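/- Let $K$ be an infinite field. A *variety* is a Zariski-closed subset of a finite-dimensional $K$-vector space. For $\dim V=p+n$, a *Hodge dual* is a linear map $\star:\bigwedge^pV\to\bigwedge^nV^*\cong(\bigwedge^nV)^*$ of the form $\star(\omega)(\omega')=\psi(\omega\wedge\omega')$ with $\psi:\bigwedge^{p+n}V\to K$ an isomorphism; here $\bigwedge^n V^*\cong(\bigwedge^n V)^*$ via $(y_1\wedge\cdots\wedge y_n)(v_1\wedge\cdots\wedge v_n)=\det(y_i(v_j))$. A *Plücker variety* $X$ assigns to every $p\in\mathbb Z_{\ge0}$ and every finite-dimensional $K$-vector space $V$ a Zariski-closed subset $X_p(V)\subseteq\bigwedge^pV$ such that (i) for every linear map $\varphi:V\to W$, $\bigwedge^p\varphi$ maps $X_p(V)$ into $X_p(W)$, and (ii) if $\dim V=p+n$, every Hodge dual $\star:\bigwedge^pV\to\bigwedge^nV^*$ maps $X_p(V)$ into $X_n(V^*)$. It is *bounded* if $X_2(V)\neq\bigwedge^2V$ for some $V$. Let $V_\infty$ be the $K$-vector space with basis $x_i$, $i\in\mathbb Z\setminus\{0\}$, and for $n,p\in\mathbb Z_{\ge0}$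 let $V_{n,p}=\langle x_{-n},\dots,x_{-1},x_1,\dots,x_p\rangle$. The (charge-zero) *infinite wedge* $\bigwedge^{\infty/2}V_\infty$ is the direct limit of the spaces $\bigwedge^pV_{n,p}$ along the inclusions $\bigwedge^pV_{n,p}\to\bigwedge^pV_{n+1,p}$ and the maps $\bigwedge^pV_{n,p}\to\bigwedge^{p+1}V_{n,p+1}$, $\omega\mapsto\omega\wedge x_{p+1}$. The group $G_\infty=\bigcup_{n,p}\mathrm{GL}(V_{n,p})$, where $\mathrm{GL}(V_{n,p})$ acts on $V_\infty$ fixing the $x_i\notin V_{n,p}$, acts on the infinite wedge: $g\in \mathrm{GL}(V_{n,p})$ acts on the image of $\bigwedge^pV_{n,p}$ through $\bigwedge^p(g|_{V_{n,p}})$. Hence it acts by algebra automorphisms on the symmetric algebra of the infinite wedge, which is the ring of polynomial functions on the dual infinite wedge $(\bigwedge^{\infty/2}V_\infty)^*$. The *limit* $X_\infty\subseteq(\bigwedge^{\infty/2}V_\infty)^*$ of $X$ is the set of all $\omega$ such that for all $n,p$ the restriction of $\omega$ to $\bigwedge^pV_{n,p}$, viewed as an element of $\bigwedge^pV_{n,p}^*$,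 lies in $X_p(V_{n,p}^*)$. **Corollary.** Let $X$ be a bounded Plücker variety over $K$. Then there are finitely many polynomials $f_1,\dots,f_k\in\mathrm{Sym}(\bigwedge^{\infty/2}V_\infty)$ such that $$X_\infty=\{\omega\in(\textstyle\bigwedge^{\infty/2}V_\infty)^* : (g f_i)(\omega)=0\text{ for all } g\in G_\infty\text{ and } i=1,\dots,k\}.$$ -/

import Mathlib

open scoped exteriorPower

noncomputable section

namespace PluckerLimit

universe u

section FiniteDimensional

variable (K : Type u) [Field K]

/-- A subset of a finite-dimensional vector space `W` is Zariski-closed if it is the common zero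
set of a collection of polynomial functions; the coordinate ring of `W` is the symmetric algebra
of `W*`, and a polynomial is evaluated at `w` by extending `ℓ ↦ ℓ w` to an algebra
homomorphism. -/
def IsZariskiClosed {W : Type u} [AddCommGroup W] [Module K W] (Z : Set W) : Prop :=
  ∃ S : Set (SymmetricAlgebra K (Module.Dual K W)),
    Z = {w | ∀ f ∈ S, SymmetricAlgebra.lift (Module.Dual.eval K W w) f = 0}

variable {K}

/-- The product `⋀^p V × ⋀^n V → ⋀^{p+n} V`. -/
def wedge {V : Type u} [AddCommGroup V] [Module K V] {p n : ℕ}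
    (ω : ⋀[K]^p V) (η : ⋀[K]^n V) : ⋀[K]^(p + n) V :=
  ⟨ω.1 * η.1, SetLike.mul_mem_graded ω.2 η.2⟩

/-- `star : ⋀^p V → ⋀^n V*` is a Hodge dual if `(star ω)(ω') = ψ (ω ∧ ω')` for some isomorphism
`ψ : ⋀^{p+n} V ≃ K`. Here `⋀^n V*` is identified with `(⋀^n V)*` through the determinant pairing
`⟨x₁ ∧ ⋯ ∧ xₙ, v₁ ∧ ⋯ ∧ vₙ⟩ = det (x_i (v_j))`. -/
def IsHodgeDual {V : Type u} [AddCommGroup V] [Module K V] {p n : ℕ}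
    (star : ⋀[K]^p V →ₗ[K] ⋀[K]^n (Module.Dual K V)) : Prop :=
  Module.finrank K V = p + n ∧
    ∃ ψ : ⋀[K]^(p + n) V ≃ₗ[K] K, ∀ (ω : ⋀[K]^p V) (η : ⋀[K]^n V),
      exteriorPower.pairingDual K V n (star ω) η = ψ (wedge ω η)

variable (K)

/-- A Plücker variety. The functor `V ↦ X_p(V)` is recorded through its values on objects, since
its value on a linear map is prescribed to be the restriction of `⋀^p φ`. -/
structure PluckerVariety where
  /-- The instance `X_p(V)`. -/
  inst (p : ℕ) (V : Type u) [AddCommGroup V] [Module K V] [FiniteDimensional K V] :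
    Set (⋀[K]^p V)
  isZariskiClosed (p : ℕ) (V : Type u) [AddCommGroup V] [Module K V] [FiniteDimensional K V] :
    IsZariskiClosed K (inst p V)
  map_mem (p : ℕ) (V W : Type u) [AddCommGroup V] [Module K V] [FiniteDimensional K V]
    [AddCommGroup W] [Module K W] [FiniteDimensional K W] (φ : V →ₗ[K] W) :
    Set.MapsTo (exteriorPower.map p φ) (inst p V) (inst p W)
  hodge_mem (p n : ℕ) (V : Type u) [AddCommGroup V] [Module K V] [FiniteDimensional K V]
    (star : ⋀[K]^p V →ₗ[K] ⋀[K]^n (Module.Dual K V)) (hstar : IsHodgeDual star) :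
    Set.MapsTo star (inst p V) (inst n (Module.Dual K V))

variable {K} in
/-- A Plücker variety `X` is bounded if `X_2(V) ≠ ⋀^2 V` for some `V`. -/
def PluckerVariety.IsBounded (X : PluckerVariety K) : Prop :=
  ∃ (V : Type u) (_ : AddCommGroup V) (_ : Module K V) (_ : FiniteDimensional K V),
    X.inst 2 V ≠ Set.univ

end FiniteDimensional

section InfiniteWedge

/-- The index set `-ℕ ∪ ℕ`, i.e. the nonzero integers. -/
abbrev Idx : Type := {i : ℤ // i ≠ 0}

variable (K : Type u) [Field K]

/-- The space `V_∞` with basis `x_i`, `i` a nonzero integer. -/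
def VInf : Type u := Idx →₀ K

instance : AddCommGroup (VInf K) := inferInstanceAs (AddCommGroup (Idx →₀ K))

instance : Module K (VInf K) := inferInstanceAs (Module K (Idx →₀ K))

/-- The basis vector `x_i` of `V_∞`. -/
def x (i : Idx) : VInf K := Finsupp.single i 1

/-- `V_{n,p} = ⟨x_{-n}, …, x_{-1}, x_1, …, x_p⟩`. -/
def Vnp (n p : ℕ) : Submodule K (VInf K) :=
  Submodule.span K (x K '' {i : Idx | -(n : ℤ) ≤ i ∧ (i : ℤ) ≤ p})

instance (n p : ℕ) : FiniteDimensional K (Vnp K n p) := by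
  refine FiniteDimensional.span_of_finite K (Set.Finite.image _ ?_)
  exact Set.Finite.of_finite_image
    ((Set.finite_Icc (-(n : ℤ)) p).subset (by rintro _ ⟨i, hi, rfl⟩; exact hi))
    Subtype.val_injective.injOn

variable {K} in
theorem x_mem_Vnp {n p : ℕ} {i : Idx} (h₁ : -(n : ℤ) ≤ i) (h₂ : (i : ℤ) ≤ p) :
    x K i ∈ Vnp K n p :=
  Submodule.subset_span ⟨i, ⟨h₁, h₂⟩, rfl⟩

theorem Vnp_mono {n p n' p' : ℕ} (hn : n ≤ n') (hp : p ≤ p') : Vnp K n p ≤ Vnp K n' p' := by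
  refine Submodule.span_mono (Set.image_mono ?_)
  rintro i ⟨h₁, h₂⟩
  exact ⟨by omega, by omega⟩

/-- The index `k + 1` for a natural number `k`. -/
def posIdx (k : ℕ) : Idx := ⟨(k : ℤ) + 1, by omega⟩

/-- `x_{k+1}` as an element of `V_{n,p}`, for `k < p`. -/
def xpos (n p k : ℕ) (hk : k < p) : Vnp K n p :=
  ⟨x K (posIdx k), x_mem_Vnp (by simp only [posIdx]; omega) (by simp only [posIdx]; omega)⟩

/-- The map `⋀^p V_{n,p} → ⋀^{p'} V_{n',p'}`, `ω ↦ ω ∧ x_{p+1} ∧ ⋯ ∧ x_{p'}`, which is the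
composition of vertical and horizontal arrows of the two-dimensional diagram; the pair `(n, p)`
is recorded as a single index in `ℕ × ℕ` with its product order. -/
def trans (a b : ℕ × ℕ) (h : a ≤ b) :
    ⋀[K]^a.2 (Vnp K a.1 a.2) →ₗ[K] ⋀[K]^b.2 (Vnp K b.1 b.2) where
  toFun ω :=
    ⟨(exteriorPower.map a.2 (Submodule.inclusion (Vnp_mono K h.1 h.2)) ω).1 *
        (exteriorPower.ιMulti K (b.2 - a.2)
          (fun k => xpos K b.1 b.2 (a.2 + k) (by omega))).1, by
      have := SetLike.mul_mem_graded
        (exteriorPower.map a.2 (Submodule.inclusion (Vnp_mono K h.1 h.2)) ω).2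
        (exteriorPower.ιMulti K (b.2 - a.2)
          (fun k => xpos K b.1 b.2 (a.2 + k) (by omega))).2
      rwa [Nat.add_sub_cancel' h.2] at this⟩
  map_add' ω η := by ext; simp [add_mul]
  map_smul' c ω := by ext; simp

/-- The (charge zero part of the) infinite wedge, the direct limit of the `⋀^p V_{n,p}`. -/
def InfWedge : Type u :=
  Module.DirectLimit (fun a : ℕ × ℕ => ⋀[K]^a.2 (Vnp K a.1 a.2)) (trans K)

instance : AddCommGroup (InfWedge K) := inferInstanceAs (AddCommGroup
  (Module.DirectLimit (fun a : ℕ × ℕ => ⋀[K]^a.2 (Vnp K a.1 a.2)) (trans K)))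

instance : Module K (InfWedge K) := inferInstanceAs (Module K
  (Module.DirectLimit (fun a : ℕ × ℕ => ⋀[K]^a.2 (Vnp K a.1 a.2)) (trans K)))

/-- The canonical map `⋀^p V_{n,p} → ⋀^{∞/2} V_∞`, with `a = (n, p)`. -/
def toInfWedge (a : ℕ × ℕ) : ⋀[K]^a.2 (Vnp K a.1 a.2) →ₗ[K] InfWedge K :=
  Module.DirectLimit.of K (ℕ × ℕ) (fun a : ℕ × ℕ => ⋀[K]^a.2 (Vnp K a.1 a.2)) (trans K) a

variable {K} in
/-- The limit `X_∞` of a Plücker variety: all elements `ω` of the dual infinite wedge such that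
for all `n, p` the image of `ω` in `⋀^p V_{n,p}^*` (that is, its restriction to `⋀^p V_{n,p}`)
lies in `X_{n,p} = X_p(V_{n,p}^*)`. -/
def PluckerVariety.limit (X : PluckerVariety K) : Set (Module.Dual K (InfWedge K)) :=
  {ω | ∀ n p : ℕ, ∃ η ∈ X.inst p (Module.Dual K (Vnp K n p)),
    exteriorPower.pairingDual K (Vnp K n p) p η = ω ∘ₗ toInfWedge K (n, p)}

end InfiniteWedge

section Group

variable (K : Type u) [Field K]

/-- `G_{n,p} = GL(V_{n,p})` as a group of automorphisms of `V_∞`: those preserving `V_{n,p}` and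
fixing the basis vectors outside `V_{n,p}`. -/
def Gnp (a : ℕ × ℕ) : Subgroup (VInf K ≃ₗ[K] VInf K) where
  carrier := {g | (Vnp K a.1 a.2).map g.toLinearMap = Vnp K a.1 a.2 ∧
    ∀ i : Idx, ¬ (-(a.1 : ℤ) ≤ i ∧ (i : ℤ) ≤ a.2) → g (x K i) = x K i}
  one_mem' := ⟨Submodule.map_id _, fun _ _ => rfl⟩
  mul_mem' := by
    rintro g h ⟨hg, hg'⟩ ⟨hh, hh'⟩
    refine ⟨?_, fun i hi => ?_⟩
    · change Submodule.map (g.toLinearMap ∘ₗ h.toLinearMap) _ = _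
      rw [Submodule.map_comp, hh, hg]
    · rw [LinearEquiv.mul_apply, hh' i hi, hg' i hi]
  inv_mem' := by
    rintro g ⟨hg, hg'⟩
    refine ⟨?_, fun i hi => ?_⟩
    · conv_lhs => rw [← hg]
      rw [← Submodule.map_comp]
      convert Submodule.map_id _
      ext1 v
      exact g.symm_apply_apply _
    · change g.symm (x K i) = x K i
      rw [LinearEquiv.symm_apply_eq, hg' i hi]

variable {K}

theorem Gnp_mono {a b : ℕ × ℕ} (h : a ≤ b) : Gnp K a ≤ Gnp K b := by
  rintro g ⟨hg, hg'⟩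
  have hn := h.1
  have hp := h.2
  refine ⟨?_, fun i hi => hg' i fun ⟨h₁, h₂⟩ => hi ⟨by omega, by omega⟩⟩
  have key : Vnp K b.1 b.2 = Vnp K a.1 a.2 ⊔ Submodule.span K
      (x K '' {i : Idx | (-(b.1 : ℤ) ≤ i ∧ (i : ℤ) ≤ b.2) ∧
        ¬ (-(a.1 : ℤ) ≤ i ∧ (i : ℤ) ≤ a.2)}) := by
    rw [Vnp, Vnp, ← Submodule.span_union, ← Set.image_union]
    congr 2
    ext i
    simp only [Set.mem_ofPred_eq, Set.mem_union]
    omega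
  rw [key, Submodule.map_sup, hg, Submodule.map_span]
  congr 2
  ext v
  constructor
  · rintro ⟨_, ⟨i, hi, rfl⟩, rfl⟩
    exact ⟨i, hi, (hg' i hi.2).symm⟩
  · rintro ⟨i, hi, rfl⟩
    exact ⟨_, ⟨i, hi, rfl⟩, hg' i hi.2⟩

variable (K) in
/-- `G_∞ = ⋃ G_{n,p}`. -/
def GInf : Subgroup (VInf K ≃ₗ[K] VInf K) where
  carrier := {g | ∃ a : ℕ × ℕ, g ∈ Gnp K a}
  one_mem' := ⟨0, one_mem _⟩
  mul_mem' := by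
    rintro g h ⟨a, ha⟩ ⟨b, hb⟩
    exact ⟨a ⊔ b, mul_mem (Gnp_mono le_sup_left ha) (Gnp_mono le_sup_right hb)⟩
  inv_mem' := by
    rintro g ⟨a, ha⟩
    exact ⟨a, inv_mem ha⟩

/-- The restriction of `g ∈ G_{n,p}` to `V_{n,p}`. -/
def restr (a : ℕ × ℕ) (g : VInf K ≃ₗ[K] VInf K) (hg : g ∈ Gnp K a) :
    Vnp K a.1 a.2 →ₗ[K] Vnp K a.1 a.2 :=
  g.toLinearMap.restrict fun v hv => by
    have h : (Vnp K a.1 a.2).map g.toLinearMap = Vnp K a.1 a.2 := hg.1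
    rw [← h]
    exact ⟨v, hv, rfl⟩

/-- The action of `g ∈ G_{n,p}` on `⋀^p V_{n,p}`. -/
def extAct (a : ℕ × ℕ) (g : VInf K ≃ₗ[K] VInf K) (hg : g ∈ Gnp K a) :
    ⋀[K]^a.2 (Vnp K a.1 a.2) →ₗ[K] ⋀[K]^a.2 (Vnp K a.1 a.2) :=
  exteriorPower.map a.2 (restr a g hg)

theorem map_subtype_injective (a : ℕ × ℕ) :
    Function.Injective (ExteriorAlgebra.map (Vnp K a.1 a.2).subtype) :=
  ExteriorAlgebra.map_injective_field (Submodule.ker_subtype _)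

theorem coe_map {M N : Type u} [AddCommGroup M] [Module K M] [AddCommGroup N] [Module K N]
    (n : ℕ) (f : M →ₗ[K] N) (ω : ⋀[K]^n M) :
    (exteriorPower.map n f ω : ExteriorAlgebra K N) = ExteriorAlgebra.map f ω.1 := by
  have h : (⋀[K]^n N).subtype ∘ₗ exteriorPower.map n f =
      (ExteriorAlgebra.map f).toLinearMap ∘ₗ (⋀[K]^n M).subtype := by
    ext v
    simp [ExteriorAlgebra.map_apply_ιMulti]
  exact congr($h ω)

/-- The product `x_{p+1} ∧ ⋯ ∧ x_{p+m}` in the exterior algebra of `V_∞`. -/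
def tail (K : Type u) [Field K] (p m : ℕ) : ExteriorAlgebra K (VInf K) :=
  ((List.range' p m).map fun k => ExteriorAlgebra.ι K (x K (posIdx k))).prod

theorem tail_mul_tail (p m l : ℕ) : tail K p m * tail K (p + m) l = tail K p (m + l) := by
  rw [tail, tail, tail, ← List.prod_append, ← List.map_append]
  congr 2
  simp

theorem map_subtype_trans (a b : ℕ × ℕ) (h : a ≤ b) (ω : ⋀[K]^a.2 (Vnp K a.1 a.2)) :
    ExteriorAlgebra.map (Vnp K b.1 b.2).subtype (trans K a b h ω).1 =
      ExteriorAlgebra.map (Vnp K a.1 a.2).subtype ω.1 * tail K a.2 (b.2 - a.2) := by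
  simp only [trans, LinearMap.coe_mk, AddHom.coe_mk, map_mul, coe_map]
  congr 1
  · rw [← AlgHom.comp_apply, ExteriorAlgebra.map_comp_map, Submodule.subtype_comp_inclusion]
  · rw [exteriorPower.ιMulti_apply_coe, ExteriorAlgebra.map_apply_ιMulti,
      ExteriorAlgebra.ιMulti_apply, tail]
    congr 1
    apply List.ext_getElem
    · simp
    · intro i h₁ h₂
      simp [xpos]

theorem map_subtype_extAct (a : ℕ × ℕ) (g : VInf K ≃ₗ[K] VInf K) (hg : g ∈ Gnp K a)
    (ω : ⋀[K]^a.2 (Vnp K a.1 a.2)) :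
    ExteriorAlgebra.map (Vnp K a.1 a.2).subtype (extAct a g hg ω).1 =
      ExteriorAlgebra.map g.toLinearMap (ExteriorAlgebra.map (Vnp K a.1 a.2).subtype ω.1) := by
  rw [extAct, coe_map, ← AlgHom.comp_apply, ← AlgHom.comp_apply, ExteriorAlgebra.map_comp_map,
    ExteriorAlgebra.map_comp_map]
  rfl

theorem map_tail (a : ℕ × ℕ) (g : VInf K ≃ₗ[K] VInf K) (hg : g ∈ Gnp K a) (m : ℕ) :
    ExteriorAlgebra.map g.toLinearMap (tail K a.2 m) = tail K a.2 m := by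
  rw [tail, map_list_prod, List.map_map]
  congr 1
  refine List.map_congr_left fun k hk => ?_
  have h : g (x K (posIdx k)) = x K (posIdx k) := by
    refine hg.2 _ fun h => ?_
    have h₁ := h.2
    simp only [posIdx] at h₁
    rw [List.mem_range'_1] at hk
    omega
  simp [h]

theorem trans_trans (a b c : ℕ × ℕ) (hab : a ≤ b) (hbc : b ≤ c)
    (ω : ⋀[K]^a.2 (Vnp K a.1 a.2)) :
    trans K b c hbc (trans K a b hab ω) = trans K a c (hab.trans hbc) ω := by
  apply Subtype.ext
  apply map_subtype_injective
  have h₁ := hab.2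
  have h₂ := hbc.2
  rw [map_subtype_trans, map_subtype_trans, map_subtype_trans, mul_assoc]
  congr 1
  have := tail_mul_tail (K := K) a.2 (b.2 - a.2) (c.2 - b.2)
  rwa [Nat.add_sub_cancel' h₁, show b.2 - a.2 + (c.2 - b.2) = c.2 - a.2 by omega] at this

theorem trans_extAct (a b : ℕ × ℕ) (h : a ≤ b) (g : VInf K ≃ₗ[K] VInf K) (hg : g ∈ Gnp K a)
    (ω : ⋀[K]^a.2 (Vnp K a.1 a.2)) :
    trans K a b h (extAct a g hg ω) = extAct b g (Gnp_mono h hg) (trans K a b h ω) := by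
  apply Subtype.ext
  apply map_subtype_injective
  rw [map_subtype_trans, map_subtype_extAct, map_subtype_extAct, map_subtype_trans, map_mul,
    map_tail a g hg]

theorem toInfWedge_trans (a b : ℕ × ℕ) (h : a ≤ b) (ω : ⋀[K]^a.2 (Vnp K a.1 a.2)) :
    toInfWedge K b (trans K a b h ω) = toInfWedge K a ω :=
  Module.DirectLimit.of_f

/-- For `g ∈ G_{n',p'}` and `ω ∈ ⋀^{p''} V_{n'',p''}`, the element `g ω` of the infinite wedge:
one regards `g` as an element of `G_{n,p}` and `ω` as an element of `⋀^p V_{n,p}`, where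
`n = max n' n''` and `p = max p' p''`, and acts there. Here `c = (n', p')`, `a = (n'', p'')`. -/
def actAt (g : VInf K ≃ₗ[K] VInf K) (c : ℕ × ℕ) (hg : g ∈ Gnp K c) (a : ℕ × ℕ) :
    ⋀[K]^a.2 (Vnp K a.1 a.2) →ₗ[K] InfWedge K :=
  toInfWedge K (a ⊔ c) ∘ₗ extAct (a ⊔ c) g (Gnp_mono le_sup_right hg) ∘ₗ
    trans K a (a ⊔ c) le_sup_left

theorem actAt_trans (g : VInf K ≃ₗ[K] VInf K) (c : ℕ × ℕ) (hg : g ∈ Gnp K c) (a b : ℕ × ℕ)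
    (hab : a ≤ b) (ω : ⋀[K]^a.2 (Vnp K a.1 a.2)) :
    actAt g c hg b (trans K a b hab ω) = actAt g c hg a ω := by
  have h : a ⊔ c ≤ b ⊔ c := sup_le_sup_right hab _
  rw [actAt, actAt, LinearMap.comp_apply, LinearMap.comp_apply, LinearMap.comp_apply,
    LinearMap.comp_apply, ← toInfWedge_trans _ _ h, trans_extAct, trans_trans, trans_trans]

/-- The action of `g ∈ G_∞` on the infinite wedge. -/
def act (g : GInf K) : InfWedge K →ₗ[K] InfWedge K :=
  Module.DirectLimit.lift K (ℕ × ℕ) (fun a : ℕ × ℕ => ⋀[K]^a.2 (Vnp K a.1 a.2)) (trans K)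
    (actAt g.1 g.2.choose g.2.choose_spec) (actAt_trans g.1 g.2.choose g.2.choose_spec)

/-- The action does not depend on the level at which it is computed. -/
theorem act_toInfWedge (g : GInf K) (a : ℕ × ℕ) (hg : g.1 ∈ Gnp K a)
    (ω : ⋀[K]^a.2 (Vnp K a.1 a.2)) :
    act g (toInfWedge K a ω) = toInfWedge K a (extAct a g.1 hg ω) := by
  have h : act g (toInfWedge K a ω) = actAt g.1 g.2.choose g.2.choose_spec a ω :=
    Module.DirectLimit.lift_of _ _ _
  rw [h, actAt, LinearMap.comp_apply, LinearMap.comp_apply, ← trans_extAct (hg := hg),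
    toInfWedge_trans]

theorem exists_toInfWedge (b : ℕ × ℕ) (z : InfWedge K) :
    ∃ a, b ≤ a ∧ ∃ ω, toInfWedge K a ω = z := by
  obtain ⟨a, ω, rfl⟩ := Module.DirectLimit.exists_of z
  exact ⟨a ⊔ b, le_sup_right, trans K a _ le_sup_left ω, toInfWedge_trans _ _ _ _⟩

theorem extAct_one (a : ℕ × ℕ) : extAct a 1 (one_mem (Gnp K a)) = LinearMap.id :=
  exteriorPower.map_id

theorem extAct_mul (a : ℕ × ℕ) (g h : VInf K ≃ₗ[K] VInf K) (hg : g ∈ Gnp K a)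
    (hh : h ∈ Gnp K a) :
    extAct a (g * h) (mul_mem hg hh) = extAct a g hg ∘ₗ extAct a h hh := by
  rw [extAct, extAct, extAct, ← exteriorPower.map_comp]
  rfl

variable (K) in
/-- The infinite wedge as a representation of `G_∞`. -/
def infWedgeRep : Representation K (GInf K) (InfWedge K) where
  toFun := act
  map_one' := by
    ext1 z
    obtain ⟨a, -, ω, rfl⟩ := exists_toInfWedge 0 z
    rw [act_toInfWedge 1 a (one_mem _)]
    exact congr(toInfWedge K a ($(extAct_one a) ω))
  map_mul' g h := by
    ext1 z
    obtain ⟨b, hb⟩ := g.2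
    obtain ⟨c, hc⟩ := h.2
    obtain ⟨a, ha, ω, rfl⟩ := exists_toInfWedge (b ⊔ c) z
    have hg : g.1 ∈ Gnp K a := Gnp_mono (le_sup_left.trans ha) hb
    have hh : h.1 ∈ Gnp K a := Gnp_mono (le_sup_right.trans ha) hc
    rw [act_toInfWedge (g * h) a (mul_mem hg hh), Module.End.mul_apply, act_toInfWedge h a hh,
      act_toInfWedge g a hg]
    exact congr(toInfWedge K a ($(extAct_mul a g.1 h.1 hg hh) ω))

end Group

section Polynomials

variable (K : Type u) [Field K]

/-- The coordinate ring of the dual infinite wedge: the symmetric algebra generated by the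
infinite wedge, i.e. the polynomial ring in the variables `x_I`. -/
abbrev CoordRing : Type u := SymmetricAlgebra K (InfWedge K)

variable {K}

/-- Evaluation of polynomials at a point of the dual infinite wedge. -/
def evalAt (ω : Module.Dual K (InfWedge K)) : CoordRing K →ₐ[K] K :=
  SymmetricAlgebra.lift ω

/-- The action of `g ∈ G_∞` on polynomials, by algebra automorphisms. -/
def polyAct (g : GInf K) : CoordRing K →ₐ[K] CoordRing K :=
  SymmetricAlgebra.lift (SymmetricAlgebra.ι K (InfWedge K) ∘ₗ infWedgeRep K g)

instance : MulAction (GInf K) (CoordRing K) where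
  smul g f := polyAct g f
  one_smul f := by
    have h : polyAct (1 : GInf K) = AlgHom.id K _ := by
      apply SymmetricAlgebra.algHom_ext
      ext1 z
      simp [polyAct]
    exact congr($h f)
  mul_smul g g' f := by
    have h : polyAct (g * g') = (polyAct g).comp (polyAct g') := by
      apply SymmetricAlgebra.algHom_ext
      ext1 z
      simp [polyAct]
    exact congr($h f)

/-- The common zero set in the dual infinite wedge of a set of polynomials. -/
def zeroSet (T : Set (CoordRing K)) : Set (Module.Dual K (InfWedge K)) :=
  {ω | ∀ f ∈ T, evalAt ω f = 0}

end Polynomials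

end PluckerLimit

end

/-! The limit of `X` is stable under `G_∞` and is cut out by the polynomials vanishing on it, so it
suffices that finitely many of these imply all others up to `G_∞`. This would follow if the dual
infinite wedge were Noetherian up to `G_∞`. Such Noetherianity is proved here on a smaller closed
set: since `X` is bounded, some nonzero polynomial `f` in the coordinates of `⋀^2 V_{n,2}` vanishes
on the limit, which therefore lies in the set where all conjugates of `f` vanish. That this set is
Noetherian up to the transvections (`noeth_van`) is the heart of the proof.

The mechanism is elimination. Let `f` vanish on the orbit of `z`, let `s` be a variable of `f`, and
deform `z` by a product of transvections with common parameter `t` that feeds the coordinate `D`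
into `s`. Then `f` vanishes identically in `t`. Taylor expansion in the direction `s` and comparison
of one power of `t` give `z_D ^ q * h(z) = p(z)`, where `h` is the Hasse derivative of least order
`q` that does not vanish, and `p` involves only lower coordinates (`exists_relation`). Minimality of
`q` makes the `q`-th power map additive. Hence where `h ≠ 0` the vanishing of any polynomial can be
tested on lower coordinates (`rootClosure`); where `h` vanishes on the whole orbit one uses
induction on the degree, as `h` has smaller degree than `f`.

Elimination is used twice. With `f` on `⋀^2 V_{n,2}` it removes every coordinate with at least two
indices below `-n` (`noeth_van_hasse_ne_zero`). The coordinates left have boundedly many indices,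
hence behave like tensors of bounded degree under the linear groups acting on the indices beyond
`[-n, n]`. There, as for polynomial functors, elimination removes one type of coordinate after
another (`noeth_of_remove_type`) until finitely many coordinates are left and Hilbert's basis
theorem applies.

In the coordinates given by semi-infinite monomials the transvections of `V_∞` act by the formulas
of the combinatorial model, up to nonzero constants, so Noetherianity carries over to the dual
infinite wedge (`noeth_dual`). Hodge duality enters through `PluckerVariety.exists_contraction`:
contraction with part of a basis is a Hodge dual, a linear map and a Hodge dual again. So the
instances of `X` at the various levels are compatible, which makes the limit stable under `G_∞`. -/

namespace PluckerLimit

/-! ### Noetherianity up to a group action. -/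

section Noetherianity

open Set

variable {K P P' : Type*} [Field K]

/-- The set `Z` is topologically Noetherian up to `G` for the closed sets cut out by functions
in `F`: there is no infinite sequence of points `z i` and functions `f i` such that `f i` does not
vanish at `z i`, while every earlier function vanishes on the orbit of `z i`. -/
def Noeth (G : Subgroup (Equiv.Perm P)) (F : Set (P → K)) (Z : Set P) : Prop :=
  ∀ (z : ℕ → P) (f : ℕ → P → K), (∀ i, z i ∈ Z) → (∀ i, f i ∈ F) →
    ∃ i, f i (z i) = 0 ∨ ∃ j < i, ∃ g ∈ G, f j (g (z i)) ≠ 0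

/-- The largest `G`-stable set on which `f` vanishes. -/
def van (G : Subgroup (Equiv.Perm P)) (f : P → K) : Set P := {z | ∀ g ∈ G, f (g z) = 0}

theorem van_stable {G : Subgroup (Equiv.Perm P)} {f : P → K} {g : Equiv.Perm P} (hg : g ∈ G)
    {z : P} (hz : z ∈ van G f) : g z ∈ van G f := fun g' hg' => hz (g' * g) (mul_mem hg' hg)

theorem Noeth.mono {G : Subgroup (Equiv.Perm P)} {F F' : Set (P → K)} {Z Z' : Set P}
    (h : Noeth G F' Z') (hF : F ⊆ F') (hZ : Z ⊆ Z') : Noeth G F Z :=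
  fun z f hz hf => h z f (fun i => hZ (hz i)) (fun i => hF (hf i))

theorem Noeth.empty (G : Subgroup (Equiv.Perm P)) (F : Set (P → K)) : Noeth G F ∅ :=
  fun _ _ hz _ => (hz 0).elim

/-- A sequence in the union visits one of the two sets infinitely often, and a bad sequence stays
bad after passing to a subsequence. -/
theorem Noeth.union {G : Subgroup (Equiv.Perm P)} {F : Set (P → K)} {Z₁ Z₂ : Set P}
    (h₁ : Noeth G F Z₁) (h₂ : Noeth G F Z₂) : Noeth G F (Z₁ ∪ Z₂) := by
  have sub : ∀ {Z : Set P}, Noeth G F Z → ∀ (z : ℕ → P) (f : ℕ → P → K), (∀ i, f i ∈ F) →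
      {i | z i ∈ Z}.Infinite → ∃ i, f i (z i) = 0 ∨ ∃ j < i, ∃ g ∈ G, f j (g (z i)) ≠ 0 := by
    intro Z h z f hf hinf
    obtain ⟨φ, hφ, hφZ⟩ := Nat.exists_strictMono_subsequence
      (P := fun i => z i ∈ Z) (fun N => (hinf.exists_gt N).imp fun n hn => ⟨hn.2, hn.1⟩)
    obtain ⟨i, hi | ⟨j, hj, hg⟩⟩ := h (z ∘ φ) (f ∘ φ) (fun i => hφZ i) (fun i => hf _)
    · exact ⟨φ i, Or.inl hi⟩
    · exact ⟨φ i, Or.inr ⟨φ j, hφ hj, hg⟩⟩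
  intro z f hz hf
  by_cases hinf : {i | z i ∈ Z₁}.Infinite
  · exact sub h₁ z f hf hinf
  · refine sub h₂ z f hf ?_
    have hcompl := (Set.not_infinite.1 hinf).infinite_compl
    exact hcompl.mono fun i hi => (hz i).resolve_left hi

/-- Earlier functions are tested on whole orbits, so `z i` may be replaced by a translate `g i (z
i)` provided that `f i` is replaced by its composition with the inverse of `g i`. -/
theorem Noeth.of_orbit {G : Subgroup (Equiv.Perm P)} {F : Set (P → K)} {Z Z₀ : Set P}
    (h : Noeth G F Z₀) (hF : ∀ g ∈ G, ∀ f ∈ F, (fun z => f (g z)) ∈ F)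
    (hZ : ∀ z ∈ Z, ∃ g ∈ G, g z ∈ Z₀) : Noeth G F Z := by
  intro z f hz hf
  choose g hg hgz using fun i => hZ (z i) (hz i)
  obtain ⟨i, hi | ⟨j, hj, g', hg', hne⟩⟩ := h (fun i => g i (z i)) (fun i w => f i ((g i)⁻¹ w)) hgz
    (fun i => hF _ (inv_mem (hg i)) _ (hf i))
  · refine ⟨i, Or.inl ?_⟩
    simpa using hi
  · exact ⟨i, Or.inr ⟨j, hj, (g j)⁻¹ * g' * g i,
      mul_mem (mul_mem (inv_mem (hg j)) hg') (hg i), hne⟩⟩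

/-- A bad sequence is pushed forward along `φ`. Only zero sets of functions matter, so functions
need to descend merely up to having the same zeros on `Z`, and the group below only has to be
liftable. -/
theorem Noeth.transfer {G : Subgroup (Equiv.Perm P)} {G' : Subgroup (Equiv.Perm P')}
    {F : Set (P → K)} {F' : Set (P' → K)} {Z : Set P} {Z' : Set P'} (h : Noeth G' F' Z')
    (φ : P → P') (hφ : ∀ z ∈ Z, φ z ∈ Z')
    (hG : ∀ g' ∈ G', ∃ g ∈ G, ∀ z ∈ Z, g z ∈ Z ∧ φ (g z) = g' (φ z))
    (hF : ∀ f ∈ F, ∃ f' ∈ F', ∀ z ∈ Z, (f z = 0 ↔ f' (φ z) = 0)) : Noeth G F Z := by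
  intro z f hz hf
  choose f' hf' hff' using fun i => hF (f i) (hf i)
  obtain ⟨i, hi | ⟨j, hj, g', hg', hne⟩⟩ := h (fun i => φ (z i)) f' (fun i => hφ _ (hz i)) hf'
  · exact ⟨i, Or.inl ((hff' i _ (hz i)).2 hi)⟩
  · obtain ⟨g, hg, hgz⟩ := hG g' hg'
    refine ⟨i, Or.inr ⟨j, hj, g, hg, fun h0 => hne ?_⟩⟩
    rw [← (hgz _ (hz i)).2]
    exact (hff' j _ (hgz _ (hz i)).1).1 h0

/-- Induction on closed stable subsets of a Noetherian space. -/
theorem Noeth.induction {G : Subgroup (Equiv.Perm P)} {F : Set (P → K)} (h : Noeth G F univ)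
    (Q : Set P → Prop)
    (step : ∀ X, (∀ f ∈ F, (∃ z ∈ X, f z ≠ 0) → Q (X ∩ van G f)) → Q X) : Q univ := by
  by_contra hQ
  have step' : ∀ X : {X // ¬ Q X}, ∃ f ∈ F, (∃ z ∈ X.1, f z ≠ 0) ∧ ¬ Q (X.1 ∩ van G f) := by
    rintro ⟨X, hX⟩
    by_contra hcon
    push Not at hcon
    exact hX (step X fun f hf ⟨z, hz, hfz⟩ => hcon f hf ⟨z, hz, hfz⟩)
  choose f hf hz hQ' using step'
  choose z hzX hzf using hz
  -- Failure of `Q univ` produces a descending chain of sets. Its witnesses contradict `h`, because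
  -- a point of a later set lies in the vanishing set of every earlier function.
  let X : ℕ → {X // ¬ Q X} := fun n => Nat.rec ⟨univ, hQ⟩ (fun _ Y => ⟨Y.1 ∩ van G (f Y), hQ' Y⟩) n
  have hX : ∀ n, (X (n + 1)).1 = (X n).1 ∩ van G (f (X n)) := fun n => rfl
  have hanti : Antitone fun n => (X n).1 := antitone_nat_of_succ_le fun n => by
    rw [hX]; exact inter_subset_left
  obtain ⟨i, hi | ⟨j, hj, g, hg, hne⟩⟩ := h (fun n => z (X n)) (fun n => f (X n))
    (fun _ => mem_univ _) (fun _ => hf _)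
  · exact hzf _ hi
  · have h1 : z (X i) ∈ (X (j + 1)).1 := hanti (Nat.succ_le_of_lt hj) (hzX _)
    rw [hX] at h1
    exact hne (h1.2 g hg)

/-- In a Noetherian stable set, any family of equations may be replaced by a finite subfamily. -/
theorem Noeth.exists_finset {G : Subgroup (Equiv.Perm P)} {F : Set (P → K)} {Z : Set P}
    (h : Noeth G F Z) (hZ : ∀ g ∈ G, ∀ z ∈ Z, g z ∈ Z) (S : Set (P → K)) (hS : S ⊆ F) :
    ∃ T : Finset (P → K), (T : Set (P → K)) ⊆ S ∧
      ∀ z ∈ Z, (∀ f ∈ T, z ∈ van G f) → ∀ f ∈ S, z ∈ van G f := by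
  by_contra hcon
  push Not at hcon
  -- If no finite subfamily suffices, points and equations can be chosen recursively, each new point
  -- satisfying all conjugates of the earlier equations but not its own equation.
  have key := exists_seq_of_forall_finset_exists
    (fun x : P × (P → K) => x.1 ∈ Z ∧ x.2 ∈ S ∧ x.2 x.1 ≠ 0)
    (fun x y => y.1 ∈ van G x.2) ?_
  · obtain ⟨s, hs, hs'⟩ := key
    obtain ⟨i, hi | ⟨j, hj, g, hg, hne⟩⟩ := h (fun i => (s i).1) (fun i => (s i).2)
      (fun i => (hs i).1) (fun i => hS (hs i).2.1)
    · exact (hs i).2.2 hi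
    · exact hne (hs' j i hj g hg)
  · intro s hs
    classical
    obtain ⟨z, hz, hzT, f, hf, hzf⟩ := hcon (s.image Prod.snd) (by
      intro f hf
      obtain ⟨x, hx, rfl⟩ := Finset.mem_image.1 (Finset.mem_coe.1 hf)
      exact (hs x hx).2.1)
    simp only [van, mem_ofPred_eq, not_forall] at hzf
    obtain ⟨g, hg, hne⟩ := hzf
    exact ⟨(g z, f), ⟨hZ g hg z hz, hf, hne⟩,
      fun x hx => van_stable hg (hzT _ (Finset.mem_image_of_mem _ hx))⟩

end Noetherianity

/-! ### Polynomial functions in prescribed coordinates. -/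

section PolynomialFunctions

open Set

variable {K : Type*} [Field K] {σ : Type*}

variable (K) in
/-- The functions on `σ → K` which are polynomial in the coordinates indexed by `S`. -/
noncomputable def polyFun (S : Set σ) : Subalgebra K ((σ → K) → K) :=
  (MvPolynomial.supported K S).map (MvPolynomial.aeval fun s z => z s)

theorem aeval_coord (f : MvPolynomial σ K) (z : σ → K) :
    (MvPolynomial.aeval (fun s (z : σ → K) => z s) f : (σ → K) → K) z =
      MvPolynomial.eval z f := by
  have h : ((Pi.evalAlgHom K (fun _ : σ → K => K) z).comp
      (MvPolynomial.aeval fun s (z : σ → K) => z s)) = MvPolynomial.aeval z := by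
    apply MvPolynomial.algHom_ext
    intro s
    simp
  exact congr($h f)

theorem mem_polyFun {S : Set σ} {F : (σ → K) → K} :
    F ∈ polyFun K S ↔ ∃ f ∈ MvPolynomial.supported K S, ∀ z, F z = MvPolynomial.eval z f := by
  simp only [polyFun, Subalgebra.mem_map]
  refine exists_congr fun f => and_congr_right fun _ => ?_
  rw [funext_iff]
  exact forall_congr' fun z => by rw [← aeval_coord, eq_comm]

theorem coord_mem_polyFun {S : Set σ} {s : σ} (hs : s ∈ S) :
    (fun z : σ → K => z s) ∈ polyFun K S :=
  mem_polyFun.2 ⟨MvPolynomial.X s, MvPolynomial.X_mem_supported.2 hs, fun z => by simp⟩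

theorem polyFun_mono {S S' : Set σ} (h : S ⊆ S') : polyFun K S ≤ polyFun K S' :=
  Subalgebra.map_mono (MvPolynomial.supported_mono h)

theorem polyFun_le {S : Set σ} {A : Subalgebra K ((σ → K) → K)}
    (h : ∀ s ∈ S, (fun z : σ → K => z s) ∈ A) : polyFun K S ≤ A := by
  rw [polyFun, MvPolynomial.supported, AlgHom.map_adjoin, Algebra.adjoin_le_iff]
  rintro _ ⟨_, ⟨s, hs, rfl⟩, rfl⟩
  simpa using h s hs

theorem eval_eq_of_supported {S : Set σ} {f : MvPolynomial σ K} (hf : f ∈ MvPolynomial.supported K S)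
    {z w : σ → K} (h : ∀ s ∈ S, z s = w s) : MvPolynomial.eval z f = MvPolynomial.eval w f := by
  rw [MvPolynomial.mem_supported] at hf
  exact MvPolynomial.eval₂Hom_congr' rfl (fun s hs _ => h s (hf hs)) rfl

theorem polyFun_congr {S : Set σ} {F : (σ → K) → K} (hF : F ∈ polyFun K S) {z w : σ → K}
    (h : ∀ s ∈ S, z s = w s) : F z = F w := by
  obtain ⟨f, hf, hfF⟩ := mem_polyFun.1 hF
  rw [hfF, hfF, eval_eq_of_supported hf h]

/-- Hilbert's basis theorem. -/
theorem Noeth.of_finite (G : Subgroup (Equiv.Perm (σ → K))) {S : Set σ} (hS : S.Finite) :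
    Noeth G (polyFun K S : Set ((σ → K) → K)) univ := by
  intro z F _ hF
  have : Finite S := hS
  have hF' : ∀ i, ∃ f : MvPolynomial S K, ∀ z : σ → K,
      F i z = MvPolynomial.eval (fun s : S => z s) f := by
    intro i
    obtain ⟨f, hf, hfF⟩ := mem_polyFun.1 (hF i)
    rw [MvPolynomial.supported_eq_range_rename] at hf
    obtain ⟨f', rfl⟩ := hf
    refine ⟨f', fun z => ?_⟩
    rw [hfF]
    exact MvPolynomial.eval_rename _ _ _
  choose f hf using hF'
  -- The ideals generated by the first polynomials stabilise, so some `f n` lies in the ideal of its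
  -- predecessors. Vanishing of these at `z n` itself then suffices: only the identity of `G` is
  -- used.
  let I : ℕ →o Ideal (MvPolynomial S K) :=
    ⟨fun n => Ideal.span (f '' {j | j < n}), fun m n hmn =>
      Ideal.span_mono (image_mono fun j (hj : j < m) => hj.trans_le hmn)⟩
  obtain ⟨n, hn⟩ := monotone_stabilizes_iff_noetherian.2
    (inferInstance : IsNoetherianRing (MvPolynomial S K)) I
  have hmem : f n ∈ I n := by
    rw [hn (n + 1) (Nat.le_succ n)]
    exact Ideal.subset_span ⟨n, Nat.lt_succ_self n, rfl⟩
  refine ⟨n, ?_⟩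
  by_contra hcon
  push Not at hcon
  refine hcon.1 ?_
  rw [hf]
  have : I n ≤ RingHom.ker (MvPolynomial.eval (fun s : S => z n s)) := by
    refine Ideal.span_le.2 ?_
    rintro _ ⟨j, hj, rfl⟩
    have := hcon.2 j hj 1 (one_mem _)
    rwa [hf] at this
  exact this hmem

end PolynomialFunctions

end PluckerLimit

namespace PluckerLimit

/-! ### Hasse derivatives and Taylor expansion in one variable. -/

section HasseDerivative

open MvPolynomial

variable {K : Type*} [Field K] {σ : Type*}

theorem eval_eq_aeval (z : σ → K) (f : MvPolynomial σ K) : eval z f = aeval z f := by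
  rw [aeval_eq_eval]

theorem aeval_mem_of_forall {A : Type*} [CommRing A] [Algebra K A] {B : Subalgebra K A}
    {b : σ → A} (f : MvPolynomial σ K) (hb : ∀ r, b r ∈ B) : aeval b f ∈ B := by
  have : (aeval b : MvPolynomial σ K →ₐ[K] A).range ≤ B := by
    rw [← Algebra.adjoin_range_eq_range_aeval, Algebra.adjoin_le_iff]
    rintro _ ⟨r, rfl⟩
    exact hb r
  exact this ⟨f, rfl⟩

variable [DecidableEq σ]

/-- The translate of a point by `y` in the direction `s`. -/
def shift {A : Type*} [AddZeroClass A] (s : σ) (z : σ → A) (y : A) : σ → A :=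
  fun r => z r + if r = s then y else 0

/-- The Taylor expansion of a polynomial in the direction of the variable `s`. -/
noncomputable def taylorHom (s : σ) : MvPolynomial σ K →ₐ[K] Polynomial (MvPolynomial σ K) :=
  aeval (shift s (fun r => Polynomial.C (X r)) Polynomial.X)

/-- The Hasse derivative of order `d` with respect to the variable `s`. -/
noncomputable def hasse (s : σ) (d : ℕ) (f : MvPolynomial σ K) : MvPolynomial σ K :=
  (taylorHom s f).coeff d

theorem aeval_shift {A : Type*} [CommRing A] [Algebra K A] (s : σ) (b : σ → A) (y : A)
    (f : MvPolynomial σ K) :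
    aeval (shift s b y) f = Polynomial.eval₂ (aeval b : MvPolynomial σ K →ₐ[K] A).toRingHom y
      (taylorHom s f) := by
  induction f using MvPolynomial.induction_on with
  | C a => simp [taylorHom, Polynomial.algebraMap_apply]
  | add p q hp hq => simp only [map_add, hp, hq, Polynomial.eval₂_add]
  | mul_X p r hp =>
    rw [map_mul, hp, map_mul, Polynomial.eval₂_mul]
    congr 1
    simp only [taylorHom, aeval_X, shift, Polynomial.eval₂_add, Polynomial.eval₂_C]
    split_ifs <;> simp

theorem aeval_shift_eq_sum {A : Type*} [CommRing A] [Algebra K A] (s : σ) (b : σ → A) (y : A)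
    (f : MvPolynomial σ K) (n : ℕ) (hn : (taylorHom s f).natDegree < n) :
    aeval (shift s b y) f = ∑ d ∈ Finset.range n, aeval b (hasse s d f) * y ^ d := by
  rw [aeval_shift, Polynomial.eval₂_eq_sum_range' _ hn]
  rfl

theorem hasse_zero (s : σ) (f : MvPolynomial σ K) : hasse s 0 f = f := by
  have := aeval_shift_eq_sum s (X : σ → MvPolynomial σ K) 0 f ((taylorHom s f).natDegree + 1)
    (Nat.lt_succ_self _)
  rw [Finset.sum_eq_single_of_mem 0 (by simp) (by
    intro d _ hd; simp [hd])] at this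
  have h0 : shift s (X : σ → MvPolynomial σ K) 0 = X := by
    funext r; simp [shift]
  rw [h0, aeval_X_left] at this
  simpa using this.symm

/-- The restriction of a polynomial function to the line through `z` in the direction `s`. -/
noncomputable def linePoly (s : σ) (z : σ → K) (f : MvPolynomial σ K) : Polynomial K :=
  (taylorHom s f).map (eval z)

theorem coeff_linePoly (s : σ) (z : σ → K) (f : MvPolynomial σ K) (d : ℕ) :
    (linePoly s z f).coeff d = eval z (hasse s d f) := by
  simp [linePoly, hasse]

theorem eval_linePoly (s : σ) (z : σ → K) (f : MvPolynomial σ K) (y : K) :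
    (linePoly s z f).eval y = eval (shift s z y) f := by
  rw [linePoly, Polynomial.eval_map, eval_eq_aeval, aeval_shift]
  rfl

theorem linePoly_shift (s : σ) (z : σ → K) (f : MvPolynomial σ K) (y : K) :
    linePoly s (shift s z y) f = Polynomial.taylor y (linePoly s z f) := by
  induction f using MvPolynomial.induction_on with
  | C a => simp [linePoly, taylorHom, Polynomial.algebraMap_apply]
  | add p q hp hq => simp only [linePoly, map_add, Polynomial.map_add] at *; rw [hp, hq]
  | mul_X p r hp =>
    simp only [linePoly, map_mul, Polynomial.map_mul, Polynomial.taylor_mul] at *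
    rw [hp]
    congr 1
    simp only [taylorHom, aeval_X, shift]
    split_ifs with h
    · simp [h, shift]; ring
    · simp [shift, h]

/-- The Taylor coefficient of order `d` vanishes at every point of the line through `z`. As `K` is
infinite, the `d`-th Hasse derivative of the restriction to this line is the zero polynomial, and
its coefficient of degree `q - d` is the binomial coefficient times the nonzero `q`-th Taylor
coefficient. -/
theorem hasse_vanish_choose [Infinite K] {s : σ} {f : MvPolynomial σ K} {Y : Set (σ → K)}
    (hY : ∀ z ∈ Y, ∀ y, shift s z y ∈ Y) {q : ℕ}
    (hlow : ∀ d, 0 < d → d < q → ∀ z ∈ Y, eval z (hasse s d f) = 0)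
    {z : σ → K} (hz : z ∈ Y) (hzq : eval z (hasse s q f) ≠ 0) {d : ℕ} (hd : 0 < d) (hdq : d < q) :
    ((q.choose d : ℕ) : K) = 0 := by
  have h : Polynomial.hasseDeriv d (linePoly s z f) = 0 := by
    refine Polynomial.funext fun y => ?_
    rw [← Polynomial.taylor_coeff, ← linePoly_shift, coeff_linePoly,
      hlow d hd hdq _ (hY z hz y), Polynomial.eval_zero]
  have h' := congr(($h).coeff (q - d))
  rw [Polynomial.hasseDeriv_coeff, Nat.sub_add_cancel hdq.le, coeff_linePoly,
    Polynomial.coeff_zero] at h'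
  exact (mul_eq_zero.1 h').resolve_right hzq

/-- All intermediate binomial coefficients vanish in `K`. Thus `q = 1` in characteristic zero and
`q` is a power of the characteristic otherwise; the argument treats both cases at once. -/
theorem add_pow_of_hasse_vanish [Infinite K] {s : σ} {f : MvPolynomial σ K} {Y : Set (σ → K)}
    (hY : ∀ z ∈ Y, ∀ y, shift s z y ∈ Y) {q : ℕ} (hq : 1 ≤ q)
    (hlow : ∀ d, 0 < d → d < q → ∀ z ∈ Y, eval z (hasse s d f) = 0)
    {z : σ → K} (hz : z ∈ Y) (hzq : eval z (hasse s q f) ≠ 0) (a b : K) :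
    (a + b) ^ q = a ^ q + b ^ q := by
  rw [add_pow, Finset.sum_range_succ, ← Nat.sub_add_cancel hq, Finset.sum_range_succ',
    Finset.sum_eq_zero]
  · simp [add_comm]
  · intro d hd
    rw [Finset.mem_range] at hd
    rw [Nat.sub_add_cancel hq, hasse_vanish_choose hY hlow hz hzq (by omega) (by omega), mul_zero]

theorem eval_shift_of_hasse_vanish {s : σ} {f : MvPolynomial σ K} {z : σ → K}
    (h : ∀ d, 1 ≤ d → eval z (hasse s d f) = 0) (y : K) : eval (shift s z y) f = eval z f := by
  rw [← eval_linePoly]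
  have : linePoly s z f = Polynomial.C (eval z f) := by
    ext d
    rw [coeff_linePoly, Polynomial.coeff_C]
    split_ifs with hd
    · rw [hd, hasse_zero]
    · exact h d (by omega)
  rw [this, Polynomial.eval_C]

/-- Along a single direction in `R` the Taylor expansion is constant. The finitely many coordinates
in `R` that occur in `f` are changed one at a time, without leaving `Y`. -/
theorem eval_eq_of_hasse_vanish {R : Set σ} {f : MvPolynomial σ K} {Y : Set (σ → K)}
    (hY : ∀ z ∈ Y, ∀ z' : σ → K, (∀ r ∉ R, z r = z' r) → z' ∈ Y)
    (h : ∀ s ∈ R, ∀ d, 1 ≤ d → ∀ z ∈ Y, eval z (hasse s d f) = 0)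
    {z z' : σ → K} (hz : z ∈ Y) (hzz' : ∀ r ∉ R, z r = z' r) : eval z' f = eval z f := by
  classical
  have key : ∀ T : Finset σ, (T : Set σ) ⊆ R →
      eval (fun r => if r ∈ T then z' r else z r) f = eval z f := by
    intro T
    induction T using Finset.induction_on with
    | empty => intro _; simp
    | insert s T hs ih =>
      intro hT
      rw [Finset.coe_insert, Set.insert_subset_iff] at hT
      rw [← ih hT.2]
      have hmem : (fun r => if r ∈ T then z' r else z r) ∈ Y := by
        refine hY z hz _ fun r hr => ?_
        rw [if_neg fun h => hr (hT.2 (Finset.mem_coe.2 h))]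
      rw [← eval_shift_of_hasse_vanish (s := s) (fun d hd => h s hT.1 d hd _ hmem) (z' s - z s)]
      congr 2
      ext r
      by_cases hr : r = s
      · subst hr; simp [shift, hs]
      · simp [shift, hr]
  rw [← key (f.vars.filter (· ∈ R)) (fun r hr => (Finset.mem_filter.1 hr).2)]
  refine eval₂Hom_congr' rfl (fun r hr _ => ?_) rfl
  by_cases hrR : r ∈ R
  · simp [hr, hrR]
  · simp [hrR, hzz' r hrR]

/-- The polynomials whose coefficients lie in a given subalgebra. -/
def coeffsIn {A : Type*} [CommRing A] [Algebra K A] (B : Subalgebra K A) :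
    Subalgebra K (Polynomial A) where
  carrier := {Q | ∀ j, Q.coeff j ∈ B}
  mul_mem' {P Q} hP hQ j := by
    rw [Polynomial.coeff_mul]
    exact sum_mem fun x _ => mul_mem (hP _) (hQ _)
  add_mem' {P Q} hP hQ j := by
    rw [Polynomial.coeff_add]
    exact add_mem (hP _) (hQ _)
  algebraMap_mem' a j := by
    rw [Polynomial.algebraMap_apply, Polynomial.coeff_C]
    split_ifs
    · exact B.algebraMap_mem a
    · exact zero_mem _

theorem C_mem_coeffsIn {A : Type*} [CommRing A] [Algebra K A] {B : Subalgebra K A}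
    {a : A} (ha : a ∈ B) : Polynomial.C a ∈ coeffsIn B := fun j => by
  rw [Polynomial.coeff_C]
  split_ifs
  · exact ha
  · exact zero_mem _

theorem X_mem_coeffsIn {A : Type*} [CommRing A] [Algebra K A] (B : Subalgebra K A) :
    (Polynomial.X : Polynomial A) ∈ coeffsIn B := fun j => by
  rw [Polynomial.coeff_X]
  split_ifs
  · exact one_mem _
  · exact zero_mem _

theorem hasse_mem_supported {S : Set σ} {f : MvPolynomial σ K} (hf : f ∈ supported K S)
    (s : σ) (d : ℕ) : hasse s d f ∈ supported K S := by
  have key : supported K S ≤ (coeffsIn (supported K S)).comap (taylorHom s) := by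
    rw [supported, Algebra.adjoin_le_iff]
    rintro _ ⟨r, hr, rfl⟩
    change taylorHom s (X r : MvPolynomial σ K) ∈ coeffsIn _
    rw [taylorHom, aeval_X, shift]
    refine add_mem (C_mem_coeffsIn (Algebra.subset_adjoin ⟨r, hr, rfl⟩)) ?_
    split_ifs
    · exact X_mem_coeffsIn _
    · exact zero_mem _
  exact key hf d

theorem hasse_eq_zero_of_notMem {f : MvPolynomial σ K} {s : σ} (hs : s ∉ f.vars)
    {d : ℕ} (hd : 1 ≤ d) : hasse s d f = 0 := by
  have hf : f ∈ supported K (f.vars : Set σ) := mem_supported.2 subset_rfl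
  have key : supported K (f.vars : Set σ) ≤ (Algebra.adjoin K
      (Polynomial.C '' (Set.univ : Set (MvPolynomial σ K)) : Set (Polynomial _))).comap (taylorHom s) := by
    rw [supported, Algebra.adjoin_le_iff]
    rintro _ ⟨r, hr, rfl⟩
    change taylorHom s (X r : MvPolynomial σ K) ∈ Algebra.adjoin K (Polynomial.C '' (Set.univ : Set (MvPolynomial σ K)))
    rw [taylorHom, aeval_X, shift, if_neg (show r ≠ s from fun h => hs (h ▸ hr)), add_zero]
    exact Algebra.subset_adjoin ⟨_, trivial, rfl⟩
  have h2 : Algebra.adjoin K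
      (Polynomial.C '' (Set.univ : Set (MvPolynomial σ K)) : Set (Polynomial _)) ≤
      (Polynomial.CAlgHom : MvPolynomial σ K →ₐ[K] Polynomial (MvPolynomial σ K)).range := by
    rw [Algebra.adjoin_le_iff]
    rintro _ ⟨p, -, rfl⟩
    exact ⟨p, rfl⟩
  obtain ⟨p, hp⟩ := h2 (key hf)
  change Polynomial.C p = taylorHom s f at hp
  rw [hasse, ← hp, Polynomial.coeff_C, if_neg (by omega)]

/-- Each monomial either loses `d` from its exponent at `s` or is killed. This drop is what lets the
inductions on the degree of an equation terminate. -/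
theorem totalDegree_hasse_lt {f : MvPolynomial σ K} {s : σ} {d : ℕ} (hd : 1 ≤ d)
    (h : hasse s d f ≠ 0) : (hasse s d f).totalDegree < f.totalDegree := by
  have hmon : ∀ (m : σ →₀ ℕ) (a : K), hasse s d (monomial m a) =
      monomial (m.erase s) a * (X s ^ (m s - d) * ((m s).choose d : MvPolynomial σ K)) := by
    intro m a
    have : monomial m a = monomial (m.erase s) a * X s ^ (m s) := by
      rw [X_pow_eq_monomial, monomial_mul, mul_one, Finsupp.erase_add_single]
    have h1 : taylorHom s (monomial (m.erase s) a) = Polynomial.C (monomial (m.erase s) a) := by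
      rw [taylorHom, aeval_monomial, monomial_eq, Polynomial.C_mul, Polynomial.algebraMap_apply]
      congr 1
      rw [Finsupp.prod, Finsupp.prod, map_prod]
      refine Finset.prod_congr rfl fun r hr => ?_
      have : r ≠ s := by rintro rfl; simp at hr
      simp [shift, this]
    have h2 : taylorHom s (X s : MvPolynomial σ K) = Polynomial.X + Polynomial.C (X s) := by
      simp [taylorHom, shift, add_comm]
    rw [hasse, this, map_mul, map_pow, h1, h2, Polynomial.coeff_C_mul,
      Polynomial.coeff_X_add_C_pow]
  have hsum : hasse s d f = ∑ m ∈ f.support, hasse s d (monomial m (coeff m f)) := by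
    conv_lhs => rw [f.as_sum, hasse, map_sum, Polynomial.finsetSum_coeff]
    rfl
  have hterm : ∀ m ∈ f.support, hasse s d (monomial m (coeff m f)) = 0 ∨
      (hasse s d (monomial m (coeff m f))).totalDegree < f.totalDegree := by
    intro m hm
    rw [hmon]
    by_cases hdm : m s < d
    · left
      rw [Nat.choose_eq_zero_of_lt hdm]; simp
    · right
      have hle := le_totalDegree hm
      have hdeg : (m.sum fun _ e => e) = ((m.erase s).sum fun _ e => e) + m s := by
        conv_lhs => rw [← Finsupp.erase_add_single s m]
        rw [Finsupp.sum_add_index' (fun _ => rfl) (fun _ _ _ => rfl), Finsupp.sum_single_index rfl]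
      refine (totalDegree_mul _ _).trans_lt ?_
      have b1 := totalDegree_monomial_le (m.erase s) (coeff m f)
      have b2 := totalDegree_mul (X s ^ (m s - d)) ((m s).choose d : MvPolynomial σ K)
      have b3 : (X s ^ (m s - d) : MvPolynomial σ K).totalDegree = m s - d := totalDegree_X_pow _ _
      have b4 : (((m s).choose d : ℕ) : MvPolynomial σ K).totalDegree = 0 := by
        rw [← map_natCast (C : K →+* MvPolynomial σ K), totalDegree_C]
      have b5 : (Finsupp.sum (m.erase s) fun _ ↦ id) = (Finsupp.sum (m.erase s) fun _ e => e) := rfl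
      omega
  have hpos : 0 < f.totalDegree := by
    by_contra h0
    refine h ?_
    rw [hsum]
    exact Finset.sum_eq_zero fun m hm => (hterm m hm).resolve_right (by omega)
  rw [hsum]
  refine (totalDegree_finsetSum _ _).trans_lt ?_
  rw [Finset.sup_lt_iff hpos]
  intro m hm
  rcases hterm m hm with h0 | h0
  · rw [h0, totalDegree_zero]; exact hpos
  · exact h0

end HasseDerivative

end PluckerLimit

namespace PluckerLimit

/-! ### Elimination of a coordinate along a deformation. -/

section Elimination

open MvPolynomial

variable {K : Type*} [Field K] {σ : Type*}

theorem polynomial_eval_aeval (b : σ → Polynomial K) (t : K) (f : MvPolynomial σ K) :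
    (aeval b f).eval t = eval (fun r => (b r).eval t) f := by
  have h : (Polynomial.aeval t : Polynomial K →ₐ[K] K).comp (aeval b) =
      aeval fun r => (b r).eval t := by
    apply algHom_ext
    intro r
    simp [Polynomial.coe_aeval_eq_eval]
  rw [eval_eq_aeval, ← h, AlgHom.comp_apply, Polynomial.coe_aeval_eq_eval]

/-- The identity `h1` expands as `∑ d, (hasse s d f)(b(t)) * ζ ^ d * t ^ (N * d) = 0`. The terms
with `0 < d < q` vanish by `h2`, those with `d > q` are divisible by a power of `t` beyond `N * q`,
and in degree `N * q` the term `d = q` contributes only its value at `t = 0`. -/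
theorem coeff_relation [DecidableEq σ] [Infinite K] {f : MvPolynomial σ K} {s : σ} {q N : ℕ}
    (hq : 1 ≤ q) (hN : 1 ≤ N) (b : σ → Polynomial K) (ζ : K)
    (h1 : ∀ t, eval (shift s (fun r => (b r).eval t) (ζ * t ^ N)) f = 0)
    (h2 : ∀ d, 0 < d → d < q → ∀ t, eval (fun r => (b r).eval t) (hasse s d f) = 0) :
    (aeval b f).coeff (N * q) + ζ ^ q * eval (fun r => (b r).coeff 0) (hasse s q f) = 0 := by
  have hp : aeval (shift s b (Polynomial.C ζ * Polynomial.X ^ N)) f = 0 := by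
    refine Polynomial.funext fun t => ?_
    rw [polynomial_eval_aeval, Polynomial.eval_zero, ← h1 t]
    congr 2
    funext r
    simp only [shift]
    split_ifs <;> simp
  have h2' : ∀ d, 0 < d → d < q → aeval b (hasse s d f) = 0 := fun d hd hdq =>
    Polynomial.funext fun t => by
      rw [polynomial_eval_aeval, h2 d hd hdq, Polynomial.eval_zero]
  rw [aeval_shift_eq_sum s b _ f (max (taylorHom s f).natDegree q + 1) (by omega)] at hp
  have hc := congr(($hp).coeff (N * q))
  rw [Polynomial.finsetSum_coeff, Polynomial.coeff_zero] at hc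
  have hsub : ({0, q} : Finset ℕ) ⊆ Finset.range (max (taylorHom s f).natDegree q + 1) := by
    intro d hd
    simp only [Finset.mem_insert, Finset.mem_singleton] at hd
    rw [Finset.mem_range]
    omega
  rw [← Finset.sum_subset hsub, Finset.sum_pair (by omega)] at hc
  · rw [← hc]
    congr 1
    · simp [hasse_zero]
    · rw [mul_pow, ← pow_mul, ← Polynomial.C_pow, ← mul_assoc, Polynomial.coeff_mul_X_pow',
        if_pos le_rfl, Nat.sub_self, Polynomial.coeff_mul_C, Polynomial.coeff_zero_eq_eval_zero,
        polynomial_eval_aeval, mul_comm]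
      simp only [Polynomial.coeff_zero_eq_eval_zero]
  · intro d _ hd
    simp only [Finset.mem_insert, Finset.mem_singleton, not_or] at hd
    rcases lt_or_gt_of_ne hd.2 with hlt | hgt
    · rw [h2' d (by omega) hlt, zero_mul, Polynomial.coeff_zero]
    · rw [mul_pow, ← pow_mul, ← Polynomial.C_pow, ← mul_assoc, Polynomial.coeff_mul_X_pow',
        if_neg]
      exact not_le.2 (Nat.mul_lt_mul_of_pos_left hgt hN)

/-- The value at the point `z` and the parameter `t` of a polynomial whose coefficients are
functions. -/
noncomputable def evalPt (z : σ → K) (t : K) (Q : Polynomial ((σ → K) → K)) : K :=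
  (Q.map (Pi.evalRingHom (fun _ : σ → K => K) z)).eval t

theorem evalPt_add (z : σ → K) (t : K) (P Q : Polynomial ((σ → K) → K)) :
    evalPt z t (P + Q) = evalPt z t P + evalPt z t Q := by
  simp [evalPt]

theorem evalPt_mul (z : σ → K) (t : K) (P Q : Polynomial ((σ → K) → K)) :
    evalPt z t (P * Q) = evalPt z t P * evalPt z t Q := by
  simp [evalPt]

theorem evalPt_C (z : σ → K) (t : K) (F : (σ → K) → K) : evalPt z t (Polynomial.C F) = F z := by
  simp [evalPt]

theorem evalPt_X (z : σ → K) (t : K) : evalPt z t Polynomial.X = t := by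
  simp [evalPt]

theorem evalPt_pow (z : σ → K) (t : K) (Q : Polynomial ((σ → K) → K)) (n : ℕ) :
    evalPt z t (Q ^ n) = evalPt z t Q ^ n := by
  simp [evalPt]

/-- The basic elimination step: if `f` vanishes along all deformations `E` of points of `Z`, whose
leading terms only occur in the coordinate `s` and are given by a function `ζ`, then `ζ ^ q` times a
Hasse derivative of `f` lies in the algebra generated by the remaining terms. -/
theorem exists_elimination [DecidableEq σ] [Infinite K] {A : Subalgebra K ((σ → K) → K)}
    {Z : Set (σ → K)} {f : MvPolynomial σ K} {s : σ} {q N : ℕ} (hq : 1 ≤ q) (hN : 1 ≤ N)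
    (B : σ → Polynomial ((σ → K) → K)) (ζ : (σ → K) → K)
    (hB : ∀ r ∈ f.vars, B r ∈ coeffsIn A)
    (hB0 : ∀ r ∈ f.vars, (B r).coeff 0 = fun z => z r)
    (h1 : ∀ z ∈ Z, ∀ t, eval (shift s (fun r => evalPt z t (B r)) (ζ z * t ^ N)) f = 0)
    (h2 : ∀ d, 0 < d → d < q → ∀ z ∈ Z, ∀ t,
      eval (fun r => evalPt z t (B r)) (hasse s d f) = 0) :
    ∃ p ∈ A, ∀ z ∈ Z, eval z (hasse s q f) * ζ z ^ q = p z := by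
  classical
  -- The hypotheses on `B` concern only the variables of `f`; zero is a harmless value elsewhere and
  -- puts all entries into `coeffsIn A`.
  let B' : σ → Polynomial ((σ → K) → K) := fun r => if r ∈ f.vars then B r else 0
  have hf : f ∈ supported K (f.vars : Set σ) := mem_supported.2 subset_rfl
  have hB' : ∀ r, B' r ∈ coeffsIn A := fun r => by
    simp only [B']
    split_ifs with h
    · exact hB r h
    · exact zero_mem _
  have hm : aeval B' f ∈ coeffsIn A := aeval_mem_of_forall f hB'
  refine ⟨-(aeval B' f).coeff (N * q), neg_mem (hm _), fun z hz => ?_⟩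
  have hrel := coeff_relation (f := f) (s := s) hq hN
    (fun r => (B' r).map (Pi.evalRingHom (fun _ : σ → K => K) z)) (ζ z) (fun t => by
      rw [← h1 z hz t]
      refine eval_eq_of_supported hf fun r hr => ?_
      simp only [shift, B', if_pos (Finset.mem_coe.1 hr), evalPt]) (fun d hd hdq t => by
      rw [← h2 d hd hdq z hz t]
      refine eval_eq_of_supported (hasse_mem_supported hf s d) fun r hr => ?_
      simp only [B', if_pos (Finset.mem_coe.1 hr), evalPt])
  have e1 : eval (fun r => ((B' r).map (Pi.evalRingHom (fun _ : σ → K => K) z)).coeff 0)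
      (hasse s q f) = eval z (hasse s q f) := by
    refine eval_eq_of_supported (hasse_mem_supported hf s q) fun r hr => ?_
    simp only [B', if_pos (Finset.mem_coe.1 hr), Polynomial.coeff_map, hB0 r hr]
    rfl
  have e2 : (aeval (fun r => (B' r).map (Pi.evalRingHom (fun _ : σ → K => K) z)) f) =
      (aeval B' f).map (Pi.evalRingHom (fun _ : σ → K => K) z) := by
    have : (Polynomial.mapAlgHom (Pi.evalAlgHom K (fun _ : σ → K => K) z)).comp (aeval B') =
        aeval (fun r => (B' r).map (Pi.evalRingHom (fun _ : σ → K => K) z)) := by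
      apply algHom_ext
      intro r
      simp
      rfl
    rw [← this]
    rfl
  rw [e1, e2, Polynomial.coeff_map] at hrel
  rw [Pi.neg_apply, mul_comm]
  exact eq_neg_of_add_eq_zero_right hrel

/-- The functions which agree, on `Z`, up to powers of `h` and iterated `q`-th roots, with elements
of `A`; here the `q`-th power map is assumed to be additive. -/
def rootClosure (A : Subalgebra K ((σ → K) → K)) (Z : Set (σ → K)) (h : (σ → K) → K) (hh : h ∈ A)
    (q : ℕ) (hq : ∀ a b : K, (a + b) ^ q = a ^ q + b ^ q) : Subalgebra K ((σ → K) → K) where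
  carrier := {F | ∃ e M : ℕ, ∃ F' ∈ A, ∀ z ∈ Z, F' z = h z ^ M * F z ^ q ^ e}
  mul_mem' := by
    rintro F₁ F₂ ⟨e₁, M₁, F₁', hF₁', h₁⟩ ⟨e₂, M₂, F₂', hF₂', h₂⟩
    refine ⟨e₁ + e₂, M₁ * q ^ e₂ + M₂ * q ^ e₁, F₁' ^ q ^ e₂ * F₂' ^ q ^ e₁,
      mul_mem (pow_mem hF₁' _) (pow_mem hF₂' _), fun z hz => ?_⟩
    simp only [Pi.mul_apply, Pi.pow_apply, h₁ z hz, h₂ z hz]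
    ring
  add_mem' := by
    rintro F₁ F₂ ⟨e₁, M₁, F₁', hF₁', h₁⟩ ⟨e₂, M₂, F₂', hF₂', h₂⟩
    have hq' : ∀ (e : ℕ) (a b : K), (a + b) ^ q ^ e = a ^ q ^ e + b ^ q ^ e := by
      intro e
      induction e with
      | zero => simp
      | succ e ih => intro a b; rw [pow_succ, pow_mul, pow_mul, pow_mul, ih, hq]
    -- Both summands are brought to the exponent `q ^ (e₁ + e₂)` and to a common power of `h`;
    -- additivity of the `q`-th power map then combines them.
    refine ⟨e₁ + e₂, M₁ * q ^ e₂ + M₂ * q ^ e₁,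
      h ^ (M₂ * q ^ e₁) * F₁' ^ q ^ e₂ + h ^ (M₁ * q ^ e₂) * F₂' ^ q ^ e₁,
      add_mem (mul_mem (pow_mem hh _) (pow_mem hF₁' _)) (mul_mem (pow_mem hh _) (pow_mem hF₂' _)),
      fun z hz => ?_⟩
    simp only [Pi.add_apply, Pi.mul_apply, Pi.pow_apply, h₁ z hz, h₂ z hz, hq']
    ring
  algebraMap_mem' a := ⟨0, 0, algebraMap K _ a, A.algebraMap_mem a, fun z _ => by simp⟩

section

variable {A : Subalgebra K ((σ → K) → K)} {Z : Set (σ → K)} {h : (σ → K) → K} {hh : h ∈ A}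
    {q : ℕ} {hq : ∀ a b : K, (a + b) ^ q = a ^ q + b ^ q}

theorem mem_rootClosure {F : (σ → K) → K} : F ∈ rootClosure A Z h hh q hq ↔
    ∃ e M : ℕ, ∃ F' ∈ A, ∀ z ∈ Z, F' z = h z ^ M * F z ^ q ^ e := Iff.rfl

theorem le_rootClosure : A ≤ rootClosure A Z h hh q hq := fun F hF =>
  mem_rootClosure.2 ⟨0, 0, F, hF, fun z _ => by simp⟩

theorem mem_rootClosure_of_mul_pow {F p : (σ → K) → K} (hp : p ∈ rootClosure A Z h hh q hq)
    (hF : ∀ z ∈ Z, h z * F z ^ q = p z) : F ∈ rootClosure A Z h hh q hq := by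
  obtain ⟨e, M, p', hp', hpp'⟩ := mem_rootClosure.1 hp
  refine mem_rootClosure.2 ⟨e + 1, M + q ^ e, p', hp', fun z hz => ?_⟩
  rw [hpp' z hz, ← hF z hz]
  ring

/-- Neither a factor that is a power of the nonvanishing `h` nor the exponent `q ^ e` changes the
zero set. So Noetherianity for functions in `A` suffices for all functions in the root closure. -/
theorem exists_zero_iff_of_mem_rootClosure (hZ : ∀ z ∈ Z, h z ≠ 0) (hq0 : q ≠ 0)
    {F : (σ → K) → K} (hF : F ∈ rootClosure A Z h hh q hq) :
    ∃ F' ∈ A, ∀ z ∈ Z, (F z = 0 ↔ F' z = 0) := by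
  obtain ⟨e, M, F', hF', hFF'⟩ := mem_rootClosure.1 hF
  refine ⟨F', hF', fun z hz => ?_⟩
  rw [hFF' z hz, mul_eq_zero, or_iff_right (pow_ne_zero _ (hZ z hz)),
    pow_eq_zero_iff (pow_ne_zero _ hq0)]

end

end Elimination

end PluckerLimit

namespace PluckerLimit

/-! ### Moves on semi-infinite monomials and transvections. -/

section Moves

open MvPolynomial

/-- A semi-infinite monomial `x_I` is recorded through the symmetric difference `D` of `I` and
`{1, 2, 3, …}`. The index `k` is occupied if it lies in `I`. -/
def Occ (k : Idx) (D : Finset Idx) : Prop := k ∈ D ↔ k.1 < 0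

instance (k : Idx) (D : Finset Idx) : Decidable (Occ k D) :=
  inferInstanceAs (Decidable (k ∈ D ↔ k.1 < 0))

/-- Replacing the index `m.1` by the index `m.2`. -/
def mv (m : Idx × Idx) (D : Finset Idx) : Finset Idx := symmDiff D {m.1, m.2}

/-- The index `m.1` is occupied and the index `m.2` is not. -/
def CanMove (m : Idx × Idx) (D : Finset Idx) : Prop := Occ m.1 D ∧ ¬ Occ m.2 D

instance (m : Idx × Idx) (D : Finset Idx) : Decidable (CanMove m D) :=
  inferInstanceAs (Decidable (_ ∧ _))

theorem mem_mv {m : Idx × Idx} {D : Finset Idx} {k : Idx} :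
    k ∈ mv m D ↔ (k ∈ D ∧ k ≠ m.1 ∧ k ≠ m.2) ∨ (k ∉ D ∧ (k = m.1 ∨ k = m.2)) := by
  simp only [mv, Finset.mem_symmDiff, Finset.mem_insert, Finset.mem_singleton]
  tauto

theorem mv_mv (m : Idx × Idx) (D : Finset Idx) : mv m (mv m D) = D := by
  simp [mv]

theorem occ_mv_of_ne {m : Idx × Idx} {D : Finset Idx} {k : Idx} (h1 : k ≠ m.1) (h2 : k ≠ m.2) :
    Occ k (mv m D) ↔ Occ k D := by
  simp only [Occ, mem_mv]
  tauto

theorem occ_mv_fst {m : Idx × Idx} {D : Finset Idx} : Occ m.1 (mv m D) ↔ ¬ Occ m.1 D := by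
  simp only [Occ, mem_mv]
  tauto

theorem occ_mv_snd {m : Idx × Idx} {D : Finset Idx} : Occ m.2 (mv m D) ↔ ¬ Occ m.2 D := by
  simp only [Occ, mem_mv]
  tauto

theorem not_canMove_mv {m : Idx × Idx} {D : Finset Idx} (h : CanMove m D) :
    ¬ CanMove m (mv m D) := fun h' => occ_mv_fst.1 h'.1 h.1

theorem ext_occ {D D' : Finset Idx} (h : ∀ k, Occ k D ↔ Occ k D') : D = D' := by
  ext k
  have := h k
  simp only [Occ] at this
  tauto

variable {K : Type*} [Field K] (ε : Idx × Idx → Finset Idx → K)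

/-- The action on points of the transvection `x_k ↦ x_k + t x_i`, with `m = (k, i)`. -/
def tvFun (m : Idx × Idx) (t : K) (z : Finset Idx → K) : Finset Idx → K :=
  fun D => z D + if CanMove m D then t * ε m D * z (mv m D) else 0

theorem tvFun_tvFun (m : Idx × Idx) (t u : K) (z : Finset Idx → K) :
    tvFun ε m u (tvFun ε m t z) = tvFun ε m (t + u) z := by
  funext D
  by_cases h : CanMove m D
  · simp only [tvFun, if_pos h, if_neg (not_canMove_mv h)]
    ring
  · simp [tvFun, if_neg h]

theorem tvFun_zero (m : Idx × Idx) (z : Finset Idx → K) : tvFun ε m 0 z = z := by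
  funext D
  simp [tvFun]

/-- Transvections as permutations of the set of points. -/
def tv (m : Idx × Idx) (t : K) : Equiv.Perm (Finset Idx → K) where
  toFun := tvFun ε m t
  invFun := tvFun ε m (-t)
  left_inv z := by rw [tvFun_tvFun, add_neg_cancel, tvFun_zero]
  right_inv z := by rw [tvFun_tvFun, neg_add_cancel, tvFun_zero]

theorem tv_apply (m : Idx × Idx) (t : K) (z : Finset Idx → K) (D : Finset Idx) :
    tv ε m t z D = z D + if CanMove m D then t * ε m D * z (mv m D) else 0 := rfl

/-- The coordinate function indexed by `D`. -/
def crd (K : Type*) (D : Finset Idx) : (Finset Idx → K) → K := fun z => z D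

/-- The effect of a sequence of transvections with common parameter on the coordinate indexed by
`D`, as a polynomial in that parameter. -/
noncomputable def pathPoly : List (Idx × Idx) → Finset Idx → Polynomial ((Finset Idx → K) → K)
  | [], D => Polynomial.C (crd K D)
  | m :: ps, D => pathPoly ps D +
      if CanMove m D then
        Polynomial.X * Polynomial.C (algebraMap K _ (ε m D)) * pathPoly ps (mv m D)
      else 0

/-- The product of a sequence of transvections with common parameter. -/
def pathPerm (t : K) (ps : List (Idx × Idx)) : Equiv.Perm (Finset Idx → K) :=
  (ps.map fun m => tv ε m t).prod

theorem evalPt_pathPoly (ps : List (Idx × Idx)) (D : Finset Idx) (z : Finset Idx → K) (t : K) :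
    evalPt z t (pathPoly ε ps D) = pathPerm ε t ps z D := by
  induction ps generalizing D with
  | nil => simp [pathPoly, pathPerm, evalPt_C, crd]
  | cons m ps ih =>
    have hp : pathPerm ε t (m :: ps) z = tv ε m t (pathPerm ε t ps z) := by
      simp [pathPerm, Equiv.Perm.mul_apply]
    rw [hp, tv_apply, ← ih, pathPoly, evalPt_add]
    congr 1
    split_ifs
    · rw [evalPt_mul, evalPt_mul, evalPt_X, evalPt_C, ih]
      rfl
    · simp [evalPt]

theorem coeff_zero_pathPoly (ps : List (Idx × Idx)) (D : Finset Idx) :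
    (pathPoly ε ps D).coeff 0 = crd K D := by
  induction ps generalizing D with
  | nil => simp [pathPoly]
  | cons m ps ih =>
    rw [pathPoly, Polynomial.coeff_add, ih]
    split_ifs
    · simp [mul_assoc]
    · simp

/-- All moves of the list can be carried out, in order, starting from `D` and ending at `D'`. -/
def IsPath : List (Idx × Idx) → Finset Idx → Finset Idx → Prop
  | [], D, D' => D = D'
  | m :: ps, D, D' => CanMove m D ∧ IsPath ps (mv m D) D'

theorem IsPath.append_singleton {ps : List (Idx × Idx)} {D D' : Finset Idx} {m : Idx × Idx}
    (h : IsPath ps D D') (hm : CanMove m D') : IsPath (ps ++ [m]) D (mv m D') := by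
  induction ps generalizing D with
  | nil =>
    obtain rfl : D = D' := h
    exact ⟨hm, rfl⟩
  | cons a ps ih => exact ⟨h.1, ih h.2⟩

/-- Each move toggles the same two indices wherever it starts, so the displacement depends on the
list alone. Hence different starting points lead to different end points. -/
theorem IsPath.exists_symmDiff (ps : List (Idx × Idx)) :
    ∃ X : Finset Idx, ∀ D D', IsPath ps D D' → D' = symmDiff D X := by
  induction ps with
  | nil => exact ⟨∅, fun D D' h => by
    rw [← Finset.bot_eq_empty, symmDiff_bot]; exact Eq.symm h⟩
  | cons m ps ih =>
    obtain ⟨X, hX⟩ := ih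
    refine ⟨symmDiff {m.1, m.2} X, fun D D' h => ?_⟩
    rw [hX _ _ h.2, mv, symmDiff_assoc]

variable {ε}

/-- A grading of a set `W` of monomials for which each move has positive weight. -/
structure IsGraded (ps : List (Idx × Idx)) (W : Set (Finset Idx)) (v : Finset Idx → ℕ)
    (wt : Idx × Idx → ℕ) : Prop where
  mem : ∀ m ∈ ps, ∀ D ∈ W, CanMove m D → mv m D ∈ W
  wt_eq : ∀ m ∈ ps, ∀ D ∈ W, CanMove m D → v (mv m D) = v D + wt m
  pos : ∀ m ∈ ps, 1 ≤ wt m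

theorem IsGraded.tail {m : Idx × Idx} {ps : List (Idx × Idx)} {W : Set (Finset Idx)}
    {v : Finset Idx → ℕ} {wt : Idx × Idx → ℕ} (h : IsGraded (m :: ps) W v wt) :
    IsGraded ps W v wt :=
  ⟨fun a ha => h.mem a (List.mem_cons_of_mem _ ha),
    fun a ha => h.wt_eq a (List.mem_cons_of_mem _ ha),
    fun a ha => h.pos a (List.mem_cons_of_mem _ ha)⟩

theorem IsGraded.target {ps : List (Idx × Idx)} {W : Set (Finset Idx)} {v : Finset Idx → ℕ}
    {wt : Idx × Idx → ℕ} (h : IsGraded ps W v wt) {D D' : Finset Idx} (hD : D ∈ W)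
    (hp : IsPath ps D D') : D' ∈ W ∧ v D' = v D + (ps.map wt).sum := by
  induction ps generalizing D with
  | nil =>
    obtain rfl : D = D' := hp
    exact ⟨hD, by simp⟩
  | cons m ps ih =>
    have := ih h.tail (h.mem m List.mem_cons_self D hD hp.1) hp.2
    rw [h.wt_eq m List.mem_cons_self D hD hp.1] at this
    refine ⟨this.1, ?_⟩
    rw [this.2, List.map_cons, List.sum_cons]
    omega

/-- The coordinates that occur are reached by carrying out some of the moves in order, so their
grade exceeds that of `D` by at most the total weight. -/
theorem pathPoly_mem {A : Subalgebra K ((Finset Idx → K) → K)} {ps : List (Idx × Idx)}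
    {W : Set (Finset Idx)} {v : Finset Idx → ℕ} {wt : Idx × Idx → ℕ} (h : IsGraded ps W v wt)
    {D : Finset Idx} (hD : D ∈ W)
    (hA : ∀ D' ∈ W, v D' ≤ v D + (ps.map wt).sum → crd K D' ∈ A) :
    pathPoly ε ps D ∈ coeffsIn A := by
  induction ps generalizing D with
  | nil => exact C_mem_coeffsIn (hA D hD (by simp))
  | cons m ps ih =>
    simp only [List.map_cons, List.sum_cons] at hA
    refine add_mem (ih h.tail hD fun D' hD' hv => hA D' hD' (by omega)) ?_
    split_ifs with hm
    · refine mul_mem (mul_mem (X_mem_coeffsIn _) (C_mem_coeffsIn (A.algebraMap_mem _))) ?_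
      refine ih h.tail (h.mem m List.mem_cons_self D hD hm) fun D' hD' hv => hA D' hD' ?_
      rw [h.wt_eq m List.mem_cons_self D hD hm] at hv
      omega
    · exact zero_mem _

/-- Omitting a move costs at least its positive weight. Thus the top grade is attained only by
carrying out the whole list, and those end points are dealt with by `hp`. -/
theorem pathPoly_mem_of_not_isPath {A : Subalgebra K ((Finset Idx → K) → K)}
    {ps : List (Idx × Idx)} {W : Set (Finset Idx)} {v : Finset Idx → ℕ} {wt : Idx × Idx → ℕ}
    (h : IsGraded ps W v wt) {D : Finset Idx} (hD : D ∈ W)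
    (hA : ∀ D' ∈ W, v D' < v D + (ps.map wt).sum → crd K D' ∈ A)
    (hp : ∀ D', IsPath ps D D' → crd K D' ∈ A) :
    pathPoly ε ps D ∈ coeffsIn A := by
  induction ps generalizing D with
  | nil => exact C_mem_coeffsIn (hp D rfl)
  | cons m ps ih =>
    have hpos := h.pos m List.mem_cons_self
    simp only [List.map_cons, List.sum_cons] at hA
    refine add_mem (pathPoly_mem h.tail hD fun D' hD' hv => hA D' hD' (by omega)) ?_
    split_ifs with hm
    · refine mul_mem (mul_mem (X_mem_coeffsIn _) (C_mem_coeffsIn (A.algebraMap_mem _))) ?_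
      refine ih h.tail (h.mem m List.mem_cons_self D hD hm) (fun D' hD' hv => hA D' hD' ?_)
        fun D' hD' => hp D' ⟨hm, hD'⟩
      rw [h.wt_eq m List.mem_cons_self D hD hm] at hv
      omega
    · exact zero_mem _

/-- The only term that may reach the top grade comes from the full path. It carries the full power
of the parameter, and its scalar is a product of nonzero structure constants. -/
theorem pathPoly_decomp (hε : ∀ m D, ε m D ≠ 0) {A : Subalgebra K ((Finset Idx → K) → K)}
    {ps : List (Idx × Idx)} {W : Set (Finset Idx)} {v : Finset Idx → ℕ} {wt : Idx × Idx → ℕ}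
    (h : IsGraded ps W v wt) {D D' : Finset Idx} (hD : D ∈ W)
    (hA : ∀ D'' ∈ W, v D'' < v D + (ps.map wt).sum → crd K D'' ∈ A)
    (hp : IsPath ps D D') :
    ∃ B ∈ coeffsIn A, ∃ c : K, c ≠ 0 ∧
      pathPoly ε ps D = B + Polynomial.C (c • crd K D') * Polynomial.X ^ ps.length := by
  induction ps generalizing D with
  | nil =>
    obtain rfl : D = D' := hp
    exact ⟨0, zero_mem _, 1, one_ne_zero, by simp [pathPoly]⟩
  | cons m ps ih =>
    have hpos := h.pos m List.mem_cons_self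
    simp only [List.map_cons, List.sum_cons] at hA
    obtain ⟨B, hB, c, hc, hBc⟩ := ih h.tail (h.mem m List.mem_cons_self D hD hp.1)
      (fun D' hD' hv => hA D' hD' (by
        rw [h.wt_eq m List.mem_cons_self D hD hp.1] at hv
        omega)) hp.2
    refine ⟨pathPoly ε ps D + Polynomial.X * Polynomial.C (algebraMap K _ (ε m D)) * B,
      add_mem (pathPoly_mem h.tail hD fun D' hD' hv => hA D' hD' (by omega))
        (mul_mem (mul_mem (X_mem_coeffsIn _) (C_mem_coeffsIn (A.algebraMap_mem _))) hB),
      ε m D * c, mul_ne_zero (hε _ _) hc, ?_⟩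
    rw [pathPoly, if_pos hp.1, hBc, List.length_cons, mul_smul, Algebra.smul_def (ε m D),
      Polynomial.C_mul]
    ring

/-- The elimination of the coordinate at the end of a path. -/
theorem exists_relation [Infinite K] {A : Subalgebra K ((Finset Idx → K) → K)}
    {Z : Set (Finset Idx → K)} {f : MvPolynomial (Finset Idx) K} {s D' : Finset Idx} {q : ℕ}
    (hq : 1 ≤ q) {ps : List (Idx × Idx)} (hps : ps ≠ [])
    (hs : ∃ B ∈ coeffsIn A, ∃ c : K, c ≠ 0 ∧
      pathPoly ε ps s = B + Polynomial.C (c • crd K D') * Polynomial.X ^ ps.length)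
    (hr : ∀ r ∈ f.vars, r ≠ s → pathPoly ε ps r ∈ coeffsIn A)
    (h1 : ∀ z ∈ Z, ∀ t, eval (pathPerm ε t ps z) f = 0)
    (h2 : ∀ d, 0 < d → d < q → ∀ z ∈ Z, ∀ t, ∀ w : Finset Idx → K,
      (∀ r ≠ s, pathPerm ε t ps z r = w r) → eval w (hasse s d f) = 0) :
    ∃ p ∈ A, ∀ z ∈ Z, eval z (hasse s q f) * z D' ^ q = p z := by
  obtain ⟨B, hB, c, hc, hBc⟩ := hs
  have hN : 1 ≤ ps.length := List.length_pos_iff.2 hps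
  -- The leading term is split off from the entry at `s` and plays the role of the displacement in
  -- the direction `s`; this is where `ζ z = c * z D'` comes from.
  obtain ⟨p, hp, hpz⟩ := exists_elimination (A := A) (Z := Z) (f := f) (s := s) hq hN
    (fun r => if r = s then B else pathPoly ε ps r) (fun z => c * z D') (by
      intro r hrf
      split_ifs with h
      · exact hB
      · exact hr r hrf h) (by
      intro r _
      split_ifs with h
      · have h0 := coeff_zero_pathPoly ε ps s
        rw [hBc, Polynomial.coeff_add, Polynomial.coeff_C_mul, Polynomial.coeff_X_pow,
          if_neg (by omega), mul_zero, add_zero] at h0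
        rw [h0, h]
        rfl
      · exact coeff_zero_pathPoly ε ps r) (by
      intro z hz t
      rw [← h1 z hz t]
      congr 2
      funext r
      rw [← evalPt_pathPoly]
      simp only [shift]
      split_ifs with h
      · rw [h, hBc, evalPt_add, evalPt_mul, evalPt_pow, evalPt_X, evalPt_C]
        rfl
      · rw [add_zero]) (by
      intro d hd hdq z hz t
      refine h2 d hd hdq z hz t _ fun r hrs => ?_
      rw [if_neg hrs, evalPt_pathPoly])
  refine ⟨(c ^ q)⁻¹ • p, A.smul_mem hp _, fun z hz => ?_⟩
  rw [Pi.smul_apply, ← hpz z hz, smul_eq_mul, mul_pow]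
  field_simp

/-- The group generated by all transvections. -/
def fullGroup (ε : Idx × Idx → Finset Idx → K) : Subgroup (Equiv.Perm (Finset Idx → K)) :=
  Subgroup.closure {g | ∃ m t, g = tv ε m t}

/-- Both indices have the same sign and absolute value larger than `n`. -/
def Outer (n : ℕ) (m : Idx × Idx) : Prop :=
  (m.1.1 < 0 ↔ m.2.1 < 0) ∧ n < m.1.1.natAbs ∧ n < m.2.1.natAbs

/-- The group generated by the transvections with indices of the same sign outside `[-n, n]`. -/
def outerGroup (ε : Idx × Idx → Finset Idx → K) (n : ℕ) :
    Subgroup (Equiv.Perm (Finset Idx → K)) :=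
  Subgroup.closure {g | ∃ m t, Outer n m ∧ g = tv ε m t}

theorem tv_mem_fullGroup (m : Idx × Idx) (t : K) : tv ε m t ∈ fullGroup ε :=
  Subgroup.subset_closure ⟨m, t, rfl⟩

theorem tv_mem_outerGroup {n : ℕ} {m : Idx × Idx} (hm : Outer n m) (t : K) :
    tv ε m t ∈ outerGroup ε n :=
  Subgroup.subset_closure ⟨m, t, hm, rfl⟩

theorem outerGroup_le_fullGroup (n : ℕ) : outerGroup ε n ≤ fullGroup ε :=
  Subgroup.closure_mono fun _ ⟨m, t, _, h⟩ => ⟨m, t, h⟩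

theorem outerGroup_mono {n n' : ℕ} (h : n ≤ n') : outerGroup ε n' ≤ outerGroup ε n :=
  Subgroup.closure_mono fun _ ⟨m, t, hm, h'⟩ => ⟨m, t, ⟨hm.1, by have := hm.2; omega⟩, h'⟩

theorem pathPerm_mem {G : Subgroup (Equiv.Perm (Finset Idx → K))} {ps : List (Idx × Idx)} (t : K)
    (h : ∀ m ∈ ps, tv ε m t ∈ G) : pathPerm ε t ps ∈ G := by
  refine Subgroup.list_prod_mem _ fun g hg => ?_
  obtain ⟨m, hm, rfl⟩ := List.mem_map.1 hg
  exact h m hm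

theorem inv_tv (m : Idx × Idx) (t : K) : (tv ε m t)⁻¹ = tv ε m (-t) := Equiv.ext fun _ => rfl

/-- A subalgebra of functions which is stable under a set of transvections is stable under the
group which they generate. -/
theorem comp_mem_of_closure {M : Set (Idx × Idx)} {A : Subalgebra K ((Finset Idx → K) → K)}
    (hA : ∀ m ∈ M, ∀ t, ∀ F ∈ A, (fun z => F (tv ε m t z)) ∈ A)
    {g : Equiv.Perm (Finset Idx → K)}
    (hg : g ∈ Subgroup.closure {g | ∃ m t, m ∈ M ∧ g = tv ε m t}) :
    ∀ F ∈ A, (fun z => F (g z)) ∈ A := by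
  have key : (∀ F ∈ A, (fun z => F (g z)) ∈ A) ∧ (∀ F ∈ A, (fun z => F (g⁻¹ z)) ∈ A) := by
    induction hg using Subgroup.closure_induction with
    | mem x hx =>
      obtain ⟨m, t, hm, rfl⟩ := hx
      exact ⟨hA m hm t, by rw [inv_tv]; exact hA m hm (-t)⟩
    | one => exact ⟨fun F hF => hF, fun F hF => hF⟩
    | mul x y _ _ hx hy =>
      refine ⟨fun F hF => hy.1 _ (hx.1 F hF), fun F hF => ?_⟩
      rw [mul_inv_rev]
      exact hx.2 _ (hy.2 F hF)
    | inv x _ hx => exact ⟨hx.2, by rw [inv_inv]; exact hx.1⟩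
  exact key.1

/-- The subalgebra generated by a set of coordinates is stable under a transvection if that set is
stable under the corresponding move. -/
theorem polyFun_comp_tv {S : Set (Finset Idx)} {m : Idx × Idx}
    (hS : ∀ D ∈ S, CanMove m D → mv m D ∈ S) (t : K) :
    ∀ F ∈ polyFun K S, (fun z => F (tv ε m t z)) ∈ polyFun K S := by
  let φ : ((Finset Idx → K) → K) →ₐ[K] ((Finset Idx → K) → K) :=
    AlgHom.pi fun z => Pi.evalAlgHom K _ (tv ε m t z)
  have h : polyFun K S ≤ (polyFun K S).comap φ := by
    refine polyFun_le fun D hD => ?_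
    have he : φ (fun z => z D) = (fun z => z D) + if CanMove m D then
        (t * ε m D) • (fun z : Finset Idx → K => z (mv m D)) else 0 := by
      funext z
      simp only [φ, AlgHom.pi_apply, Pi.evalAlgHom_apply, tv_apply, Pi.add_apply]
      split_ifs <;> simp
    rw [Subalgebra.mem_comap, he]
    refine add_mem (coord_mem_polyFun hD) ?_
    split_ifs with hm
    · exact Subalgebra.smul_mem _ (coord_mem_polyFun (hS D hD hm)) _
    · exact zero_mem _
  exact fun F hF => h hF

theorem polyFun_comp_outerGroup {S : Set (Finset Idx)} {n : ℕ}
    (hS : ∀ m, Outer n m → ∀ D ∈ S, CanMove m D → mv m D ∈ S)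
    {g : Equiv.Perm (Finset Idx → K)} (hg : g ∈ outerGroup ε n) :
    ∀ F ∈ polyFun K S, (fun z => F (g z)) ∈ polyFun K S :=
  comp_mem_of_closure (M := {m | Outer n m}) (fun m hm t => polyFun_comp_tv (hS m hm) t) hg

theorem polyFun_comp_fullGroup {S : Set (Finset Idx)}
    (hS : ∀ m, ∀ D ∈ S, CanMove m D → mv m D ∈ S)
    {g : Equiv.Perm (Finset Idx → K)} (hg : g ∈ fullGroup ε) :
    ∀ F ∈ polyFun K S, (fun z => F (g z)) ∈ polyFun K S :=
  comp_mem_of_closure (M := Set.univ) (fun m _ t => polyFun_comp_tv (hS m) t)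
    (by simpa [fullGroup] using hg)

/-- Coordinates all of whose indices lie in `[-n, n]` are invariant under the outer group. -/
theorem outerGroup_apply {n : ℕ} {D : Finset Idx} (hD : ∀ k ∈ D, k.1.natAbs ≤ n)
    {g : Equiv.Perm (Finset Idx → K)} (hg : g ∈ outerGroup ε n) (z : Finset Idx → K) :
    g z D = z D := by
  induction hg using Subgroup.closure_induction generalizing z with
  | mem x hx =>
    obtain ⟨m, t, hm, rfl⟩ := hx
    rw [tv_apply, if_neg, add_zero]
    rintro ⟨h1, h2⟩
    have n1 : m.1 ∉ D := fun h => by have := hD _ h; have := hm.2; omega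
    have n2 : m.2 ∉ D := fun h => by have := hD _ h; have := hm.2; omega
    simp only [Occ, n1, n2, false_iff] at h1 h2
    exact h2 fun h => h1 (hm.1.2 h)
  | one => rfl
  | mul x y _ _ hx hy => rw [Equiv.Perm.mul_apply, hx, hy]
  | inv x _ hx =>
    rw [← hx (x⁻¹ z), ← Equiv.Perm.mul_apply, mul_inv_cancel, Equiv.Perm.one_apply]

theorem eval_outerGroup {n : ℕ} {f : MvPolynomial (Finset Idx) K}
    (hf : ∀ D ∈ f.vars, ∀ k ∈ D, k.1.natAbs ≤ n)
    {g : Equiv.Perm (Finset Idx → K)} (hg : g ∈ outerGroup ε n) (z : Finset Idx → K) :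
    eval (g z) f = eval z f :=
  eval_eq_of_supported (mem_supported.2 subset_rfl) fun D hD => outerGroup_apply (hf D hD) hg z

end Moves

end PluckerLimit

namespace PluckerLimit

/-! ### Types of monomials relative to a level, and paths between them. -/

section BoundedArity

open MvPolynomial

/-- The elements of `D` outside `[-n, n]`. -/
def outer (n : ℕ) (D : Finset Idx) : Finset Idx := D.filter fun k => n < k.1.natAbs

/-- The elements of `D` in `[-n, n]`. -/
def inner (n : ℕ) (D : Finset Idx) : Finset Idx := D.filter fun k => k.1.natAbs ≤ n

theorem mem_outer {n : ℕ} {D : Finset Idx} {k : Idx} : k ∈ outer n D ↔ k ∈ D ∧ n < k.1.natAbs :=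
  Finset.mem_filter

theorem mem_inner {n : ℕ} {D : Finset Idx} {k : Idx} : k ∈ inner n D ↔ k ∈ D ∧ k.1.natAbs ≤ n :=
  Finset.mem_filter

theorem inner_union_outer (n : ℕ) (D : Finset Idx) : inner n D ∪ outer n D = D := by
  ext k
  rw [Finset.mem_union, mem_inner, mem_outer, ← and_or_left]
  exact and_iff_left (le_or_gt _ _)

/-- The sign of an index. -/
def sgn (k : Idx) : Bool := decide (k.1 < 0)

theorem sgn_eq_iff {k l : Idx} : sgn k = sgn l ↔ (k.1 < 0 ↔ l.1 < 0) := by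
  simp [sgn]

/-- The type of `D` at level `n`: its elements in `[-n, n]` and the signs of the others. -/
def ty (n : ℕ) (D : Finset Idx) : Finset Idx × Multiset Bool :=
  (inner n D, (outer n D).val.map sgn)

theorem card_ty_snd (n : ℕ) (D : Finset Idx) : (ty n D).2.card = (outer n D).card := by
  simp [ty]

/-- Between indices of the same sign a move exchanges an element of `D` for a non-element. Which of
the two is removed depends on the sign: negative indices are occupied when they lie in `D`, positive
ones when they do not. -/
theorem exists_mv_eq {m : Idx × Idx} {D : Finset Idx} (hm : m.1.1 < 0 ↔ m.2.1 < 0)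
    (h : CanMove m D) : ∃ k l, k ∈ D ∧ l ∉ D ∧ (k = m.1 ∧ l = m.2 ∨ k = m.2 ∧ l = m.1) ∧
      mv m D = insert l (D.erase k) := by
  have key : ∀ k l, k ∈ D → l ∉ D → (k = m.1 ∧ l = m.2 ∨ k = m.2 ∧ l = m.1) →
      mv m D = insert l (D.erase k) := by
    intro k l hk hl hkl
    ext x
    rw [mem_mv, Finset.mem_insert, Finset.mem_erase]
    by_cases hx1 : x = k
    · subst hx1
      have : x ≠ l := fun h => hl (h ▸ hk)
      tauto
    · by_cases hx2 : x = l
      · subst hx2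
        tauto
      · have : x ≠ m.1 ∧ x ≠ m.2 := by
          rcases hkl with ⟨rfl, rfl⟩ | ⟨rfl, rfl⟩ <;> tauto
        tauto
  obtain ⟨h1, h2⟩ := h
  simp only [Occ] at h1 h2
  by_cases hneg : m.1.1 < 0
  · have hk : m.1 ∈ D := h1.2 hneg
    have hl : m.2 ∉ D := fun h => h2 ⟨fun _ => hm.1 hneg, fun _ => h⟩
    exact ⟨m.1, m.2, hk, hl, Or.inl ⟨rfl, rfl⟩, key _ _ hk hl (Or.inl ⟨rfl, rfl⟩)⟩
  · have hl : m.1 ∉ D := fun h => hneg (h1.1 h)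
    have hk : m.2 ∈ D := by
      by_contra h
      exact h2 ⟨fun h' => absurd h' h, fun h' => absurd (hm.2 h') hneg⟩
    exact ⟨m.2, m.1, hk, hl, Or.inr ⟨rfl, rfl⟩, key _ _ hk hl (Or.inr ⟨rfl, rfl⟩)⟩

theorem map_val_insert_erase {F : Finset Idx} {k l : Idx} (hk : k ∈ F) (hl : l ∉ F)
    (h : sgn k = sgn l) : (insert l (F.erase k)).val.map sgn = F.val.map sgn := by
  rw [Finset.insert_val_of_notMem (fun h => hl (Finset.mem_of_mem_erase h)), Multiset.map_cons,
    ← h, ← Multiset.map_cons, ← Finset.insert_val_of_notMem (Finset.notMem_erase k F),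
    Finset.insert_erase hk]

/-- The two exchanged indices lie beyond `n` and have equal sign, so neither the inner part nor the
multiset of outer signs changes. This makes saturated sets of coordinates stable under the outer
group. -/
theorem ty_mv {n : ℕ} {m : Idx × Idx} (hm : Outer n m) {D : Finset Idx} (h : CanMove m D) :
    ty n (mv m D) = ty n D := by
  obtain ⟨k, l, hk, hl, hkl, he⟩ := exists_mv_eq hm.1 h
  have hk' : n < k.1.natAbs := by
    have := hm.2
    rcases hkl with ⟨rfl, rfl⟩ | ⟨rfl, rfl⟩ <;> omega
  have hl' : n < l.1.natAbs := by
    have := hm.2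
    rcases hkl with ⟨rfl, rfl⟩ | ⟨rfl, rfl⟩ <;> omega
  have hs : sgn k = sgn l := by
    have := hm.1
    rw [sgn_eq_iff]
    rcases hkl with ⟨rfl, rfl⟩ | ⟨rfl, rfl⟩ <;> tauto
  have ho : outer n (insert l (D.erase k)) = insert l ((outer n D).erase k) := by
    ext x
    simp only [mem_outer, Finset.mem_insert, Finset.mem_erase]
    constructor
    · rintro ⟨h1 | h1, h2⟩ <;> tauto
    · rintro (rfl | h1) <;> tauto
  have hi : inner n (insert l (D.erase k)) = inner n D := by
    ext x
    simp only [mem_inner, Finset.mem_insert, Finset.mem_erase]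
    constructor
    · rintro ⟨rfl | h1, h2⟩
      · omega
      · exact ⟨h1.2, h2⟩
    · rintro ⟨h1, h2⟩
      exact ⟨Or.inr ⟨by rintro rfl; omega, h1⟩, h2⟩
  rw [he, ty, ty, hi, ho, map_val_insert_erase (mem_outer.2 ⟨hk, hk'⟩)
    (fun h => hl (mem_outer.1 h).1) hs]

/-- Everything in `[-n', n']` is recorded by the inner part at level `n'`, including the signs of
the indices between the two levels. -/
theorem ty_eq_of_le {n n' : ℕ} (h : n ≤ n') {D D' : Finset Idx} (hD : ty n' D = ty n' D') :
    ty n D = ty n D' := by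
  have hi : ∀ D, inner n D = inner n (inner n' D) := fun D => by
    ext x
    simp only [mem_inner]
    constructor
    · exact fun hx => ⟨⟨hx.1, hx.2.trans h⟩, hx.2⟩
    · exact fun hx => ⟨hx.1.1, hx.2⟩
  have ho : ∀ D, (outer n D).val.map sgn =
      (outer n (inner n' D)).val.map sgn + (outer n' D).val.map sgn := fun D => by
    rw [← Multiset.map_add]
    have hd : Disjoint (outer n (inner n' D)) (outer n' D) :=
      Finset.disjoint_left.2 fun x hx hx' => by
        have h1 := (mem_inner.1 (mem_outer.1 hx).1).2
        have h2 := (mem_outer.1 hx').2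
        omega
    rw [← Finset.disjUnion_val _ _ hd]
    congr 2
    ext x
    simp only [Finset.mem_disjUnion, mem_outer, mem_inner]
    constructor
    · intro hx
      rcases le_or_gt x.1.natAbs n' with h' | h'
      · exact Or.inl ⟨⟨hx.1, h'⟩, hx.2⟩
      · exact Or.inr ⟨hx.1, h'⟩
    · rintro (hx | hx)
      · exact ⟨hx.1.1, hx.2⟩
      · exact ⟨hx.1, by omega⟩
  have h1 : inner n' D = inner n' D' := congr(($hD).1)
  have h2 : (outer n' D).val.map sgn = (outer n' D').val.map sgn := congr(($hD).2)
  rw [ty, ty, ho D, ho D', hi D, hi D', h1, h2]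

theorem outer_subset {n n' : ℕ} (h : n ≤ n') (D : Finset Idx) : outer n' D ⊆ outer n D :=
  fun x hx => by
    rw [mem_outer] at *
    exact ⟨hx.1, by omega⟩

/-- The assumption leaves no element of `D` between the two levels. This is how types of maximal
arity are compared when the level is raised. -/
theorem ty_eq_of_card_le {n n' : ℕ} (h : n ≤ n') {D : Finset Idx}
    (hc : (outer n D).card ≤ (outer n' D).card) : ty n' D = ty n D := by
  have ho := Finset.eq_of_subset_of_card_le (outer_subset h D) hc
  have hi : ∀ n, inner n D = D \ outer n D := fun n => by
    ext x
    simp only [mem_inner, Finset.mem_sdiff, mem_outer]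
    constructor
    · exact fun hx => ⟨hx.1, fun h' => by omega⟩
    · exact fun hx => ⟨hx.1, by_contra fun h' => hx.2 ⟨hx.1, by omega⟩⟩
  rw [ty, ty, hi, hi, ho]

theorem finite_natAbs_le (n : ℕ) : {k : Idx | k.1.natAbs ≤ n}.Finite := by
  refine Set.Finite.of_finite_image ((Set.finite_Icc (-(n : ℤ)) n).subset ?_)
    Subtype.val_injective.injOn
  rintro _ ⟨k, hk, rfl⟩
  rw [Set.mem_Icc]
  have : k.1.natAbs ≤ n := hk
  omega

theorem finite_ty (n a : ℕ) : {τ | ∃ D, (outer n D).card ≤ a ∧ ty n D = τ}.Finite := by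
  have h1 : {J : Finset Idx | ∀ k ∈ J, k.1.natAbs ≤ n}.Finite := by
    refine ((finite_natAbs_le n).toFinset.powerset.finite_toSet).subset fun J hJ => ?_
    rw [Finset.mem_coe, Finset.mem_powerset]
    exact fun k hk => (finite_natAbs_le n).mem_toFinset.2 (hJ k hk)
  have h2 : {s : Multiset Bool | s.card ≤ a}.Finite := by
    refine (Set.finite_Iic (a • (Finset.univ : Finset Bool).val)).subset fun s hs => ?_
    rw [Set.mem_Iic, Multiset.le_iff_count]
    intro b
    rw [Multiset.count_nsmul, Multiset.count_eq_one_of_mem Finset.univ.nodup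
      (Finset.mem_univ b), mul_one]
    exact (Multiset.count_le_card b s).trans hs
  refine (h1.prod h2).subset ?_
  rintro _ ⟨D, hD, rfl⟩
  exact ⟨fun k hk => (mem_inner.1 hk).2, by
    change (ty n D).2.card ≤ a
    rwa [card_ty_snd]⟩

/-- The move which replaces the element `k` of `D` by the element `l` of the same sign. -/
def swapMove (k l : Idx) : Idx × Idx := if k.1 < 0 then (k, l) else (l, k)

theorem swapMove_spec {k l : Idx} (h : sgn k = sgn l) :
    ((swapMove k l).1.1 < 0 ↔ (swapMove k l).2.1 < 0) ∧
    (swapMove k l = (k, l) ∨ swapMove k l = (l, k)) ∧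
    ∀ D, CanMove (swapMove k l) D ↔ k ∈ D ∧ l ∉ D := by
  rw [sgn_eq_iff] at h
  simp only [swapMove, CanMove, Occ]
  by_cases hk : k.1 < 0
  · have hl := h.1 hk
    simp [hk, hl]
  · have hl : ¬ l.1 < 0 := fun h' => hk (h.2 h')
    simp only [hk, hl, if_false]
    tauto

theorem mv_swapMove {k l : Idx} {D : Finset Idx} (h : sgn k = sgn l) (hk : k ∈ D) (hl : l ∉ D) :
    mv (swapMove k l) D = insert l (D.erase k) := by
  ext x
  rw [mem_mv, Finset.mem_insert, Finset.mem_erase]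
  have hkl : k ≠ l := fun h => hl (h ▸ hk)
  by_cases hx1 : x = k
  · subst hx1
    rcases (swapMove_spec h).2.1 with h' | h' <;> simp [h'] <;> tauto
  · by_cases hx2 : x = l
    · subst hx2
      rcases (swapMove_spec h).2.1 with h' | h' <;> simp [h'] <;> tauto
    · rcases (swapMove_spec h).2.1 with h' | h' <;> simp [h', hx1, hx2]

/-- Two sets with the same signs are connected by a path. -/
theorem exists_path (A B J : Finset Idx) (hAB : A.val.map sgn = B.val.map sgn)
    (hJA : Disjoint J A) (hJB : Disjoint J B) (hd : Disjoint A B) :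
    ∃ ps : List (Idx × Idx), IsPath ps (J ∪ A) (J ∪ B) ∧ ps.length = A.card ∧
      ∀ m ∈ ps, ∃ k ∈ A, ∃ l ∈ B, sgn k = sgn l ∧ m = swapMove k l := by
  induction A using Finset.induction_on generalizing B J with
  | empty =>
    have : B = ∅ := by
      have h := congrArg Multiset.card hAB
      rw [Multiset.card_map, Multiset.card_map] at h
      exact Finset.card_eq_zero.1 (by simpa using h.symm)
    subst this
    exact ⟨[], rfl, rfl, by simp⟩
  | insert k A hk ih =>
    rw [Finset.insert_val_of_notMem hk, Multiset.map_cons] at hAB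
    have hmem : sgn k ∈ B.val.map sgn := hAB ▸ Multiset.mem_cons_self _ _
    obtain ⟨l, hl, hlk⟩ := Multiset.mem_map.1 hmem
    have hlB : l ∈ B := hl
    rw [← Finset.insert_erase hlB, Finset.insert_val_of_notMem (Finset.notMem_erase _ _),
      Multiset.map_cons, hlk, Multiset.cons_inj_right] at hAB
    rw [Finset.disjoint_insert_right] at hJA
    rw [Finset.disjoint_insert_left] at hd
    have hlA : l ∉ A := fun h => Finset.disjoint_left.1 hd.2 h hlB
    have hlJ : l ∉ J := fun h => Finset.disjoint_left.1 hJB h hlB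
    have hkl : k ≠ l := fun h => hd.1 (h ▸ hlB)
    -- After exchanging `k` for `l`, the index `l` joins the part `J` that stays fixed, and the rest
    -- of `A` is carried to the rest of `B`.
    obtain ⟨ps, hps, hlen, hmv⟩ := ih (B.erase l) (insert l J) hAB
      (Finset.disjoint_insert_left.2 ⟨hlA, hJA.2⟩)
      (Finset.disjoint_insert_left.2 ⟨Finset.notMem_erase _ _,
        hJB.mono_right (Finset.erase_subset _ _)⟩)
      (hd.2.mono_right (Finset.erase_subset _ _))
    refine ⟨swapMove k l :: ps, ⟨?_, ?_⟩, ?_, ?_⟩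
    · rw [(swapMove_spec hlk.symm).2.2]
      refine ⟨by simp, ?_⟩
      simp only [Finset.mem_union, Finset.mem_insert, not_or]
      exact ⟨hlJ, hkl.symm, hlA⟩
    · rw [mv_swapMove hlk.symm (by simp) (by
        simp only [Finset.mem_union, Finset.mem_insert, not_or]
        exact ⟨hlJ, hkl.symm, hlA⟩)]
      have e1 : insert l ((J ∪ insert k A).erase k) = insert l J ∪ A := by
        ext x
        simp only [Finset.mem_insert, Finset.mem_erase, Finset.mem_union]
        constructor
        · tauto
        · rintro ((rfl | h) | h)
          · tauto
          · exact Or.inr ⟨by rintro rfl; exact hJA.1 h, Or.inl h⟩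
          · exact Or.inr ⟨by rintro rfl; exact hk h, Or.inr (Or.inr h)⟩
      have e2 : J ∪ B = insert l J ∪ B.erase l := by
        conv_lhs => rw [← Finset.insert_erase hlB]
        simp
      rw [e1, e2]
      exact hps
    · rw [List.length_cons, hlen, Finset.card_insert_of_notMem hk]
    · intro m hm
      rcases List.mem_cons.1 hm with rfl | hm
      · exact ⟨k, Finset.mem_insert_self _ _, l, hlB, hlk.symm, rfl⟩
      · obtain ⟨k', hk', l', hl', h⟩ := hmv m hm
        exact ⟨k', Finset.mem_insert_of_mem hk', l', Finset.mem_of_mem_erase hl', h⟩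

end BoundedArity

end PluckerLimit

namespace PluckerLimit

/-! ### Noetherianity for coordinates of bounded arity. -/

section BoundedArity

open MvPolynomial Set

variable {K : Type*} [Field K] {ε : Idx × Idx → Finset Idx → K}

/-- Membership in `S` only depends on the type at level `n`. -/
def Saturated (n : ℕ) (S : Set (Finset Idx)) : Prop :=
  ∀ D D', ty n D = ty n D' → D ∈ S → D' ∈ S

theorem Saturated.mv_mem {n : ℕ} {S : Set (Finset Idx)} (hS : Saturated n S) (m : Idx × Idx)
    (hm : Outer n m) (D : Finset Idx) (hD : D ∈ S) (h : CanMove m D) : mv m D ∈ S :=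
  hS D _ (ty_mv hm h).symm hD

theorem Saturated.mono {n n' : ℕ} (h : n ≤ n') {S : Set (Finset Idx)} (hS : Saturated n S) :
    Saturated n' S := fun D D' hD => hS D D' (ty_eq_of_le h hD)

theorem Saturated.sdiff {n : ℕ} {S : Set (Finset Idx)} (hS : Saturated n S)
    (τ : Finset Idx × Multiset Bool) : Saturated n (S \ {D | ty n D = τ}) :=
  fun D D' h hD => ⟨hS D D' h hD.1, fun h' => hD.2 (h.trans h')⟩

/-- Where the Hasse derivative is nonzero, every coordinate of type `τ` at a higher level `n'` lies
in the root closure of the other coordinates, for which `hIH` gives Noetherianity. The level `n'`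
bounds all indices occurring in `f`: then the Hasse derivative is invariant under `outerGroup ε n'`,
and it does not itself involve coordinates of type `τ` at level `n'`. -/
theorem noeth_hasse_ne_zero [Infinite K] (hε : ∀ m D, ε m D ≠ 0) {n : ℕ} {S : Set (Finset Idx)}
    {τ : Finset Idx × Multiset Bool} (hS : Saturated n S) (hτ : 1 ≤ τ.2.card)
    (hIH : ∀ n' ≥ n, Noeth (outerGroup ε n')
      (polyFun K (S \ {D | ty n' D = τ}) : Set ((Finset Idx → K) → K)) univ)
    {Y : Set (Finset Idx → K)} (hYG : ∀ g ∈ outerGroup ε n, ∀ z ∈ Y, g z ∈ Y)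
    (hYR : ∀ z ∈ Y, ∀ z' : Finset Idx → K, (∀ D, ty n D ≠ τ → z D = z' D) → z' ∈ Y)
    {f : MvPolynomial (Finset Idx) K} (hf : f ∈ supported K S) {s : Finset Idx}
    (hs : ty n s = τ) (hsf : s ∈ f.vars) {q : ℕ} (hq : 1 ≤ q)
    (hlow : ∀ d, 0 < d → d < q → ∀ z ∈ Y, eval z (hasse s d f) = 0)
    (hne : ∃ z ∈ Y, eval z (hasse s q f) ≠ 0) :
    Noeth (outerGroup ε n) (polyFun K S : Set ((Finset Idx → K) → K))
      {z | z ∈ Y ∩ van (outerGroup ε n) (fun z => eval z f) ∧ eval z (hasse s q f) ≠ 0} := by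
  have hfv : ↑f.vars ⊆ S := mem_supported.1 hf
  obtain ⟨n', hn', hvars⟩ : ∃ n' ≥ n, ∀ D ∈ f.vars, ∀ k ∈ D, k.1.natAbs ≤ n' := by
    refine ⟨max n (f.vars.sup fun D => D.sup fun k => k.1.natAbs), le_max_left _ _, ?_⟩
    intro D hD k hk
    refine le_trans ?_ (le_max_right _ _)
    exact (Finset.le_sup (f := fun k : Idx => k.1.natAbs) hk).trans
      (Finset.le_sup (f := fun D : Finset Idx => D.sup fun k => k.1.natAbs) hD)
  have houter : ∀ D ∈ f.vars, outer n' D = ∅ := fun D hD => by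
    rw [Finset.eq_empty_iff_forall_notMem]
    intro k hk
    have h1 := mem_outer.1 hk
    have h2 := hvars D hD k h1.1
    omega
  have hvty : ∀ D ∈ f.vars, ty n' D ≠ τ := fun D hD h => by
    rw [← h, card_ty_snd, houter D hD, Finset.card_empty] at hτ
    omega
  have hshift : ∀ z ∈ Y, ∀ y, shift s z y ∈ Y := fun z hz y => by
    refine hYR z hz _ fun D hD => ?_
    have : D ≠ s := by rintro rfl; exact hD hs
    simp [shift, this]
  obtain ⟨z₀, hz₀, hz₀q⟩ := hne
  have hadd := add_pow_of_hasse_vanish hshift hq hlow hz₀ hz₀q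
  have hh : (fun z => eval z (hasse s q f)) ∈ polyFun K (S \ {D | ty n' D = τ}) := by
    refine mem_polyFun.2 ⟨hasse s q f, hasse_mem_supported ?_ s q, fun _ => rfl⟩
    exact mem_supported.2 fun D hD => ⟨hfv hD, hvty D hD⟩
  have hle : polyFun K S ≤ rootClosure (polyFun K (S \ {D | ty n' D = τ}))
      {z | z ∈ Y ∩ van (outerGroup ε n) (fun z => eval z f) ∧ eval z (hasse s q f) ≠ 0}
      _ hh q hadd := by
    refine polyFun_le fun D hD => ?_
    by_cases hDτ : ty n' D = τ
    swap
    · exact le_rootClosure (coord_mem_polyFun ⟨hD, hDτ⟩)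
    have hinner : inner n s = inner n' D := congr(($(hs.trans hDτ.symm)).1)
    have hmapo : (outer n s).val.map sgn = (outer n' D).val.map sgn :=
      congr(($(hs.trans hDτ.symm)).2)
    -- The indices of `s` beyond `n`, all of which lie within `[-n', n']`, are exchanged for the
    -- indices of `D` beyond `n'`.
    obtain ⟨ps, hps, hlen, hmv⟩ := exists_path (outer n s) (outer n' D) (inner n s) hmapo
      (Finset.disjoint_left.2 fun k h1 h2 => by
        have := (mem_inner.1 h1).2; have := (mem_outer.1 h2).2; omega)
      (Finset.disjoint_left.2 fun k h1 h2 => by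
        have := (mem_inner.1 h1).2; have := (mem_outer.1 h2).2; omega)
      (Finset.disjoint_left.2 fun k h1 h2 => by
        have := hvars s hsf k (mem_outer.1 h1).1; have := (mem_outer.1 h2).2; omega)
    have hcard : (outer n s).card = τ.2.card := by rw [← hs, card_ty_snd]
    rw [inner_union_outer, hinner, inner_union_outer] at hps
    have hout : ∀ m ∈ ps, Outer n m := by
      intro m hm
      obtain ⟨k, hk, l, hl, hkl, rfl⟩ := hmv m hm
      have hk' := (mem_outer.1 hk).2
      have hl' := (mem_outer.1 hl).2
      refine ⟨(swapMove_spec hkl).1, ?_⟩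
      rcases (swapMove_spec hkl).2.1 with h | h <;> rw [h] <;> constructor <;> dsimp only <;> omega
    -- Each move exchanges an index within `[-n', n']` for one beyond it, so the number of indices
    -- beyond `n'` serves as a grading.
    have hgr : IsGraded ps S (fun D => (outer n' D).card) (fun _ => 1) := by
      refine ⟨fun m hm => hS.mv_mem m (hout m hm), ?_, fun _ _ => le_rfl⟩
      intro m hm E _ hcan
      obtain ⟨k, hk, l, hl, hkl, rfl⟩ := hmv m hm
      have hkl' := ((swapMove_spec hkl).2.2 E).1 hcan
      rw [mv_swapMove hkl hkl'.1 hkl'.2]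
      have hk' := hvars s hsf k (mem_outer.1 hk).1
      have hl' := (mem_outer.1 hl).2
      have : outer n' (insert l (E.erase k)) = insert l (outer n' E) := by
        ext x
        simp only [mem_outer, Finset.mem_insert, Finset.mem_erase]
        constructor
        · tauto
        · rintro (rfl | h)
          · tauto
          · exact ⟨Or.inr ⟨by rintro rfl; omega, h.1⟩, h.2⟩
      rw [this, Finset.card_insert_of_notMem fun h => hkl'.2 (mem_outer.1 h).1]
    have hsum : (ps.map fun _ => 1).sum = τ.2.card := by
      simp [hlen, hcard]
    have hlowA : ∀ r ∈ f.vars, ∀ D'' ∈ S, (outer n' D'').card < (outer n' r).card +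
        (ps.map fun _ => 1).sum → crd K D'' ∈ polyFun K (S \ {D | ty n' D = τ}) := by
      intro r hr D'' hD'' hlt
      refine coord_mem_polyFun ⟨hD'', fun h => ?_⟩
      rw [houter r hr, Finset.card_empty, zero_add, hsum] at hlt
      have h' : ty n' D'' = τ := h
      rw [← card_ty_snd, h'] at hlt
      omega
    obtain ⟨X, hX⟩ := IsPath.exists_symmDiff ps
    obtain ⟨p, hp, hpz⟩ := exists_relation (A := polyFun K (S \ {D | ty n' D = τ}))
      (Z := {z | z ∈ Y ∩ van (outerGroup ε n) (fun z => eval z f) ∧ eval z (hasse s q f) ≠ 0})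
      (ε := ε) (f := f) (s := s) (D' := D) hq (ps := ps) (by
        rintro rfl
        rw [List.length_nil, hcard] at hlen
        omega)
      (pathPoly_decomp hε hgr (hfv hsf) (hlowA s hsf) hps) (by
        -- A full path from another variable `r` cannot end in type `τ`: the displacement is the
        -- same as from `s`, so equal inner parts at level `n'` at the ends would force `r = s`,
        -- both being contained in `[-n', n']`.
        intro r hr hrs
        refine pathPoly_mem_of_not_isPath hgr (hfv hr) (hlowA r hr) fun D' hD' => ?_
        refine coord_mem_polyFun ⟨(hgr.target (hfv hr) hD').1, fun h => hrs ?_⟩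
        have h' : inner n' D' = inner n' D := congr(($((show ty n' D' = τ from h).trans hDτ.symm)).1)
        rw [hX _ _ hD', hX _ _ hps] at h'
        ext k
        by_cases hk : k.1.natAbs ≤ n'
        · have := congr(k ∈ $h')
          simp only [mem_inner, hk, and_true, Finset.mem_symmDiff, eq_iff_iff] at this
          tauto
        · exact iff_of_false (fun h => hk (hvars r hr k h)) (fun h => hk (hvars s hsf k h))) (by
        intro z hz t
        exact hz.1.2 _ (pathPerm_mem t fun m hm => tv_mem_outerGroup (hout m hm) t)) (by
        -- The set `Y` puts no condition on coordinates of type `τ` at level `n`, so changing the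
        -- coordinate `s` of the deformed point does not leave `Y`.
        intro d hd hdq z hz t w hw
        refine hlow d hd hdq w (hYR _ (hYG _ (pathPerm_mem t fun m hm =>
          tv_mem_outerGroup (hout m hm) t) z hz.1.1) w fun D hD => hw D ?_)
        rintro rfl
        exact hD hs)
    exact mem_rootClosure_of_mul_pow (le_rootClosure hp) hpz
  refine (hIH n' hn').transfer id (fun _ _ => mem_univ _) ?_ ?_
  · intro g hg
    refine ⟨g, outerGroup_mono hn' hg, fun z hz => ⟨⟨⟨hYG g (outerGroup_mono hn' hg) z hz.1.1,
      van_stable (outerGroup_mono hn' hg) hz.1.2⟩, ?_⟩, rfl⟩⟩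
    rw [eval_outerGroup (n := n') _ hg]
    · exact hz.2
    · intro D hD
      exact hvars D (mem_supported.1
        (hasse_mem_supported (mem_supported.2 (Set.Subset.refl (f.vars : Set (Finset Idx)))) s q) hD)
  · intro F hF
    exact exists_zero_iff_of_mem_rootClosure (fun z hz => hz.2) (by omega) (hle hF)

/-- Removal of one type of coordinates. -/
theorem noeth_of_remove_type [Infinite K] (hε : ∀ m D, ε m D ≠ 0) {n : ℕ} {S : Set (Finset Idx)}
    {τ : Finset Idx × Multiset Bool} (hS : Saturated n S) (hτ : 1 ≤ τ.2.card)
    (hIH : ∀ n' ≥ n, Noeth (outerGroup ε n')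
      (polyFun K (S \ {D | ty n' D = τ}) : Set ((Finset Idx → K) → K)) univ) :
    Noeth (outerGroup ε n) (polyFun K S : Set ((Finset Idx → K) → K)) univ := by
  classical
  have hS' := hS.sdiff τ
  -- The outer induction runs over closed stable sets `Y` cut out by equations without coordinates
  -- of type `τ`; the inner one, in `claim`, is on the degree of an additional equation `f`.
  refine Noeth.induction (hIH n le_rfl) (fun Y => (∀ g ∈ outerGroup ε n, ∀ z ∈ Y, g z ∈ Y) →
    (∀ z ∈ Y, ∀ z' : Finset Idx → K, (∀ D, ty n D ≠ τ → z D = z' D) → z' ∈ Y) →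
    Noeth (outerGroup ε n) (polyFun K S : Set ((Finset Idx → K) → K)) Y) ?_
    (fun _ _ _ _ => mem_univ _) (fun _ _ _ _ => mem_univ _)
  intro Y hY hYG hYR
  have claim : ∀ d, ∀ f ∈ supported K S, f.totalDegree < d → (∃ z ∈ Y, eval z f ≠ 0) →
      Noeth (outerGroup ε n) (polyFun K S : Set ((Finset Idx → K) → K))
        (Y ∩ van (outerGroup ε n) (fun z => eval z f)) := by
    intro d
    induction d with
    | zero => intro f _ h; omega
    | succ d ih =>
      intro f hf hdeg hfY
      -- If some Hasse derivative in a direction of type `τ` is nonzero on `Y`, the set splits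
      -- according to whether that derivative vanishes on the orbit. Otherwise `f` agrees on `Y`
      -- with a polynomial free of these coordinates, and the outer induction applies.
      by_cases hcase : ∃ s, ty n s = τ ∧ ∃ q, 1 ≤ q ∧ ∃ z ∈ Y, eval z (hasse s q f) ≠ 0
      · obtain ⟨s, hs, hex⟩ := hcase
        obtain ⟨hq, hne⟩ := Nat.find_spec hex
        set q := Nat.find hex
        have hlow : ∀ d, 0 < d → d < q → ∀ z ∈ Y, eval z (hasse s d f) = 0 := by
          intro d hd hdq z hz
          by_contra hcon
          exact Nat.find_min hex hdq ⟨hd, z, hz, hcon⟩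
        have hneq : hasse s q f ≠ 0 := by
          obtain ⟨z, _, hz⟩ := hne
          intro h
          rw [h, map_zero] at hz
          exact hz rfl
        have hsf : s ∈ f.vars := by
          by_contra h
          exact hneq (hasse_eq_zero_of_notMem h hq)
        have h1 := ih (hasse s q f) (hasse_mem_supported hf s q)
          (by have := totalDegree_hasse_lt hq hneq; omega) hne
        have h2 := noeth_hasse_ne_zero hε hS hτ hIH hYG hYR hf hs hsf hq hlow hne
        have h3 : Noeth (outerGroup ε n) (polyFun K S : Set ((Finset Idx → K) → K))
            {z | ∃ g ∈ outerGroup ε n, g z ∈ {z | z ∈ Y ∩ van (outerGroup ε n)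
              (fun z => eval z f) ∧ eval z (hasse s q f) ≠ 0}} :=
          h2.of_orbit (fun g hg F hF => polyFun_comp_outerGroup hS.mv_mem hg F hF)
            fun z hz => hz
        refine (h1.union h3).mono (subset_refl _) fun z hz => ?_
        by_cases hzh : z ∈ van (outerGroup ε n) (fun z => eval z (hasse s q f))
        · exact Or.inl ⟨hz.1, hzh⟩
        · simp only [van, mem_ofPred_eq, not_forall] at hzh
          obtain ⟨g, hg, hgz⟩ := hzh
          exact Or.inr ⟨g, hg, ⟨hYG g hg z hz.1, van_stable hg hz.2⟩, hgz⟩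
      · push Not at hcase
        have hsame : ∀ z ∈ Y, eval (fun D => if ty n D = τ then 0 else z D) f = eval z f :=
          fun z hz => eval_eq_of_hasse_vanish (R := {D | ty n D = τ}) hYR
            (fun s hs d hd z hz => hcase s hs d hd z hz) hz
            (fun D hD => (if_neg hD).symm)
        have hF : (fun z => eval (fun D => if ty n D = τ then 0 else z D) f) ∈
            polyFun K (S \ {D | ty n D = τ}) := by
          let φ : ((Finset Idx → K) → K) →ₐ[K] ((Finset Idx → K) → K) :=
            AlgHom.pi fun z => Pi.evalAlgHom K _ (fun D => if ty n D = τ then 0 else z D)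
          have h : polyFun K S ≤ (polyFun K (S \ {D | ty n D = τ})).comap φ := by
            refine polyFun_le fun D hD => ?_
            rw [Subalgebra.mem_comap]
            by_cases hDτ : ty n D = τ
            · have : φ (fun z => z D) = 0 := by
                funext z
                simp [φ, AlgHom.pi_apply, hDτ]
              rw [this]
              exact zero_mem _
            · have : φ (fun z => z D) = fun z => z D := by
                funext z
                simp [φ, AlgHom.pi_apply, hDτ]
              rw [this]
              exact coord_mem_polyFun ⟨hD, hDτ⟩
          exact h (mem_polyFun.2 ⟨f, hf, fun _ => rfl⟩)
        set F : (Finset Idx → K) → K := fun z => eval (fun D => if ty n D = τ then 0 else z D) f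
        have hvan : Y ∩ van (outerGroup ε n) (fun z => eval z f) = Y ∩ van (outerGroup ε n) F := by
          ext z
          refine and_congr_right fun hz => ?_
          simp only [van, mem_ofPred_eq]
          exact forall₂_congr fun g hg => by rw [← hsame _ (hYG g hg z hz)]
        rw [hvan]
        obtain ⟨z₁, hz₁, hne₁⟩ := hfY
        refine hY F hF ⟨z₁, hz₁, ?_⟩ (fun g hg z hz => ⟨hYG g hg z hz.1, van_stable hg hz.2⟩) ?_
        · change eval _ f ≠ 0
          rwa [hsame z₁ hz₁]
        · intro z hz z' hzz'
          refine ⟨hYR z hz.1 z' hzz', fun g hg => ?_⟩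
          rw [← hz.2 g hg]
          exact polyFun_congr (polyFun_comp_outerGroup hS'.mv_mem hg F hF)
            fun D hD => (hzz' D hD.2).symm
  -- Unless the first function vanishes on all of `Y`, either it is nonzero on the orbit of some
  -- later point or all later points lie in its vanishing set, where `claim` applies to the shifted
  -- sequence.
  intro z F hz hF
  by_cases h0 : ∃ z ∈ Y, F 0 z ≠ 0
  · obtain ⟨f, hf, hfF⟩ := mem_polyFun.1 (hF 0)
    have hfF' : F 0 = fun z => eval z f := funext hfF
    by_cases hall : ∀ i, z (i + 1) ∈ van (outerGroup ε n) (F 0)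
    · rw [hfF'] at hall h0
      have := claim (f.totalDegree + 1) f hf (Nat.lt_succ_self _) h0
      obtain ⟨i, hi | ⟨j, hj, g, hg, hne⟩⟩ := this (fun i => z (i + 1)) (fun i => F (i + 1))
        (fun i => ⟨hz _, hall i⟩) (fun i => hF _)
      · exact ⟨i + 1, Or.inl hi⟩
      · exact ⟨i + 1, Or.inr ⟨j + 1, by omega, g, hg, hne⟩⟩
    · simp only [van, mem_ofPred_eq, not_forall] at hall
      obtain ⟨i, g, hg, hne⟩ := hall
      exact ⟨i + 1, Or.inr ⟨0, Nat.succ_pos i, g, hg, hne⟩⟩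
  · push Not at h0
    exact ⟨0, Or.inl (h0 _ (hz 0))⟩

/-- The types of maximal arity which occur in a set of coordinates. -/
def topTypes (n a : ℕ) (S : Set (Finset Idx)) : Set (Finset Idx × Multiset Bool) :=
  {τ | τ.2.card = a ∧ ∃ D ∈ S, ty n D = τ}

theorem finite_topTypes (n a : ℕ) (S : Set (Finset Idx)) : (topTypes n a S).Finite := by
  refine (finite_ty n a).subset ?_
  rintro _ ⟨ha, D, _, rfl⟩
  exact ⟨D, by rw [← card_ty_snd, ha], rfl⟩

/-- Points whose coordinates have bounded arity form a Noetherian space up to the outer group. -/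
theorem noeth_of_bounded_arity [Infinite K] (hε : ∀ m D, ε m D ≠ 0) (a : ℕ) (n : ℕ)
    (S : Set (Finset Idx)) (hS : Saturated n S) (ha : ∀ D ∈ S, (outer n D).card ≤ a) :
    Noeth (outerGroup ε n) (polyFun K S : Set ((Finset Idx → K) → K)) univ := by
  induction a generalizing n S with
  | zero =>
    refine Noeth.of_finite _ ?_
    refine ((finite_natAbs_le n).toFinset.powerset.finite_toSet).subset fun D hD => ?_
    rw [Finset.mem_coe, Finset.mem_powerset]
    intro k hk
    rw [(finite_natAbs_le n).mem_toFinset]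
    by_contra h
    have := Finset.card_pos.2 ⟨k, mem_outer.2 ⟨hk, not_le.1 h⟩⟩
    have := ha D hD
    omega
  | succ a iha =>
    -- A second induction, on the number of types of maximal arity. Level and coordinate set stay
    -- general because removing a type involves all higher levels.
    obtain ⟨c, hc⟩ : ∃ c, (topTypes n (a + 1) S).ncard ≤ c := ⟨_, le_rfl⟩
    induction c generalizing n S with
    | zero =>
      have hempty : topTypes n (a + 1) S = ∅ :=
        (Set.ncard_eq_zero (finite_topTypes _ _ _)).1 (Nat.le_zero.1 hc)
      refine iha n S hS fun D hD => ?_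
      have h1 := ha D hD
      by_contra h2
      have : ty n D ∈ topTypes n (a + 1) S := ⟨by rw [card_ty_snd]; omega, D, hD, rfl⟩
      rw [hempty] at this
      exact this
    | succ c ihc =>
      by_cases hempty : topTypes n (a + 1) S = ∅
      · exact ihc n S hS ha (by rw [hempty, Set.ncard_empty]; omega)
      · obtain ⟨τ, hτ⟩ := Set.nonempty_iff_ne_empty.2 hempty
        refine noeth_of_remove_type hε hS (by rw [hτ.1]; omega) (τ := τ) fun n' hn' => ?_
        refine ihc n' _ ((hS.mono hn').sdiff τ) (fun D hD => (Finset.card_le_card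
          (outer_subset hn' D)).trans (ha D hD.1)) ?_
        -- A set with `a + 1` elements beyond `n'` has none between `n` and `n'`, so raising the
        -- level creates no new types of maximal arity, and `τ` is gone.
        have hsub : topTypes n' (a + 1) (S \ {D | ty n' D = τ}) ⊆
            topTypes n (a + 1) S \ {τ} := by
          rintro _ ⟨hcard, D, hD, rfl⟩
          rw [card_ty_snd] at hcard
          have heq : ty n' D = ty n D := ty_eq_of_card_le hn' (by rw [hcard]; exact ha D hD.1)
          refine ⟨⟨by rw [card_ty_snd]; exact hcard, D, hD.1, heq.symm⟩, ?_⟩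
          exact fun h => hD.2 h
        have := Set.ncard_le_ncard hsub ((finite_topTypes _ _ _).subset Set.sdiff_subset)
        rw [Set.ncard_sdiff_singleton_of_mem hτ] at this
        omega

end BoundedArity

end PluckerLimit

namespace PluckerLimit

/-! ### Charge, thin monomials and paths out of a plane. -/

section BoundedRank

open MvPolynomial Set

/-- The charge of a monomial. -/
def chg (D : Finset Idx) : ℤ := ∑ k ∈ D, if k.1 < 0 then -1 else 1

theorem chg_eq (D : Finset Idx) :
    chg D = ((D.filter fun k => ¬ k.1 < 0).card : ℤ) - (D.filter fun k => k.1 < 0).card := by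
  rw [chg, Finset.sum_ite]
  simp
  ring

theorem chg_toggle (D : Finset Idx) (k : Idx) :
    chg (symmDiff D {k}) = chg D + if Occ k D then 1 else -1 := by
  by_cases hk : k ∈ D
  · have h : symmDiff D {k} = D.erase k := by
      ext x
      simp only [Finset.mem_symmDiff, Finset.mem_singleton, Finset.mem_erase]
      by_cases hx : x = k
      · subst hx; tauto
      · tauto
    have h2 := Finset.add_sum_erase D (fun k : Idx => if k.1 < 0 then (-1 : ℤ) else 1) hk
    rw [h, chg, chg, ← h2]
    simp only [Occ, hk, true_iff]
    split_ifs <;> ring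
  · have h : symmDiff D {k} = insert k D := by
      ext x
      simp only [Finset.mem_symmDiff, Finset.mem_singleton, Finset.mem_insert]
      by_cases hx : x = k
      · subst hx; tauto
      · tauto
    rw [h, chg, chg, Finset.sum_insert hk]
    simp only [Occ, hk, false_iff]
    split_ifs <;> ring

theorem chg_mv {m : Idx × Idx} {D : Finset Idx} (h : CanMove m D) : chg (mv m D) = chg D := by
  have hne : m.1 ≠ m.2 := fun he => h.2 (he ▸ h.1)
  have hm : mv m D = symmDiff (symmDiff D {m.1}) {m.2} := by
    ext x
    simp only [mem_mv, Finset.mem_symmDiff, Finset.mem_singleton]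
    by_cases h1 : x = m.1
    · subst h1
      tauto
    · tauto
  have h2 : Occ m.2 (symmDiff D {m.1}) ↔ Occ m.2 D := by
    simp only [Occ, Finset.mem_symmDiff, Finset.mem_singleton]
    tauto
  rw [hm, chg_toggle, chg_toggle, if_pos h.1, if_neg (fun h' => h.2 (h2.1 h'))]
  ring

/-- The monomials of charge zero. -/
def balanced : Set (Finset Idx) := {D | chg D = 0}

/-- The monomials of charge zero which differ from the highest one only in `[-n, 2]`. -/
def planeSet (n : ℕ) : Set (Finset Idx) := {D | chg D = 0 ∧ ∀ k ∈ D, -(n : ℤ) ≤ k.1 ∧ k.1 ≤ 2}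

/-- The monomials of charge zero with at most one index below `-n`. -/
def thinSet (n : ℕ) : Set (Finset Idx) :=
  {D | chg D = 0 ∧ (D.filter fun k => k.1 < -(n : ℤ)).card ≤ 1}

theorem planeSet_subset_thinSet (n : ℕ) : planeSet n ⊆ thinSet n := fun D hD => by
  refine ⟨hD.1, ?_⟩
  rw [Finset.filter_eq_empty_iff.2 (fun k hk => not_lt.2 (hD.2 k hk).1), Finset.card_empty]
  exact Nat.zero_le _

/-- Both the charge and the number of indices below `-n` can be read off from the inner part and the
multiset of outer signs. -/
theorem saturated_thinSet (n : ℕ) : Saturated n (thinSet n) := by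
  have h1 : ∀ D, (D.filter fun k : Idx => k.1 < -(n : ℤ)).card =
      Multiset.count true ((outer n D).val.map sgn) := by
    intro D
    have h : (outer n D).val.filter (fun k => true = sgn k) =
        ((outer n D).filter fun k => k.1 < 0).val := by
      rw [Finset.filter_val]
      exact Multiset.filter_congr fun k _ => by simp [sgn]
    rw [Multiset.count_map, h, Finset.card_val]
    congr 1
    ext k
    rw [Finset.mem_filter, Finset.mem_filter, mem_outer, and_assoc]
    refine and_congr_right fun _ => ?_
    omega
  have h2 : ∀ D, chg D = chg (inner n D) +
      (((outer n D).val.map sgn).map fun b => if b then (-1 : ℤ) else 1).sum := by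
    intro D
    have hd : Disjoint (inner n D) (outer n D) := Finset.disjoint_left.2 fun k h1 h2 => by
      have := (mem_inner.1 h1).2; have := (mem_outer.1 h2).2; omega
    conv_lhs => rw [← inner_union_outer n D, chg, Finset.sum_union hd]
    congr 1
    rw [Multiset.map_map]
    rw [Finset.sum]
    congr 1
    exact Multiset.map_congr rfl fun k _ => by simp [sgn]
  rintro D D' h ⟨hD1, hD2⟩
  have hi : inner n D = inner n D' := congr(($h).1)
  have ho : (outer n D).val.map sgn = (outer n D').val.map sgn := congr(($h).2)
  refine ⟨?_, ?_⟩
  · rw [← hD1, h2, h2 D, hi, ho]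
  · rw [h1, ho, ← h1] at hD2
    exact hD2

/-- At most one negative index lies below `-n`, and charge zero forces equally many positive and
negative ones. This bounds the arity of thin monomials. -/
theorem card_le_of_mem_thinSet {n : ℕ} {D : Finset Idx} (hD : D ∈ thinSet n) :
    D.card ≤ 2 * ((finite_natAbs_le n).toFinset.card + 1) := by
  have hneg : (D.filter fun k => k.1 < 0).card ≤ (finite_natAbs_le n).toFinset.card + 1 := by
    have hsub : (D.filter fun k => k.1 < 0) ⊆
        (finite_natAbs_le n).toFinset ∪ D.filter fun k => k.1 < -(n : ℤ) := by
      intro k hk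
      rw [Finset.mem_filter] at hk
      rw [Finset.mem_union, Finset.mem_filter, (finite_natAbs_le n).mem_toFinset]
      rcases le_or_gt (-(n : ℤ)) k.1 with h | h
      · exact Or.inl (by change k.1.natAbs ≤ n; omega)
      · exact Or.inr ⟨hk.1, h⟩
    have := Finset.card_le_card hsub
    have := Finset.card_union_le (finite_natAbs_le n).toFinset (D.filter fun k => k.1 < -(n : ℤ))
    have := hD.2
    omega
  have h0 := hD.1
  rw [chg_eq] at h0
  have := Finset.card_filter_add_card_filter_not (s := D) (fun k : Idx => k.1 < 0)
  omega

/-- The occupied indices which are at most two. -/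
def lowOcc (D : Finset Idx) : Finset Idx :=
  (D.filter fun k => k.1 < 0) ∪ (({posIdx 0, posIdx 1} : Finset Idx) \ D)

theorem mem_lowOcc {D : Finset Idx} {k : Idx} : k ∈ lowOcc D ↔ k.1 ≤ 2 ∧ Occ k D := by
  have h0 := k.2
  have h1 : k = posIdx 0 ↔ k.1 = 1 := by
    rw [← Subtype.coe_inj]; simp [posIdx]
  have h2 : k = posIdx 1 ↔ k.1 = 2 := by
    rw [← Subtype.coe_inj]; simp [posIdx]
  simp only [lowOcc, Finset.mem_union, Finset.mem_filter, Finset.mem_sdiff, Finset.mem_insert,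
    Finset.mem_singleton, Occ, h1, h2]
  by_cases hk : k ∈ D
  · simp only [hk, true_and, not_true_eq_false, and_false, or_false, true_iff]
    omega
  · simp only [hk, false_and, not_false_eq_true, and_true, false_or, false_iff]
    omega

/-- In the highest monomial exactly `1` and `2` are occupied among the indices up to `2`; charge
zero means that every vacancy above `2` is balanced by one more occupied index there. -/
theorem card_lowOcc {D : Finset Idx} (hD : chg D = 0) :
    (lowOcc D).card = (D.filter fun k => 2 < k.1).card + 2 := by
  have hd : Disjoint (D.filter fun k => k.1 < 0) (({posIdx 0, posIdx 1} : Finset Idx) \ D) :=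
    Finset.disjoint_left.2 fun k h1 h2 => (Finset.mem_sdiff.1 h2).2 (Finset.mem_filter.1 h1).1
  have hpair : ({posIdx 0, posIdx 1} : Finset Idx).card = 2 :=
    Finset.card_pair (by rw [Ne, ← Subtype.coe_inj]; simp [posIdx])
  have hsd := Finset.card_sdiff_add_card_inter ({posIdx 0, posIdx 1} : Finset Idx) D
  have hpos : (D.filter fun k => ¬ k.1 < 0) =
      (D.filter fun k => 2 < k.1) ∪ (({posIdx 0, posIdx 1} : Finset Idx) ∩ D) := by
    ext k
    have h0 := k.2
    have h1 : k = posIdx 0 ↔ k.1 = 1 := by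
      rw [← Subtype.coe_inj]; simp [posIdx]
    have h2 : k = posIdx 1 ↔ k.1 = 2 := by
      rw [← Subtype.coe_inj]; simp [posIdx]
    simp only [Finset.mem_union, Finset.mem_filter, Finset.mem_inter, Finset.mem_insert,
      Finset.mem_singleton, h1, h2]
    by_cases hk : k ∈ D
    · simp only [hk, true_and, and_true]; omega
    · simp [hk]
  have hd2 : Disjoint (D.filter fun k => 2 < k.1) (({posIdx 0, posIdx 1} : Finset Idx) ∩ D) := by
    refine Finset.disjoint_left.2 fun k h1 h2 => ?_
    have h1 := (Finset.mem_filter.1 h1).2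
    have h2 := (Finset.mem_inter.1 h2).1
    simp only [Finset.mem_insert, Finset.mem_singleton] at h2
    rcases h2 with rfl | rfl <;> simp [posIdx] at h1
  have hc : (D.filter fun k => ¬ k.1 < 0).card = _ := congrArg Finset.card hpos
  rw [Finset.card_union_of_disjoint hd2] at hc
  rw [chg_eq] at hD
  rw [lowOcc, Finset.card_union_of_disjoint hd]
  omega

theorem eq_of_lowOcc_eq {D D' : Finset Idx} (h : lowOcc D = lowOcc D')
    (h2 : ∀ k : Idx, 2 < k.1 → (k ∈ D ↔ k ∈ D')) : D = D' := by
  refine ext_occ fun k => ?_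
  rcases le_or_gt k.1 2 with hk | hk
  · have := congr(k ∈ $h)
    simp only [mem_lowOcc, hk, true_and, eq_iff_iff] at this
    exact this
  · simp only [Occ, h2 k hk]

/-- The moves which are used to reach monomials with two prescribed indices `a` and `b` from the
monomials in `planeSet n`. -/
theorem exists_plane_path {n : ℕ} {s : Finset Idx} (hs : s ∈ planeSet n) {k l a b : Idx}
    (hkl : k ≠ l) (hQ : lowOcc s = {k, l}) (hab : a ≠ b) (ha : a.1 < -(n : ℤ))
    (hb : b.1 < -(n : ℤ)) {D : Finset Idx} (hD : chg D = 0) (haD : a ∈ D) (hbD : b ∈ D) :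
    ∃ ps, IsPath ((k, a) :: (l, b) :: ps) s D ∧ ∀ m ∈ ps, 2 < m.1.1 ∧ m.2.1 ≤ 2 := by
  -- Induction on the number of vacancies of `D` above `2`. If there are none, then `a` and `b` are
  -- the only occupied indices up to `2`, and the first two moves already lead to `D`.
  obtain ⟨u, hu⟩ : ∃ u, (D.filter fun k => 2 < k.1).card = u := ⟨_, rfl⟩
  have hlow : ∀ c : Idx, c.1 < -(n : ℤ) → c ∉ s := fun c hc h => by
    have := (hs.2 c h).1
    omega
  have haQ : a ∈ lowOcc D := mem_lowOcc.2 ⟨by omega, by simp only [Occ, haD, true_iff]; omega⟩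
  have hbQ : b ∈ lowOcc D := mem_lowOcc.2 ⟨by omega, by simp only [Occ, hbD, true_iff]; omega⟩
  induction u generalizing D with
  | zero =>
    refine ⟨[], ?_, by simp⟩
    have hkQ : k ∈ lowOcc s := by simp [hQ]
    have hlQ : l ∈ lowOcc s := by simp [hQ]
    have hka : ∀ c : Idx, c.1 < -(n : ℤ) → ∀ x ∈ lowOcc s, x ≠ c := by
      rintro c hc x hx rfl
      have h1 := (mem_lowOcc.1 hx).2
      simp only [Occ, hlow x hc, false_iff] at h1
      omega
    have hnocc : ∀ c : Idx, c.1 < -(n : ℤ) → ¬ Occ c s := fun c hc h => by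
      simp only [Occ, hlow c hc, false_iff] at h
      omega
    have hlk : Occ l (mv (k, a) s) ↔ Occ l s := occ_mv_of_ne hkl.symm (hka a ha l hlQ)
    have hbk : Occ b (mv (k, a) s) ↔ Occ b s := occ_mv_of_ne (hka b hb k hkQ).symm hab.symm
    have hcan1 : CanMove (k, a) s := ⟨(mem_lowOcc.1 hkQ).2, hnocc a ha⟩
    have hcan2 : CanMove (l, b) (mv (k, a) s) :=
      ⟨hlk.2 (mem_lowOcc.1 hlQ).2, fun h => hnocc b hb (hbk.1 h)⟩
    refine ⟨hcan1, hcan2, ?_⟩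
    have hDQ : lowOcc D = {a, b} := by
      refine (Finset.eq_of_subset_of_card_le ?_ ?_).symm
      · intro x hx
        rcases Finset.mem_insert.1 hx with rfl | hx
        · exact haQ
        · rw [Finset.mem_singleton.1 hx]; exact hbQ
      · rw [card_lowOcc hD, hu, Finset.card_pair hab]
    refine eq_of_lowOcc_eq ?_ ?_
    · rw [hDQ]
      ext x
      have hxs : x ∈ lowOcc s ↔ x = k ∨ x = l := by rw [hQ]; simp
      rw [mem_lowOcc] at hxs ⊢
      simp only [Finset.mem_insert, Finset.mem_singleton]
      by_cases hxb : x = b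
      · subst hxb
        refine iff_of_true ⟨by omega, ?_⟩ (Or.inr rfl)
        exact (occ_mv_snd (m := (l, x))).2 hcan2.2
      by_cases hxl : x = l
      · subst hxl
        refine iff_of_false (fun h => (occ_mv_fst (m := (x, b))).1 h.2 hcan2.1) ?_
        rintro (h | h)
        · exact hka a ha x hlQ h
        · exact hxb h
      rw [occ_mv_of_ne (m := (l, b)) hxl hxb]
      by_cases hxa : x = a
      · subst hxa
        exact iff_of_true ⟨by omega, (occ_mv_snd (m := (k, x))).2 hcan1.2⟩ (Or.inl rfl)
      by_cases hxk : x = k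
      · subst hxk
        exact iff_of_false (fun h => (occ_mv_fst (m := (x, a))).1 h.2 hcan1.1) (by tauto)
      rw [occ_mv_of_ne (m := (k, a)) hxk hxa]
      tauto
    · intro x hx
      have hxD : x ∉ D := fun h => by
        have hmem : x ∈ D.filter fun k => 2 < k.1 := Finset.mem_filter.2 ⟨h, hx⟩
        have := Finset.card_pos.2 ⟨x, hmem⟩
        omega
      refine iff_of_false ?_ hxD
      have hxs : x ∉ s := fun h => by have := (hs.2 x h).2; omega
      have hne : ∀ y : Idx, y.1 ≤ 2 → x ≠ y := by rintro y hy rfl; omega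
      have hk2 := (mem_lowOcc.1 hkQ).1
      have hl2 := (mem_lowOcc.1 hlQ).1
      have := hne a (by omega)
      have := hne b (by omega)
      have := hne k hk2
      have := hne l hl2
      simp only [mem_mv]
      tauto
  | succ u ih =>
    -- A vacancy `c` above `2` comes with an occupied index `g` up to `2` other than `a` and `b`.
    -- Moving `g` back to `c` reduces to fewer vacancies, and the move `(c, g)` is appended at the
    -- end.
    obtain ⟨c, hc⟩ := Finset.card_pos.1 (by omega : 0 < (D.filter fun k => 2 < k.1).card)
    rw [Finset.mem_filter] at hc
    obtain ⟨g, hgQ, hgab⟩ : ∃ g ∈ lowOcc D, g ∉ ({a, b} : Finset Idx) := by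
      by_contra hcon
      push Not at hcon
      have h1 := Finset.card_le_card (show lowOcc D ⊆ {a, b} from hcon)
      rw [card_lowOcc hD, hu, Finset.card_pair hab] at h1
      omega
    simp only [Finset.mem_insert, Finset.mem_singleton, not_or] at hgab
    have hg := mem_lowOcc.1 hgQ
    have hcocc : ¬ Occ c D := fun h => by
      simp only [Occ, hc.1, true_iff] at h
      omega
    have hcomm : mv (c, g) D = mv (g, c) D := by
      rw [mv, mv, Finset.pair_comm]
    have hcan : CanMove (c, g) (mv (c, g) D) :=
      ⟨(occ_mv_fst (m := (c, g))).2 hcocc, fun h => (occ_mv_snd (m := (c, g))).1 h hg.2⟩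
    have hgc : g ≠ c := by rintro rfl; omega
    have hmem : ∀ x : Idx, x.1 < 0 → x ≠ g → x ∈ D → x ∈ mv (c, g) D := fun x hx hxg hxD =>
      mem_mv.2 (Or.inl ⟨hxD, by rintro rfl; have := hc.2; omega, hxg⟩)
    have hcard : ((mv (c, g) D).filter fun k => 2 < k.1).card = u := by
      have : (mv (c, g) D).filter (fun k => 2 < k.1) = (D.filter fun k => 2 < k.1).erase c := by
        ext x
        simp only [Finset.mem_filter, mem_mv, Finset.mem_erase]
        by_cases hxc : x = c
        · subst hxc; tauto
        · by_cases hxg : x = g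
          · subst hxg
            exact iff_of_false (fun h => by omega) (fun h => by omega)
          · tauto
      rw [this, Finset.card_erase_of_mem (Finset.mem_filter.2 hc), hu]
      rfl
    have ha' := hmem a (by omega) (Ne.symm hgab.1) haD
    have hb' := hmem b (by omega) (Ne.symm hgab.2) hbD
    obtain ⟨ps, hps, hpsm⟩ := ih (D := mv (c, g) D)
      (by rw [hcomm, chg_mv ⟨hg.2, hcocc⟩, hD]) ha' hb' hcard
      (mem_lowOcc.2 ⟨by omega, by simp only [Occ, ha', true_iff]; omega⟩)
      (mem_lowOcc.2 ⟨by omega, by simp only [Occ, hb', true_iff]; omega⟩)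
    refine ⟨ps ++ [(c, g)], ?_, ?_⟩
    · have := hps.append_singleton hcan
      rwa [mv_mv] at this
    · intro m hm
      rcases List.mem_append.1 hm with hm | hm
      · exact hpsm m hm
      · rw [List.mem_singleton.1 hm]
        exact ⟨hc.2, hg.1⟩

/-- The indices outside `[-n, 2]`. -/
def Far (n : ℕ) (k : Idx) : Prop := k.1 < -(n : ℤ) ∨ 2 < k.1

instance (n : ℕ) : DecidablePred (Far n) := fun _ => inferInstanceAs (Decidable (_ ∨ _))

/-- An index that is vacated and far lies above `2`; being occupied, it is not in `D`. An index that
is filled and far lies below `-n`; being vacant, it is not in `D`. So moves only add far indices. -/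
theorem isGraded_plane {n : ℕ} {ps : List (Idx × Idx)}
    (h : ∀ m ∈ ps, -(n : ℤ) ≤ m.1.1 ∧ m.2.1 ≤ 2 ∧ (Far n m.1 ∨ Far n m.2)) :
    IsGraded ps balanced (fun D => (D.filter (Far n)).card)
      (fun m => (({m.1, m.2} : Finset Idx).filter (Far n)).card) := by
  refine ⟨fun m _ D hD hm => (chg_mv hm).trans hD, ?_, ?_⟩
  · intro m hm D _ hcan
    obtain ⟨h1, h2, _⟩ := h m hm
    have hd : Disjoint (D.filter (Far n)) (({m.1, m.2} : Finset Idx).filter (Far n)) := by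
      refine Finset.disjoint_left.2 fun x hx hx' => ?_
      rw [Finset.mem_filter] at hx hx'
      obtain ⟨hxD, hxf⟩ := hx
      rcases Finset.mem_insert.1 hx'.1 with rfl | hx'
      · have := hcan.1
        simp only [Occ, hxD, true_iff] at this
        rcases hxf with hf | hf <;> omega
      · rw [Finset.mem_singleton.1 hx'] at hxD hxf
        have := hcan.2
        simp only [Occ, hxD, true_iff] at this
        rcases hxf with hf | hf <;> omega
    have : (mv m D).filter (Far n) =
        D.filter (Far n) ∪ ({m.1, m.2} : Finset Idx).filter (Far n) := by
      ext x
      have : x ∈ D.filter (Far n) → x ∉ ({m.1, m.2} : Finset Idx).filter (Far n) :=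
        fun h => Finset.disjoint_left.1 hd h
      simp only [Finset.mem_filter, Finset.mem_union, Finset.mem_insert, Finset.mem_singleton,
        mem_mv] at this ⊢
      tauto
    rw [this, Finset.card_union_of_disjoint hd]
  · intro m hm
    obtain ⟨_, _, hf | hf⟩ := h m hm
    · exact Finset.card_pos.2 ⟨m.1, Finset.mem_filter.2 ⟨by simp, hf⟩⟩
    · exact Finset.card_pos.2 ⟨m.2, Finset.mem_filter.2 ⟨by simp, hf⟩⟩

end BoundedRank

end PluckerLimit

namespace PluckerLimit

/-! ### Noetherianity of the zero set of the conjugates of one plane equation. -/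

section BoundedRank

open MvPolynomial Set

variable {K : Type*} [Field K] {ε : Idx × Idx → Finset Idx → K}

/-- Every coordinate with two or more indices below `-n` is eliminated, so only thin coordinates, of
bounded arity, remain. For these the outer group suffices, and it fixes the Hasse derivative because
the indices of the latter lie in `[-n, 2]`, hence in `[-n, n]` by `hn`. -/
theorem noeth_van_hasse_ne_zero [Infinite K] (hε : ∀ m D, ε m D ≠ 0) {n : ℕ} (hn : 2 ≤ n)
    {f : MvPolynomial (Finset Idx) K} (hf : f ∈ supported K (planeSet n)) {s : Finset Idx}
    (hsf : s ∈ f.vars) {q : ℕ} (hq : 1 ≤ q) (hlow : ∀ d, 0 < d → d < q → hasse s d f = 0)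
    (hne : hasse s q f ≠ 0) :
    Noeth (fullGroup ε) (polyFun K balanced : Set ((Finset Idx → K) → K))
      {z | z ∈ van (fullGroup ε) (fun z => eval z f) ∧ eval z (hasse s q f) ≠ 0} := by
  have hfv : ↑f.vars ⊆ planeSet n := mem_supported.1 hf
  have hplane : planeSet n ⊆ balanced := fun D hD => hD.1
  have hs := hfv hsf
  obtain ⟨z₀, hz₀⟩ : ∃ z, eval z (hasse s q f) ≠ 0 := by
    by_contra hcon
    push Not at hcon
    exact hne (MvPolynomial.funext fun z => by rw [hcon, map_zero])
  have hadd := add_pow_of_hasse_vanish (Y := univ) (fun _ _ _ => mem_univ _) hq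
    (fun d hd hdq z _ => by rw [hlow d hd hdq, map_zero]) (mem_univ z₀) hz₀
  have hsupp : hasse s q f ∈ supported K (planeSet n) := hasse_mem_supported hf s q
  have hh : (fun z => eval z (hasse s q f)) ∈ polyFun K (thinSet n) :=
    polyFun_mono (planeSet_subset_thinSet n) (mem_polyFun.2 ⟨_, hsupp, fun _ => rfl⟩)
  set Z : Set (Finset Idx → K) :=
    {z | z ∈ van (fullGroup ε) (fun z => eval z f) ∧ eval z (hasse s q f) ≠ 0}
  obtain ⟨k, l, hkl, hQ⟩ : ∃ k l, k ≠ l ∧ lowOcc s = {k, l} := by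
    refine Finset.card_eq_two.1 ?_
    rw [card_lowOcc hs.1, Finset.filter_eq_empty_iff.2 (fun k hk => not_lt.2 (hs.2 k hk).2),
      Finset.card_empty]
  have hlowbound : ∀ x ∈ lowOcc s, -(n : ℤ) ≤ x.1 := by
    intro x hx
    have hx := (mem_lowOcc.1 hx).2
    by_cases hxs : x ∈ s
    · exact (hs.2 x hxs).1
    · simp only [Occ, hxs, false_iff] at hx
      omega
  have hfar : ∀ r ∈ planeSet n, r.filter (Far n) = ∅ := by
    intro r hr
    rw [Finset.filter_eq_empty_iff]
    intro x hx hf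
    have := hr.2 x hx
    rcases hf with hf | hf <;> omega
  -- Induction on the number of far indices. The relation for `D` has its right-hand side in the
  -- root closure itself, so roots get iterated.
  have hcrd : ∀ N, ∀ D, chg D = 0 → (D.filter (Far n)).card < N →
      crd K D ∈ rootClosure (polyFun K (thinSet n)) Z _ hh q hadd := by
    intro N
    induction N with
    | zero => intro D _ h; omega
    | succ N ih =>
      intro D hD hv
      rcases le_or_gt (D.filter fun k => k.1 < -(n : ℤ)).card 1 with hr | hr
      · exact le_rootClosure (coord_mem_polyFun ⟨hD, hr⟩)
      obtain ⟨a, b, ha, hb, hab⟩ := Finset.one_lt_card_iff.1 hr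
      rw [Finset.mem_filter] at ha hb
      obtain ⟨ps, hps, hpsm⟩ := exists_plane_path hs hkl hQ hab ha.2 hb.2 hD ha.1 hb.1
      have hgr := isGraded_plane (n := n) (ps := (k, a) :: (l, b) :: ps) (by
        intro m hm
        rcases List.mem_cons.1 hm with rfl | hm
        · exact ⟨hlowbound k (by simp [hQ]), by dsimp only; omega, Or.inr (Or.inl ha.2)⟩
        rcases List.mem_cons.1 hm with rfl | hm
        · exact ⟨hlowbound l (by simp [hQ]), by dsimp only; omega, Or.inr (Or.inl hb.2)⟩
        · have := hpsm m hm
          exact ⟨by omega, this.2, Or.inl (Or.inr this.1)⟩)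
      have hvD := (hgr.target (hplane hs) hps).2
      have hlowA : ∀ r ∈ f.vars, ∀ D'' ∈ balanced, (D''.filter (Far n)).card <
          (r.filter (Far n)).card + (((k, a) :: (l, b) :: ps).map
            fun m => (({m.1, m.2} : Finset Idx).filter (Far n)).card).sum →
          crd K D'' ∈ rootClosure (polyFun K (thinSet n)) Z _ hh q hadd := by
        intro r hr D'' hD'' hlt
        rw [hfar s hs] at hvD
        rw [hfar r (hfv hr), ← hvD] at hlt
        exact ih D'' hD'' (by omega)
      obtain ⟨p, hp, hpz⟩ := exists_relation (Z := Z) (ε := ε) (f := f) (s := s) (D' := D) hq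
        (List.cons_ne_nil _ _) (pathPoly_decomp hε hgr (hplane hs) (hlowA s hsf) hps) (by
        -- No other variable of `f` is the start of a path: the first two moves need `k` and `l`
        -- occupied, and on `planeSet n` the two occupied indices up to `2` determine the monomial.
        intro r hr hrs
        refine pathPoly_mem_of_not_isPath hgr (hplane (hfv hr)) (hlowA r hr) fun D' hD' => ?_
        exfalso
        refine hrs ?_
        have hrp := hfv hr
        have hk2 := mem_lowOcc.1 (show k ∈ lowOcc s by simp [hQ])
        have hl2 := mem_lowOcc.1 (show l ∈ lowOcc s by simp [hQ])
        have hl3 := hlowbound l (by simp [hQ])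
        have hkr : k ∈ lowOcc r := mem_lowOcc.2 ⟨hk2.1, hD'.1.1⟩
        have hlr : l ∈ lowOcc r := mem_lowOcc.2 ⟨hl2.1,
          (occ_mv_of_ne (m := (k, a)) hkl.symm (by rintro rfl; omega)).1 hD'.2.1.1⟩
        have hr0 : (r.filter fun k => 2 < k.1) = ∅ :=
          Finset.filter_eq_empty_iff.2 fun x hx => not_lt.2 (hrp.2 x hx).2
        have hrQ : lowOcc r = {k, l} := by
          refine (Finset.eq_of_subset_of_card_le ?_ ?_).symm
          · intro x hx
            rcases Finset.mem_insert.1 hx with rfl | hx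
            · exact hkr
            · rw [Finset.mem_singleton.1 hx]; exact hlr
          · rw [card_lowOcc hrp.1, hr0, Finset.card_pair hkl, Finset.card_empty]
        refine eq_of_lowOcc_eq (hrQ.trans hQ.symm) fun x hx => iff_of_false (fun h => ?_)
          (fun h => ?_)
        · have := (hrp.2 x h).2; omega
        · have := (hs.2 x h).2; omega) (by
        intro z hz t
        exact hz.1 _ (pathPerm_mem t fun m _ => tv_mem_fullGroup m t)) (by
        intro d hd hdq z _ t w _
        rw [hlow d hd hdq, map_zero])
      exact mem_rootClosure_of_mul_pow hp hpz
  have hle : polyFun K balanced ≤ rootClosure (polyFun K (thinSet n)) Z _ hh q hadd :=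
    polyFun_le fun D hD => hcrd _ D hD (Nat.lt_succ_self _)
  refine (noeth_of_bounded_arity hε _ n (thinSet n) (saturated_thinSet n) fun D hD =>
    (Finset.card_le_card (Finset.filter_subset _ _)).trans
      (card_le_of_mem_thinSet hD)).transfer id (fun _ _ => mem_univ _) ?_ ?_
  · intro g hg
    have hg' := outerGroup_le_fullGroup n hg
    refine ⟨g, hg', fun z hz => ⟨⟨van_stable hg' hz.1, ?_⟩, rfl⟩⟩
    rw [eval_outerGroup (n := n) _ hg]
    · exact hz.2
    · intro D hD x hx
      have := (mem_supported.1 hsupp hD).2 x hx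
      omega
  · intro F hF
    exact exists_zero_iff_of_mem_rootClosure (fun z hz => hz.2) (by omega) (hle hF)

/-- The points satisfying all conjugates of a nontrivial equation in the coordinates on a plane
form a Noetherian space up to the group generated by all transvections. -/
theorem noeth_van [Infinite K] (hε : ∀ m D, ε m D ≠ 0) {n : ℕ} (hn : 2 ≤ n)
    {f : MvPolynomial (Finset Idx) K} (hf : f ∈ supported K (planeSet n)) (hf0 : f ≠ 0) :
    Noeth (fullGroup ε) (polyFun K balanced : Set ((Finset Idx → K) → K))
      (van (fullGroup ε) (fun z => eval z f)) := by
  obtain ⟨d, hd⟩ : ∃ d, f.totalDegree < d := ⟨_, Nat.lt_succ_self _⟩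
  induction d generalizing f with
  | zero => omega
  | succ d ih =>
    by_cases hcase : ∃ s, ∃ q, 1 ≤ q ∧ hasse s q f ≠ 0
    · obtain ⟨s, hex⟩ := hcase
      classical
      obtain ⟨hq, hne⟩ := Nat.find_spec hex
      set q := Nat.find hex
      have hlow : ∀ d, 0 < d → d < q → hasse s d f = 0 := by
        intro d hd hdq
        by_contra hcon
        exact Nat.find_min hex hdq ⟨hd, hcon⟩
      have hsf : s ∈ f.vars := by
        by_contra h
        exact hne (hasse_eq_zero_of_notMem h hq)
      have h1 := ih (hasse_mem_supported hf s q) hne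
        (by have := totalDegree_hasse_lt hq hne; omega)
      have h2 := noeth_van_hasse_ne_zero hε hn hf hsf hq hlow hne
      have h3 : Noeth (fullGroup ε) (polyFun K balanced : Set ((Finset Idx → K) → K))
          {z | ∃ g ∈ fullGroup ε, g z ∈ {z | z ∈ van (fullGroup ε)
            (fun z => eval z f) ∧ eval z (hasse s q f) ≠ 0}} :=
        h2.of_orbit (fun g hg F hF => polyFun_comp_fullGroup
          (fun m D hD hm => (chg_mv hm).trans hD) hg F hF) fun z hz => hz
      refine (h1.union h3).mono (subset_refl _) fun z hz => ?_
      by_cases hzh : z ∈ van (fullGroup ε) (fun z => eval z (hasse s q f))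
      · exact Or.inl hzh
      · simp only [van, mem_ofPred_eq, not_forall] at hzh
        obtain ⟨g, hg, hgz⟩ := hzh
        exact Or.inr ⟨g, hg, van_stable hg hz, hgz⟩
    · push Not at hcase
      -- With all Hasse derivatives zero, `f` is a nonzero constant and its vanishing set is empty.
      have hconst : ∀ z w : Finset Idx → K, eval w f = eval z f := fun z w =>
        eval_eq_of_hasse_vanish (R := univ) (Y := univ) (fun _ _ _ _ => mem_univ _)
          (fun s _ d hd z _ => by rw [hcase s d hd, map_zero]) (mem_univ z)
          (fun r hr => (hr (mem_univ r)).elim)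
      have hempty : van (fullGroup ε) (fun z => eval z f) = ∅ := by
        rw [Set.eq_empty_iff_forall_notMem]
        intro z hz
        refine hf0 (MvPolynomial.funext fun w => ?_)
        rw [hconst z w, map_zero]
        exact hz 1 (one_mem _)
      rw [hempty]
      exact Noeth.empty _ _

end BoundedRank

end PluckerLimit

noncomputable section

namespace PluckerLimit

/-! ### Semi-infinite monomials in the infinite wedge. -/

section Monomials

universe u

variable (K : Type u) [Field K]

/-- The product of the basis vectors indexed by a list in the exterior algebra of `V_∞`. -/
def wprod (L : List Idx) : ExteriorAlgebra K (VInf K) :=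
  (L.map fun i => ExteriorAlgebra.ι K (x K i)).prod

theorem wprod_cons (i : Idx) (L : List Idx) :
    wprod K (i :: L) = ExteriorAlgebra.ι K (x K i) * wprod K L := by
  simp [wprod]

theorem wprod_append (L L' : List Idx) : wprod K (L ++ L') = wprod K L * wprod K L' := by
  simp [wprod]

/-- The sign is absorbed into an unspecified nonzero scalar. Signs need not be tracked, as the
Noetherianity results ask only for nonzero structure constants. -/
theorem wprod_perm {L L' : List Idx} (h : L.Perm L') :
    ∃ c : K, c ≠ 0 ∧ wprod K L = c • wprod K L' := by
  induction h with
  | nil => exact ⟨1, one_ne_zero, (one_smul _ _).symm⟩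
  | cons i _ ih =>
    obtain ⟨c, hc, h⟩ := ih
    exact ⟨c, hc, by rw [wprod_cons, wprod_cons, h, mul_smul_comm]⟩
  | swap i j L =>
    refine ⟨-1, neg_ne_zero.2 one_ne_zero, ?_⟩
    have h := ExteriorAlgebra.ι_add_mul_swap (R := K) (x K i) (x K j)
    rw [wprod_cons, wprod_cons, wprod_cons, wprod_cons, ← mul_assoc, ← mul_assoc,
      eq_neg_of_add_eq_zero_right h, neg_mul, neg_one_smul]
  | trans _ _ ih1 ih2 =>
    obtain ⟨c, hc, h⟩ := ih1
    obtain ⟨d, hd, h'⟩ := ih2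
    exact ⟨c * d, mul_ne_zero hc hd, by rw [h, h', mul_smul]⟩

theorem wprod_eq_zero {L : List Idx} (h : ¬ L.Nodup) : wprod K L = 0 := by
  obtain ⟨i, hi⟩ : ∃ i, List.Duplicate i L := by
    simpa [List.nodup_iff_forall_not_duplicate] using h
  obtain ⟨L', hL'⟩ : ∃ L', L.Perm (i :: i :: L') := by
    obtain ⟨L', hL'⟩ := (List.duplicate_iff_sublist.1 hi).exists_perm_append
    exact ⟨L', hL'⟩
  obtain ⟨c, -, h⟩ := wprod_perm K hL'
  rw [h, wprod_cons, wprod_cons, ← mul_assoc, ExteriorAlgebra.ι_sq_zero, zero_mul, smul_zero]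

/-- The element `z` of the infinite wedge is represented at level `a` by the product of the
basis vectors indexed by `L`. -/
def Rep (a : ℕ × ℕ) (L : List Idx) (z : InfWedge K) : Prop :=
  ∃ ω, toInfWedge K a ω = z ∧ ExteriorAlgebra.map (Vnp K a.1 a.2).subtype ω.1 = wprod K L

variable {K}

/-- The comparison takes place in the exterior algebra of `V_∞`, into which that of each `V_{n,p}`
embeds. -/
theorem Rep.smul_eq {a : ℕ × ℕ} {L L' : List Idx} {z z' : InfWedge K} (h : Rep K a L z)
    (h' : Rep K a L' z') {c : K} (hc : wprod K L = c • wprod K L') : z = c • z' := by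
  obtain ⟨ω, rfl, hω⟩ := h
  obtain ⟨ω', rfl, hω'⟩ := h'
  rw [← map_smul]
  congr 1
  apply Subtype.ext
  apply map_subtype_injective
  change _ = ExteriorAlgebra.map _ (c • ω'.1)
  rw [hω, hc, map_smul, hω']

theorem Rep.perm {a : ℕ × ℕ} {L L' : List Idx} {z z' : InfWedge K} (h : Rep K a L z)
    (h' : Rep K a L' z') (hL : L.Perm L') : ∃ c : K, c ≠ 0 ∧ z = c • z' := by
  obtain ⟨c, hc, h1⟩ := wprod_perm K hL
  exact ⟨c, hc, h.smul_eq h' h1⟩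

theorem Rep.eq_zero {a : ℕ × ℕ} {L : List Idx} {z : InfWedge K} (h : Rep K a L z)
    (hL : ¬ L.Nodup) : z = 0 := by
  have h0 := h.smul_eq h (c := 0) (by rw [wprod_eq_zero K hL, zero_smul])
  rwa [zero_smul] at h0

theorem Rep.mono {a b : ℕ × ℕ} (hab : a ≤ b) {L : List Idx} {z : InfWedge K} (h : Rep K a L z) :
    Rep K b (L ++ (List.range' a.2 (b.2 - a.2)).map posIdx) z := by
  obtain ⟨ω, rfl, hω⟩ := h
  refine ⟨trans K a b hab ω, toInfWedge_trans _ _ _ _, ?_⟩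
  rw [map_subtype_trans, hω, wprod_append]
  congr 1
  rw [tail, wprod, List.map_map]
  rfl

theorem Rep.exists {a : ℕ × ℕ} {L : List Idx} (hlen : L.length = a.2)
    (hL : ∀ k ∈ L, -(a.1 : ℤ) ≤ k.1 ∧ k.1 ≤ a.2) : ∃ z, Rep K a L z := by
  refine ⟨_, exteriorPower.ιMulti K a.2 (fun j : Fin a.2 => (⟨x K (L.get (j.cast hlen.symm)),
    x_mem_Vnp (hL _ (List.get_mem _ _)).1 (hL _ (List.get_mem _ _)).2⟩ : Vnp K a.1 a.2)),
    rfl, ?_⟩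
  rw [exteriorPower.ιMulti_apply_coe, ExteriorAlgebra.map_apply_ιMulti,
    ExteriorAlgebra.ιMulti_apply, wprod]
  congr 1
  apply List.ext_getElem
  · simp [hlen]
  · intro i h1 h2
    simp

/-- The occupied indices which are at most `p`. -/
def occLE (p : ℕ) (D : Finset Idx) : Finset Idx :=
  (D.filter fun k => k.1 < 0) ∪ ((Finset.range p).image posIdx \ D)

theorem mem_image_posIdx {p : ℕ} {k : Idx} :
    k ∈ (Finset.range p).image posIdx ↔ 0 < k.1 ∧ k.1 ≤ p := by
  simp only [Finset.mem_image, Finset.mem_range]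
  constructor
  · rintro ⟨j, hj, rfl⟩
    simp only [posIdx]
    omega
  · rintro ⟨h1, h2⟩
    refine ⟨k.1.toNat - 1, by omega, Subtype.ext ?_⟩
    simp only [posIdx]
    omega

theorem mem_occLE {p : ℕ} {D : Finset Idx} {k : Idx} : k ∈ occLE p D ↔ k.1 ≤ p ∧ Occ k D := by
  have h0 := k.2
  simp only [occLE, Finset.mem_union, Finset.mem_filter, Finset.mem_sdiff, mem_image_posIdx, Occ]
  by_cases hk : k ∈ D
  · simp only [hk, true_and, not_true_eq_false, and_false, or_false, true_iff]
    omega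
  · simp only [hk, false_and, not_false_eq_true, and_true, false_or, false_iff]
    omega

/-- Starting from `1, …, p`, the positive indices in `D` are removed and the negative ones added.
Charge zero is thus what puts the product of the occupied basis vectors into degree `p`. -/
theorem card_occLE {p : ℕ} {D : Finset Idx} (hD : ∀ k ∈ D, k.1 ≤ p) :
    ((occLE p D).card : ℤ) = p - chg D := by
  have hd : Disjoint (D.filter fun k => k.1 < 0) ((Finset.range p).image posIdx \ D) :=
    Finset.disjoint_left.2 fun k h1 h2 => (Finset.mem_sdiff.1 h2).2 (Finset.mem_filter.1 h1).1
  have hinj : Function.Injective posIdx := fun i j h => by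
    have := congr(($h).1)
    simp only [posIdx] at this
    omega
  have hcard : ((Finset.range p).image posIdx).card = p := by
    rw [Finset.card_image_of_injective _ hinj, Finset.card_range]
  have hsd := Finset.card_sdiff_add_card_inter ((Finset.range p).image posIdx) D
  have hpos : (Finset.range p).image posIdx ∩ D = D.filter fun k => ¬ k.1 < 0 := by
    ext k
    rw [Finset.mem_inter, mem_image_posIdx, Finset.mem_filter]
    have h0 := k.2
    constructor
    · rintro ⟨h1, h2⟩
      exact ⟨h2, by omega⟩
    · rintro ⟨h1, h2⟩
      have := hD k h1
      exact ⟨by omega, h1⟩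
  rw [hpos, hcard] at hsd
  rw [occLE, Finset.card_union_of_disjoint hd, chg_eq]
  push_cast
  omega

/-- The list `L` enumerates the indices up to `a.2` occupied in the monomial `D`, which differs
from the highest one only in `[-a.1, a.2]`. -/
structure Enum (a : ℕ × ℕ) (L : List Idx) (D : Finset Idx) : Prop where
  nodup : L.Nodup
  mem_iff : ∀ k, k ∈ L ↔ k.1 ≤ a.2 ∧ Occ k D
  supp : ∀ k ∈ D, -(a.1 : ℤ) ≤ k.1 ∧ k.1 ≤ a.2

theorem Enum.perm {a : ℕ × ℕ} {L L' : List Idx} {D : Finset Idx} (h : Enum a L D)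
    (h' : Enum a L' D) : L.Perm L' :=
  (List.perm_ext_iff_of_nodup h.nodup h'.nodup).2 fun k => by rw [h.mem_iff, h'.mem_iff]

theorem Enum.mono {a b : ℕ × ℕ} (hab : a ≤ b) {L : List Idx} {D : Finset Idx}
    (h : Enum a L D) : Enum b (L ++ (List.range' a.2 (b.2 - a.2)).map posIdx) D := by
  have h1 := hab.1
  have h2 := hab.2
  have hmem : ∀ k : Idx, k ∈ (List.range' a.2 (b.2 - a.2)).map posIdx ↔
      (a.2 : ℤ) < k.1 ∧ k.1 ≤ b.2 := by
    intro k
    rw [List.mem_map]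
    constructor
    · rintro ⟨j, hj, rfl⟩
      rw [List.mem_range'_1] at hj
      simp only [posIdx]
      omega
    · rintro ⟨h3, h4⟩
      refine ⟨k.1.toNat - 1, List.mem_range'_1.2 (by omega), Subtype.ext ?_⟩
      simp only [posIdx]
      omega
  refine ⟨?_, fun k => ?_, fun k hk => ?_⟩
  · refine List.Nodup.append h.nodup ?_ ?_
    · refine List.Nodup.map (fun i j h => ?_) (List.nodup_range' (step := 1))
      have := congr(($h).1)
      simp only [posIdx] at this
      omega
    · intro k hk hk'
      have := ((h.mem_iff k).1 hk).1
      have := ((hmem k).1 hk').1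
      omega
  · rw [List.mem_append, h.mem_iff, hmem]
    constructor
    · rintro (⟨h3, h4⟩ | ⟨h3, h4⟩)
      · exact ⟨by omega, h4⟩
      · refine ⟨h4, ?_⟩
        have : k ∉ D := fun hk => by have := (h.supp k hk).2; omega
        simp only [Occ, this, false_iff]
        omega
    · rintro ⟨h3, h4⟩
      rcases le_or_gt k.1 a.2 with h5 | h5
      · exact Or.inl ⟨h5, h4⟩
      · exact Or.inr ⟨h5, h3⟩
  · have := h.supp k hk
    omega

theorem enum_occLE {a : ℕ × ℕ} {D : Finset Idx}
    (hD : ∀ k ∈ D, -(a.1 : ℤ) ≤ k.1 ∧ k.1 ≤ a.2) : Enum a (occLE a.2 D).toList D :=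
  ⟨Finset.nodup_toList _, fun k => by rw [Finset.mem_toList, mem_occLE], hD⟩

theorem Enum.length_eq {a : ℕ × ℕ} {L : List Idx} {D : Finset Idx} (h : Enum a L D) :
    (L.length : ℤ) = a.2 - chg D := by
  rw [(h.perm (enum_occLE h.supp)).length_eq, Finset.length_toList,
    card_occLE fun k hk => (h.supp k hk).2]

theorem Enum.exists_rep {a : ℕ × ℕ} {L : List Idx} {D : Finset Idx} (h : Enum a L D)
    (hD : chg D = 0) : ∃ z, Rep K a L z := by
  have h1 := h.length_eq
  refine Rep.exists (by omega) fun k hk => ?_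
  have h2 := (h.mem_iff k).1 hk
  refine ⟨?_, h2.1⟩
  by_cases hk' : k ∈ D
  · exact (h.supp k hk').1
  · have := h2.2
    simp only [Occ, hk', false_iff] at this
    omega

theorem exists_level (D : Finset Idx) :
    ∃ M : ℕ, ∀ k ∈ D, -(M : ℤ) ≤ k.1 ∧ k.1 ≤ M :=
  ⟨D.sup fun k => k.1.natAbs, fun k hk => by
    have := Finset.le_sup (f := fun k : Idx => k.1.natAbs) hk
    omega⟩

variable (K) in
theorem exists_monomial (D : Finset Idx) : ∃ z : InfWedge K, (chg D ≠ 0 → z = 0) ∧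
    (chg D = 0 → ∃ a L, Enum a L D ∧ Rep K a L z) := by
  by_cases h : chg D = 0
  · obtain ⟨M, hM⟩ := exists_level D
    have he := enum_occLE (a := (M, M)) hM
    obtain ⟨z, hz⟩ := he.exists_rep (K := K) h
    exact ⟨z, fun h' => absurd h h', fun _ => ⟨_, _, he, hz⟩⟩
  · exact ⟨0, fun _ => rfl, fun h' => absurd h' h⟩

variable (K) in
/-- The semi-infinite monomial attached to `D`; it is zero if the charge is not zero. -/
def monomial (D : Finset Idx) : InfWedge K := (exists_monomial K D).choose

theorem monomial_eq_zero {D : Finset Idx} (hD : chg D ≠ 0) : monomial K D = 0 :=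
  (exists_monomial K D).choose_spec.1 hD

/-- Both representatives are moved to a common level, where their lists enumerate the same set of
occupied indices. -/
theorem Rep.eq_smul_monomial {a : ℕ × ℕ} {L : List Idx} {D : Finset Idx} (h : Enum a L D)
    {z : InfWedge K} (hz : Rep K a L z) (hD : chg D = 0) :
    ∃ c : K, c ≠ 0 ∧ z = c • monomial K D := by
  obtain ⟨b, L', hL', hz'⟩ := (exists_monomial K D).choose_spec.2 hD
  exact (hz.mono (le_sup_left : a ≤ a ⊔ b)).perm (hz'.mono le_sup_right)
    ((h.mono le_sup_left).perm (hL'.mono le_sup_right))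

/-- The span of the products of basis vectors. -/
theorem span_ιMulti_Vnp (n p q : ℕ) :
    Submodule.span K {ω : ⋀[K]^q (Vnp K n p) | ∃ L : List Idx, L.length = q ∧
      (∀ k ∈ L, -(n : ℤ) ≤ k.1 ∧ k.1 ≤ p) ∧
        ExteriorAlgebra.map (Vnp K n p).subtype ω.1 = wprod K L} = ⊤ := by
  have hs : Submodule.span K {v : Vnp K n p | ∃ k : Idx, (-(n : ℤ) ≤ k.1 ∧ k.1 ≤ p) ∧
      v.1 = x K k} = ⊤ := by
    apply Submodule.map_injective_of_injective (Vnp K n p).injective_subtype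
    rw [Submodule.map_span, Submodule.map_top, Submodule.range_subtype]
    conv_rhs => rw [Vnp]
    congr 1
    ext v
    constructor
    · rintro ⟨w, ⟨k, hk, hw⟩, rfl⟩
      exact ⟨k, hk, hw.symm⟩
    · rintro ⟨k, hk, rfl⟩
      exact ⟨⟨x K k, x_mem_Vnp hk.1 hk.2⟩, ⟨k, hk, rfl⟩, rfl⟩
  rw [eq_top_iff, ← exteriorPower.ιMulti_span_of_span K q (Vnp K n p) hs]
  refine Submodule.span_mono ?_
  rintro _ ⟨v, hv, rfl⟩
  choose k hk hk' using fun j => hv ⟨j, rfl⟩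
  refine ⟨List.ofFn k, List.length_ofFn, ?_, ?_⟩
  · intro i hi
    obtain ⟨j, rfl⟩ := List.mem_ofFn.1 hi
    exact hk j
  · rw [exteriorPower.ιMulti_apply_coe, ExteriorAlgebra.map_apply_ιMulti,
      ExteriorAlgebra.ιMulti_apply, wprod, List.map_ofFn]
    congr 2
    funext j
    simp [hk']

theorem exists_enum {a : ℕ × ℕ} {L : List Idx} (hlen : L.length = a.2)
    (hL : ∀ k ∈ L, -(a.1 : ℤ) ≤ k.1 ∧ k.1 ≤ a.2) (hn : L.Nodup) :
    ∃ D, Enum a L D ∧ chg D = 0 := by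
  let B : Finset Idx := L.toFinset.filter (fun k => k.1 < 0) ∪
    (((Finset.range a.2).image posIdx) \ L.toFinset)
  have hB : ∀ k, k ∈ B ↔ (k ∈ L ∧ k.1 < 0) ∨ ((0 < k.1 ∧ k.1 ≤ a.2) ∧ k ∉ L) := by
    intro k
    simp only [B, Finset.mem_union, Finset.mem_filter, Finset.mem_sdiff, mem_image_posIdx,
      List.mem_toFinset]
  have he : Enum a L B := by
    refine ⟨hn, fun k => ?_, fun k hk => ?_⟩
    · have h0 := k.2
      simp only [Occ, hB]
      constructor
      · intro hk
        refine ⟨(hL k hk).2, ?_⟩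
        tauto
      · rintro ⟨h1, h2⟩
        by_contra hk
        simp only [hk, false_and, not_false_eq_true, and_true, false_or] at h2
        omega
    · rcases (hB k).1 hk with h | h
      · exact hL k h.1
      · omega
  refine ⟨B, he, ?_⟩
  have := he.length_eq
  omega

theorem toInfWedge_mem_span (a : ℕ × ℕ) (ω : ⋀[K]^a.2 (Vnp K a.1 a.2)) :
    toInfWedge K a ω ∈ Submodule.span K (monomial K ''
      {D | chg D = 0 ∧ ∀ k ∈ D, -(a.1 : ℤ) ≤ k.1 ∧ k.1 ≤ a.2}) := by
  have hω : ω ∈ (⊤ : Submodule K _) := trivial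
  rw [← span_ιMulti_Vnp a.1 a.2 a.2] at hω
  induction hω using Submodule.span_induction with
  | mem ω h =>
    obtain ⟨L, hlen, hL, h⟩ := h
    have hr : Rep K a L (toInfWedge K a ω) := ⟨ω, rfl, h⟩
    by_cases hn : L.Nodup
    · obtain ⟨D, hD, hD'⟩ := exists_enum hlen hL hn
      obtain ⟨c, -, h⟩ := hr.eq_smul_monomial hD hD'
      rw [h]
      exact Submodule.smul_mem _ _ (Submodule.subset_span ⟨D, ⟨hD', hD.supp⟩, rfl⟩)
    · rw [hr.eq_zero hn]
      exact zero_mem _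
  | zero => rw [map_zero]; exact zero_mem _
  | add _ _ _ _ h1 h2 => rw [map_add]; exact add_mem h1 h2
  | smul c _ _ h => rw [map_smul]; exact Submodule.smul_mem _ _ h

variable (K) in
theorem span_monomial : Submodule.span K (monomial K '' balanced) = ⊤ := by
  rw [eq_top_iff]
  rintro z -
  obtain ⟨a, -, ω, rfl⟩ := exists_toInfWedge 0 z
  exact Submodule.span_mono (Set.image_mono fun D hD => hD.1) (toInfWedge_mem_span a ω)

end Monomials

end PluckerLimit

end

noncomputable section

namespace PluckerLimit

/-! ### Monomials at a finite level. -/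

section Level

universe u

variable {K : Type u} [Field K]

/-- The monomials which differ from the highest one only in `[-a.1, a.2]`. -/
def levelSet (a : ℕ × ℕ) : Set (Finset Idx) :=
  {D | chg D = 0 ∧ ∀ k ∈ D, -(a.1 : ℤ) ≤ k.1 ∧ k.1 ≤ a.2}

-- The representative is rescaled so that it maps exactly to `monomial K D`; polynomials at a finite
-- level can then be evaluated directly at `coords ω`.
variable (K) in
theorem exists_levelMonomial (a : ℕ × ℕ) (D : Finset Idx) :
    ∃ y : ⋀[K]^a.2 (Vnp K a.1 a.2), D ∈ levelSet a → toInfWedge K a y = monomial K D ∧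
      ∃ L, ∃ c : K, c ≠ 0 ∧ Enum a L D ∧
        wprod K L = c • ExteriorAlgebra.map (Vnp K a.1 a.2).subtype y.1 := by
  by_cases hD : D ∈ levelSet a
  · have he := enum_occLE hD.2
    obtain ⟨z, hz⟩ := he.exists_rep (K := K) hD.1
    obtain ⟨c, hc, h⟩ := hz.eq_smul_monomial he hD.1
    obtain ⟨ω, h1, h2⟩ := hz
    refine ⟨c⁻¹ • ω, fun _ => ⟨?_, _, c, hc, he, ?_⟩⟩
    · rw [map_smul, h1, h, smul_smul, inv_mul_cancel₀ hc, one_smul]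
    · change _ = c • ExteriorAlgebra.map _ (c⁻¹ • ω.1)
      rw [map_smul, h2, smul_smul, mul_inv_cancel₀ hc, one_smul]
  · exact ⟨0, fun h => absurd h hD⟩

variable (K) in
/-- The monomial attached to `D` as an element of `⋀^p V_{n,p}`. -/
def levelMonomial (a : ℕ × ℕ) (D : Finset Idx) : ⋀[K]^a.2 (Vnp K a.1 a.2) :=
  (exists_levelMonomial K a D).choose

theorem toInfWedge_levelMonomial {a : ℕ × ℕ} {D : Finset Idx} (hD : D ∈ levelSet a) :
    toInfWedge K a (levelMonomial K a D) = monomial K D :=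
  ((exists_levelMonomial K a D).choose_spec hD).1

variable (K) in
theorem span_levelMonomial (a : ℕ × ℕ) :
    Submodule.span K (levelMonomial K a '' levelSet a) = ⊤ := by
  rw [eq_top_iff, ← span_ιMulti_Vnp a.1 a.2 a.2, Submodule.span_le]
  rintro ω ⟨L, hlen, hL, h⟩
  by_cases hn : L.Nodup
  · obtain ⟨D, hD, hD'⟩ := exists_enum hlen hL hn
    obtain ⟨-, L', c, hc, hL', h'⟩ := (exists_levelMonomial K a D).choose_spec ⟨hD', hD.supp⟩
    obtain ⟨d, -, hd⟩ := wprod_perm K (hD.perm hL')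
    have key : ω = (d * c) • levelMonomial K a D := by
      apply Subtype.ext
      apply map_subtype_injective
      change _ = ExteriorAlgebra.map _ ((d * c) • (levelMonomial K a D).1)
      rw [h, hd, h', map_smul, smul_smul]
      rfl
    rw [key]
    exact Submodule.smul_mem _ _ (Submodule.subset_span ⟨D, ⟨hD', hD.supp⟩, rfl⟩)
  · have key : ω = 0 := by
      apply Subtype.ext
      apply map_subtype_injective
      rw [h, wprod_eq_zero K hn]
      exact (map_zero _).symm
    rw [key]
    exact zero_mem _

end Level

/-! ### The action of transvections on monomials. -/

section Transvections

universe u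

variable {K : Type u} [Field K]

variable (K) in
/-- The coordinate function dual to `x_k`. -/
def coordFun (k : Idx) : VInf K →ₗ[K] K := Finsupp.lapply k

theorem coordFun_x (k i : Idx) : coordFun K k (x K i) = if k = i then 1 else 0 := by
  change (Finsupp.single i (1 : K)) k = _
  rw [Finsupp.single_apply]
  exact if_congr eq_comm rfl rfl

theorem coordFun_smul_x {k i : Idx} (h : k ≠ i) (t : K) : coordFun K k (t • x K i) = 0 := by
  rw [map_smul, coordFun_x, if_neg h, smul_zero]

/-- The transvection `x_k ↦ x_k + t x_i`. -/
def transv {k i : Idx} (h : k ≠ i) (t : K) : VInf K ≃ₗ[K] VInf K :=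
  LinearEquiv.transvection (coordFun_smul_x h t)

theorem transv_apply {k i : Idx} (h : k ≠ i) (t : K) (v : VInf K) :
    transv h t v = v + coordFun K k v • t • x K i := rfl

theorem transv_x_self {k i : Idx} (h : k ≠ i) (t : K) :
    transv h t (x K k) = x K k + t • x K i := by
  rw [transv_apply, coordFun_x, if_pos rfl, one_smul]

theorem transv_x {k i j : Idx} (h : k ≠ i) (hj : j ≠ k) (t : K) :
    transv h t (x K j) = x K j := by
  rw [transv_apply, coordFun_x, if_neg hj.symm, zero_smul, add_zero]

theorem transv_neg_transv {k i : Idx} (h : k ≠ i) (t : K) (v : VInf K) :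
    transv h t (transv h (-t) v) = v := by
  have h1 : coordFun K k (transv h (-t) v) = coordFun K k v := by
    rw [transv_apply, map_add, map_smul, coordFun_smul_x h, smul_zero, add_zero]
  rw [transv_apply, h1, transv_apply, neg_smul, smul_neg, neg_add_cancel_right]

theorem transv_mem_Gnp {k i : Idx} (h : k ≠ i) (t : K) {a : ℕ × ℕ}
    (hk : -(a.1 : ℤ) ≤ k.1 ∧ k.1 ≤ a.2) (hi : -(a.1 : ℤ) ≤ i.1 ∧ i.1 ≤ a.2) :
    transv h t ∈ Gnp K a := by
  have hle : ∀ t : K, ∀ v ∈ Vnp K a.1 a.2, transv h t v ∈ Vnp K a.1 a.2 := fun t v hv => by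
    rw [transv_apply]
    exact add_mem hv (Submodule.smul_mem _ _ (Submodule.smul_mem _ _ (x_mem_Vnp hi.1 hi.2)))
  refine ⟨le_antisymm ?_ fun v hv => ⟨_, hle (-t) v hv, transv_neg_transv h t v⟩, fun j hj => ?_⟩
  · rintro _ ⟨v, hv, rfl⟩
    exact hle t v hv
  · exact transv_x h (fun hjk : j = k => hj (by rw [hjk]; exact hk)) t

/-- The transvection `x_k ↦ x_k + t x_i` as an element of `G_∞`. -/
def transvInf {k i : Idx} (h : k ≠ i) (t : K) : GInf K :=
  ⟨transv h t, by
    refine ⟨(max k.1.natAbs i.1.natAbs, max k.1.natAbs i.1.natAbs), transv_mem_Gnp h t ?_ ?_⟩ <;>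
    · dsimp only
      omega⟩

theorem Rep.act {a : ℕ × ℕ} {L : List Idx} {z : InfWedge K} (h : Rep K a L z) {g : GInf K}
    (hg : g.1 ∈ Gnp K a) : ∃ ω, toInfWedge K a ω = act g z ∧
      ExteriorAlgebra.map (Vnp K a.1 a.2).subtype ω.1 =
        ExteriorAlgebra.map g.1.toLinearMap (wprod K L) := by
  obtain ⟨ω, rfl, hω⟩ := h
  exact ⟨_, (act_toInfWedge g a hg ω).symm, by rw [map_subtype_extAct, hω]⟩

theorem map_transv_wprod {k i : Idx} (h : k ≠ i) (t : K) {L : List Idx} (hL : k ∉ L) :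
    ExteriorAlgebra.map (transv h t).toLinearMap (wprod K L) = wprod K L := by
  rw [wprod, map_list_prod, List.map_map]
  congr 1
  refine List.map_congr_left fun j hj => ?_
  have := transv_x (K := K) h (fun hjk => hL (hjk ▸ hj)) t
  simp [this]

theorem mv_mem_levelSet {a : ℕ × ℕ} {m : Idx × Idx} {D : Finset Idx} (hD : D ∈ levelSet a)
    (hm : CanMove m D) (h1 : -(a.1 : ℤ) ≤ m.1.1 ∧ m.1.1 ≤ a.2)
    (h2 : -(a.1 : ℤ) ≤ m.2.1 ∧ m.2.1 ≤ a.2) : mv m D ∈ levelSet a := by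
  refine ⟨(chg_mv hm).trans hD.1, fun k hk => ?_⟩
  rcases mem_mv.1 hk with h | ⟨-, rfl | rfl⟩
  · exact hD.2 k h.1
  · exact h1
  · exact h2

/-- If `x_k` occurs, it is brought to the front; the transvection fixes the other factors and
replaces `x_k` by `x_k + t x_i`. The extra term is zero when `i` is already occupied and otherwise a
nonzero multiple of the moved monomial. The scalar is independent of `t`. -/
theorem act_transvInf_monomial {m : Idx × Idx} (hm : m.1 ≠ m.2) (D : Finset Idx) :
    ∃ e : K, e ≠ 0 ∧ ∀ t, act (transvInf hm t) (monomial K D) =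
      monomial K D + if CanMove m D then (t * e) • monomial K (mv m D) else 0 := by
  by_cases hD : chg D = 0
  swap
  · refine ⟨1, one_ne_zero, fun t => ?_⟩
    rw [monomial_eq_zero hD, map_zero, zero_add]
    split_ifs with h
    · rw [monomial_eq_zero (by rwa [chg_mv h]), smul_zero]
    · rfl
  obtain ⟨M, hM⟩ := exists_level (insert m.1 (insert m.2 D))
  let a : ℕ × ℕ := (M, M)
  have h1 : -(a.1 : ℤ) ≤ m.1.1 ∧ m.1.1 ≤ a.2 := hM _ (Finset.mem_insert_self _ _)
  have h2 : -(a.1 : ℤ) ≤ m.2.1 ∧ m.2.1 ≤ a.2 :=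
    hM _ (Finset.mem_insert_of_mem (Finset.mem_insert_self _ _))
  have h3 : D ∈ levelSet a :=
    ⟨hD, fun k hk => hM _ (Finset.mem_insert_of_mem (Finset.mem_insert_of_mem hk))⟩
  have hg : ∀ t : K, (transvInf hm t).1 ∈ Gnp K a := fun t => transv_mem_Gnp hm t h1 h2
  have he := enum_occLE h3.2
  obtain ⟨z, hz⟩ := he.exists_rep (K := K) hD
  obtain ⟨c, hc, hzc⟩ := hz.eq_smul_monomial he hD
  have hmono : monomial K D = c⁻¹ • z := by rw [hzc, smul_smul, inv_mul_cancel₀ hc, one_smul]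
  by_cases hk : m.1 ∈ occLE a.2 D
  swap
  · refine ⟨1, one_ne_zero, fun t => ?_⟩
    have hk' : ¬ CanMove m D := fun h => hk (mem_occLE.2 ⟨h1.2, h.1⟩)
    rw [if_neg hk', add_zero, hmono, map_smul]
    obtain ⟨ω, hω, hω'⟩ := hz.act (hg t)
    congr 1
    have hr : Rep K a (occLE a.2 D).toList (act (transvInf hm t) z) :=
      ⟨ω, hω, by
        rw [hω']
        exact map_transv_wprod hm t (by rwa [Finset.mem_toList])⟩
    have := hr.smul_eq hz (c := 1) (one_smul _ _).symm
    rwa [one_smul] at this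
  · let L' := ((occLE a.2 D).erase m.1).toList
    have hperm : (occLE a.2 D).toList.Perm (m.1 :: L') := by
      have hp := Finset.toList_insert (Finset.notMem_erase m.1 (occLE a.2 D))
      rwa [Finset.insert_erase hk] at hp
    have hlen : (m.1 :: L').length = a.2 := by
      have := he.length_eq
      rw [hperm.length_eq] at this
      omega
    have hent : ∀ k ∈ L', -(a.1 : ℤ) ≤ k.1 ∧ k.1 ≤ a.2 := fun k hk => by
      have hk' := (he.mem_iff k).1 (hperm.symm.subset (List.mem_cons_of_mem _ hk))
      refine ⟨?_, hk'.1⟩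
      by_cases hkD : k ∈ D
      · exact (h3.2 k hkD).1
      · have := hk'.2
        simp only [Occ, hkD, false_iff] at this
        omega
    have hL'k : m.1 ∉ L' := by
      rw [Finset.mem_toList]
      exact Finset.notMem_erase _ _
    obtain ⟨z1, hz1⟩ : ∃ z, Rep K a (m.1 :: L') z := Rep.exists hlen (by
      intro k hk
      rcases List.mem_cons.1 hk with rfl | hk
      · exact h1
      · exact hent k hk)
    obtain ⟨z2, hz2⟩ : ∃ z, Rep K a (m.2 :: L') z := Rep.exists (by simpa using hlen) (by
      intro k hk
      rcases List.mem_cons.1 hk with rfl | hk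
      · exact h2
      · exact hent k hk)
    have hact : ∀ t, act (transvInf hm t) z1 = z1 + t • z2 := by
      intro t
      obtain ⟨ω, hω, hω'⟩ := hz1.act (hg t)
      obtain ⟨ω1, rfl, hω1⟩ := hz1
      obtain ⟨ω2, rfl, hω2⟩ := hz2
      rw [← hω, ← map_smul, ← map_add]
      congr 1
      apply Subtype.ext
      apply map_subtype_injective
      change _ = ExteriorAlgebra.map _ (ω1.1 + t • ω2.1)
      rw [hω', map_add, map_smul, hω1, hω2, wprod_cons, wprod_cons, map_mul]
      have := map_transv_wprod (K := K) hm t hL'k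
      change _ * ExteriorAlgebra.map (transv hm t).toLinearMap (wprod K L') = _
      rw [this]
      change ExteriorAlgebra.map (transv hm t).toLinearMap _ * _ = _
      rw [ExteriorAlgebra.map_apply_ι]
      change ExteriorAlgebra.ι K (transv hm t (x K m.1)) * _ = _
      rw [transv_x_self, map_add, map_smul, add_mul, smul_mul_assoc]
    obtain ⟨d, hd, hzd⟩ := hz1.perm hz hperm.symm
    have hmono1 : monomial K D = (c⁻¹ * d⁻¹) • z1 := by
      rw [hzd, smul_smul, mul_assoc, inv_mul_cancel₀ hd, mul_one, hmono]
    by_cases hi : Occ m.2 D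
    · refine ⟨1, one_ne_zero, fun t => ?_⟩
      have hz20 : z2 = 0 := hz2.eq_zero (by
        intro hn
        refine (List.nodup_cons.1 hn).1 ?_
        rw [Finset.mem_toList, Finset.mem_erase, mem_occLE]
        exact ⟨hm.symm, h2.2, hi⟩)
      rw [if_neg (fun h => h.2 hi), add_zero, hmono1, map_smul, hact, hz20, smul_zero, add_zero]
    · have hcan : CanMove m D := ⟨(mem_occLE.1 hk).2, hi⟩
      have hmv := mv_mem_levelSet h3 hcan h1 h2
      have hE : Enum a (m.2 :: L') (mv m D) := by
        refine ⟨List.nodup_cons.2 ⟨?_, Finset.nodup_toList _⟩, fun k => ?_, hmv.2⟩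
        · rw [Finset.mem_toList, Finset.mem_erase, mem_occLE]
          exact fun h => hi h.2.2
        · rw [List.mem_cons, Finset.mem_toList, Finset.mem_erase, mem_occLE]
          by_cases hk2 : k = m.2
          · subst hk2
            have := (occ_mv_snd (m := m) (D := D)).2 hi
            exact ⟨fun _ => ⟨h2.2, this⟩, fun _ => Or.inl rfl⟩
          · by_cases hk1 : k = m.1
            · subst hk1
              have := (occ_mv_fst (m := m) (D := D))
              constructor
              · rintro (h | h)
                · exact absurd h hk2
                · exact absurd rfl h.1
              · rintro ⟨-, h⟩
                exact absurd hcan.1 (this.1 h)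
            · rw [occ_mv_of_ne hk1 hk2]
              constructor
              · rintro (h | h)
                · exact absurd h hk2
                · exact h.2
              · exact fun h => Or.inr ⟨hk1, h⟩
      obtain ⟨b, hb, hzb⟩ := hz2.eq_smul_monomial hE hmv.1
      refine ⟨c⁻¹ * d⁻¹ * b, mul_ne_zero (mul_ne_zero (inv_ne_zero hc) (inv_ne_zero hd)) hb,
        fun t => ?_⟩
      rw [if_pos hcan]
      conv_lhs => rw [hmono1, map_smul, hact, smul_add, ← hmono1, hzb, smul_smul, smul_smul]
      congr 2
      ring

end Transvections

end PluckerLimit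

end

noncomputable section

namespace PluckerLimit

/-! ### Transfer of Noetherianity to the dual infinite wedge. -/

section Transfer

universe u

variable {K : Type u} [Field K]

theorem infWedgeRep_comp (g g' : GInf K) :
    infWedgeRep K g ∘ₗ infWedgeRep K g' = infWedgeRep K (g * g') :=
  (map_mul (infWedgeRep K) g g').symm

theorem infWedgeRep_one : infWedgeRep K (1 : GInf K) = LinearMap.id :=
  map_one (infWedgeRep K)

variable (K) in
/-- The group of permutations of the dual infinite wedge induced by `G_∞`. -/
def dualGroup : Subgroup (Equiv.Perm (Module.Dual K (InfWedge K))) where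
  carrier := {e | ∃ g : GInf K, ∀ ω, e ω = ω ∘ₗ infWedgeRep K g}
  one_mem' := ⟨1, fun ω => by rw [infWedgeRep_one, LinearMap.comp_id, Equiv.Perm.one_apply]⟩
  mul_mem' := by
    rintro e e' ⟨g, hg⟩ ⟨g', hg'⟩
    exact ⟨g' * g, fun ω => by
      rw [Equiv.Perm.mul_apply, hg, hg', LinearMap.comp_assoc, infWedgeRep_comp]⟩
  inv_mem' := by
    rintro e ⟨g, hg⟩
    exact ⟨g⁻¹, fun ω => by
      rw [Equiv.Perm.inv_eq_iff_eq, hg, LinearMap.comp_assoc, infWedgeRep_comp,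
        inv_mul_cancel, infWedgeRep_one, LinearMap.comp_id]⟩

/-- The permutation of the dual infinite wedge induced by an element of `G_∞`. -/
def dualPerm (g : GInf K) : Equiv.Perm (Module.Dual K (InfWedge K)) where
  toFun ω := ω ∘ₗ infWedgeRep K g
  invFun ω := ω ∘ₗ infWedgeRep K g⁻¹
  left_inv ω := by
    dsimp only
    rw [LinearMap.comp_assoc, infWedgeRep_comp, mul_inv_cancel, infWedgeRep_one,
      LinearMap.comp_id]
  right_inv ω := by
    dsimp only
    rw [LinearMap.comp_assoc, infWedgeRep_comp, inv_mul_cancel, infWedgeRep_one,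
      LinearMap.comp_id]

theorem dualPerm_apply (g : GInf K) (ω : Module.Dual K (InfWedge K)) :
    dualPerm g ω = ω ∘ₗ infWedgeRep K g := rfl

theorem mem_dualGroup {e : Equiv.Perm (Module.Dual K (InfWedge K))} :
    e ∈ dualGroup K ↔ ∃ g : GInf K, ∀ ω, e ω = ω ∘ₗ infWedgeRep K g := Iff.rfl

theorem exists_mem_dualGroup (g : GInf K) :
    ∃ e ∈ dualGroup K, ∀ ω, e ω = ω ∘ₗ infWedgeRep K g :=
  ⟨dualPerm g, mem_dualGroup.2 ⟨g, dualPerm_apply g⟩, dualPerm_apply g⟩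

theorem evalAt_ι (ω : Module.Dual K (InfWedge K)) (z : InfWedge K) :
    evalAt ω (SymmetricAlgebra.ι K _ z) = ω z := by
  rw [evalAt, SymmetricAlgebra.lift_ι_apply]

theorem evalAt_smul (ω : Module.Dual K (InfWedge K)) (g : GInf K) (f : CoordRing K) :
    evalAt ω (g • f) = evalAt (ω ∘ₗ infWedgeRep K g) f := by
  have h : (evalAt ω).comp (polyAct g) = evalAt (ω ∘ₗ infWedgeRep K g) := by
    apply SymmetricAlgebra.algHom_ext
    ext1 z
    simp [polyAct, evalAt]
  exact congr($h f)

theorem mem_zeroSet_orbit {S : Set (CoordRing K)} {ω : Module.Dual K (InfWedge K)} :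
    ω ∈ zeroSet (⋃ f ∈ S, MulAction.orbit (GInf K) f) ↔
      ∀ f ∈ S, ω ∈ van (dualGroup K) (fun ω => evalAt ω f) := by
  constructor
  · intro h f hf e he
    obtain ⟨g, hg⟩ := mem_dualGroup.1 he
    change evalAt (e ω) f = 0
    rw [hg, ← evalAt_smul]
    exact h _ (Set.mem_biUnion hf ⟨g, rfl⟩)
  · intro h f hf
    obtain ⟨f', hf', g, rfl⟩ := Set.mem_iUnion₂.1 hf
    obtain ⟨e, he, he'⟩ := exists_mem_dualGroup g
    change evalAt ω (g • f') = 0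
    rw [evalAt_smul, ← he']
    exact h f' hf' e he

/-- The coordinates of a point of the dual infinite wedge. -/
def coords (ω : Module.Dual K (InfWedge K)) (D : Finset Idx) : K := ω (monomial K D)

variable (K) in
/-- The structure constants of the action of transvections on monomials. -/
def sgnConst (m : Idx × Idx) (D : Finset Idx) : K :=
  if hm : m.1 ≠ m.2 then (act_transvInf_monomial (K := K) hm D).choose else 1

theorem sgnConst_ne_zero (m : Idx × Idx) (D : Finset Idx) : sgnConst K m D ≠ 0 := by
  by_cases hm : m.1 ≠ m.2
  · rw [sgnConst, dif_pos hm]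
    exact (act_transvInf_monomial (K := K) hm D).choose_spec.1
  · rw [sgnConst, dif_neg hm]
    exact one_ne_zero

theorem coords_transv {m : Idx × Idx} (hm : m.1 ≠ m.2) (t : K)
    (ω : Module.Dual K (InfWedge K)) :
    coords (ω ∘ₗ infWedgeRep K (transvInf hm t)) = tv (sgnConst K) m t (coords ω) := by
  funext D
  have h := (act_transvInf_monomial (K := K) hm D).choose_spec.2 t
  have h' : sgnConst K m D = (act_transvInf_monomial (K := K) hm D).choose := dif_pos hm
  rw [tv_apply]
  change ω (act (transvInf hm t) (monomial K D)) = _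
  rw [h, map_add, ← h']
  congr 1
  split_ifs
  · rw [map_smul]
    rfl
  · rw [map_zero]

/-- Generators are lifted by `coords_transv`. A pair with equal entries acts trivially, since no
index is both occupied and vacant, and is lifted to the identity. -/
theorem exists_lift {e' : Equiv.Perm (Finset Idx → K)} (he' : e' ∈ fullGroup (sgnConst K)) :
    ∃ e ∈ dualGroup K, ∀ ω, coords (e ω) = e' (coords ω) := by
  induction he' using Subgroup.closure_induction with
  | mem e' h =>
    obtain ⟨m, t, rfl⟩ := h
    by_cases hm : m.1 = m.2
    · refine ⟨1, one_mem _, fun ω => ?_⟩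
      funext D
      have h : ¬ CanMove m D := fun h => h.2 (hm ▸ h.1)
      rw [tv_apply, if_neg h, add_zero]
      rfl
    · obtain ⟨e, he, h⟩ := exists_mem_dualGroup (transvInf hm t)
      exact ⟨e, he, fun ω => by rw [h, coords_transv]⟩
  | one => exact ⟨1, one_mem _, fun ω => rfl⟩
  | mul _ _ _ _ h1 h2 =>
    obtain ⟨e1, he1, h1⟩ := h1
    obtain ⟨e2, he2, h2⟩ := h2
    exact ⟨e1 * e2, mul_mem he1 he2, fun ω => by
      rw [Equiv.Perm.mul_apply, h1, h2, Equiv.Perm.mul_apply]⟩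
  | inv _ _ h =>
    obtain ⟨e, he, h⟩ := h
    exact ⟨e⁻¹, inv_mem he, fun ω => by
      rw [Equiv.Perm.eq_inv_iff_eq, ← h]
      exact congrArg coords (e.apply_symm_apply ω)⟩

/-- On generators of the symmetric algebra this holds because the monomials of charge zero span the
infinite wedge; their linear independence plays no role. -/
theorem exists_polyFun_evalAt (f : CoordRing K) :
    ∃ f' ∈ polyFun K balanced, ∀ ω, evalAt ω f = f' (coords ω) := by
  induction f using SymmetricAlgebra.induction with
  | algebraMap r => exact ⟨_, (polyFun K balanced).algebraMap_mem r, fun ω => by simp⟩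
  | ι z =>
    have hz : z ∈ (⊤ : Submodule K (InfWedge K)) := trivial
    simp only [evalAt_ι]
    rw [← span_monomial] at hz
    induction hz using Submodule.span_induction with
    | mem z h =>
      obtain ⟨D, hD, rfl⟩ := h
      exact ⟨_, coord_mem_polyFun hD, fun ω => rfl⟩
    | zero => exact ⟨0, zero_mem _, fun ω => map_zero _⟩
    | add _ _ _ _ h1 h2 =>
      obtain ⟨f1, hf1, h1⟩ := h1
      obtain ⟨f2, hf2, h2⟩ := h2
      exact ⟨f1 + f2, add_mem hf1 hf2, fun ω => by rw [map_add, h1, h2]; rfl⟩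
    | smul c _ _ h =>
      obtain ⟨f1, hf1, h1⟩ := h
      exact ⟨c • f1, (polyFun K balanced).smul_mem hf1 c, fun ω => by rw [map_smul, h1]; rfl⟩
  | mul _ _ h1 h2 =>
    obtain ⟨f1, hf1, h1⟩ := h1
    obtain ⟨f2, hf2, h2⟩ := h2
    exact ⟨f1 * f2, mul_mem hf1 hf2, fun ω => by rw [map_mul, h1, h2]; rfl⟩
  | add _ _ h1 h2 =>
    obtain ⟨f1, hf1, h1⟩ := h1
    obtain ⟨f2, hf2, h2⟩ := h2
    exact ⟨f1 + f2, add_mem hf1 hf2, fun ω => by rw [map_add, h1, h2]; rfl⟩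

variable (K) in
/-- The polynomial functions on the dual infinite wedge. -/
def dualFun : Set (Module.Dual K (InfWedge K) → K) :=
  Set.range fun (f : CoordRing K) ω => evalAt ω f

/-- Zero sets and orbits pull back along `coords`, which need be neither injective nor surjective
for this. -/
theorem noeth_dual [Infinite K] {n : ℕ} (hn : 2 ≤ n) {f : MvPolynomial (Finset Idx) K}
    (hf : f ∈ MvPolynomial.supported K (planeSet n)) (hf0 : f ≠ 0) :
    Noeth (dualGroup K) (dualFun K)
      (van (dualGroup K) (fun ω => MvPolynomial.eval (coords ω) f)) := by
  refine (noeth_van (ε := sgnConst K) sgnConst_ne_zero hn hf hf0).transfer coords ?_ ?_ ?_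
  · intro ω hω e' he'
    obtain ⟨e, he, h⟩ := exists_lift he'
    rw [← h]
    exact hω e he
  · intro e' he'
    obtain ⟨e, he, h⟩ := exists_lift he'
    exact ⟨e, he, fun ω hω => ⟨van_stable he hω, h ω⟩⟩
  · rintro _ ⟨f, rfl⟩
    obtain ⟨f', hf', h⟩ := exists_polyFun_evalAt f
    exact ⟨f', hf', fun ω _ => by
      change evalAt ω f = 0 ↔ _
      rw [h]⟩

end Transfer

end PluckerLimit

end

noncomputable section

namespace PluckerLimit

/-! ### The determinant pairing, Hodge duals and volume forms. -/

section Pairing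

universe u

variable {K : Type u} [Field K]
variable {V W : Type u} [AddCommGroup V] [Module K V] [AddCommGroup W] [Module K W]

open exteriorPower

theorem append_comp_inl_inr {α : Type*} {r s : ℕ} (w : Fin r ⊕ Fin s → α) :
    Fin.append (w ∘ Sum.inl) (w ∘ Sum.inr) = w ∘ finSumFinEquiv.symm := by
  funext i
  refine Fin.addCases (fun i => ?_) (fun i => ?_) i <;> simp

theorem wedge_ιMulti_ιMulti {r s : ℕ} (v : Fin r → V) (w : Fin s → V) :
    wedge (ιMulti K r v) (ιMulti K s w) = ιMulti K (r + s) (Fin.append v w) :=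
  Subtype.ext (ExteriorAlgebra.ιMulti_mul_ιMulti v w)

theorem pairingDual_map {n : ℕ} (f : V →ₗ[K] W) (η : ⋀[K]^n (Module.Dual K W)) (m : ⋀[K]^n V) :
    pairingDual K V n (map n f.dualMap η) m = pairingDual K W n η (map n f m) := by
  have h : pairingDual K V n ∘ₗ map n f.dualMap =
      (map n f).dualMap ∘ₗ pairingDual K W n := by
    ext y v
    simp
  exact congr($h η m)

theorem pairingDual_map_eval {n : ℕ} (m : ⋀[K]^n V) (η : ⋀[K]^n (Module.Dual K V)) :
    pairingDual K (Module.Dual K V) n (map n (Module.Dual.eval K V) m) η =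
      pairingDual K V n η m := by
  have h : pairingDual K (Module.Dual K V) n ∘ₗ map n (Module.Dual.eval K V) =
      (pairingDual K V n).flip := by
    ext v y
    simp only [LinearMap.compAlternatingMap_apply, LinearMap.comp_apply, map_apply_ιMulti,
      pairingDual_ιMulti_ιMulti, LinearMap.flip_apply]
    rw [← Matrix.det_transpose]
    rfl
  exact congr($h m η)

theorem pairingDual_bijective [FiniteDimensional K V] (n : ℕ) :
    Function.Bijective (pairingDual K V n) := by
  have hs : Function.Surjective (pairingDual K V n) := by
    let b := Module.finBasis K V
    intro φ
    refine ⟨∑ s, φ (b.exteriorPower n s) • ιMulti_family K n b.coord s, ?_⟩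
    rw [map_sum]
    conv_rhs => rw [← (b.exteriorPower n).sum_dual_apply_smul_coord φ]
    refine Finset.sum_congr rfl fun s _ => ?_
    rw [map_smul, basis_coord]
    rfl
  refine ⟨(LinearMap.injective_iff_surjective_of_finrank_eq_finrank ?_).2 hs, hs⟩
  rw [Subspace.dual_finrank_eq, finrank_eq, finrank_eq, Subspace.dual_finrank_eq]

theorem exists_hodgeDual [FiniteDimensional K V] {p n : ℕ} (hV : Module.finrank K V = p + n)
    (ψ : ⋀[K]^(p + n) V ≃ₗ[K] K) :
    ∃ star : ⋀[K]^p V →ₗ[K] ⋀[K]^n (Module.Dual K V), IsHodgeDual star ∧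
      ∀ ω η, pairingDual K V n (star ω) η = ψ (wedge ω η) := by
  let B : ⋀[K]^p V →ₗ[K] ⋀[K]^n V →ₗ[K] K := LinearMap.mk₂ K (fun ω η => ψ (wedge ω η))
    (fun ω ω' η => by rw [← map_add]; congr 1; exact Subtype.ext (add_mul _ _ _))
    (fun c ω η => by rw [← map_smul]; congr 1; exact Subtype.ext (smul_mul_assoc _ _ _))
    (fun ω η η' => by rw [← map_add]; congr 1; exact Subtype.ext (mul_add _ _ _))
    (fun c ω η => by rw [← map_smul]; congr 1; exact Subtype.ext (mul_smul_comm _ _ _))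
  let P := LinearEquiv.ofBijective (pairingDual K V n) (pairingDual_bijective n)
  have h : ∀ ω η, pairingDual K V n ((P.symm.toLinearMap ∘ₗ B) ω) η = ψ (wedge ω η) := by
    intro ω η
    have : pairingDual K V n (P.symm (B ω)) = B ω := P.apply_symm_apply (B ω)
    exact congr($this η)
  exact ⟨P.symm.toLinearMap ∘ₗ B, ⟨hV, ψ, h⟩, h⟩

theorem exists_volume {d : ℕ} (b : Module.Basis (Fin d) K V) :
    ∃ ψ : ⋀[K]^d V ≃ₗ[K] K, ψ (ιMulti K d b) = 1 := by
  have : FiniteDimensional K V := b.finiteDimensional_of_finite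
  have hd : Module.finrank K V = d := by
    rw [Module.finrank_eq_card_basis b, Fintype.card_fin]
  have h1 : Module.finrank K (⋀[K]^d V) = Module.finrank K K := by
    rw [finrank_eq, hd, Nat.choose_self, Module.finrank_self]
  have h2 : pairingDual K V d (ιMulti K d b.coord) (ιMulti K d b) = 1 := by
    rw [pairingDual_ιMulti_ιMulti]
    have h : (Matrix.of fun i j => b.coord j (b i)) = (1 : Matrix (Fin d) (Fin d) K) := by
      ext i j
      simp [Matrix.one_apply, Finsupp.single_apply]
    rw [h, Matrix.det_one]
  have h3 : Function.Surjective (pairingDual K V d (ιMulti K d b.coord)) := fun c =>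
    ⟨c • ιMulti K d b, by rw [map_smul, h2, smul_eq_mul, mul_one]⟩
  exact ⟨LinearEquiv.ofBijective _
    ⟨(LinearMap.injective_iff_surjective_of_finrank_eq_finrank h1).2 h3, h3⟩, h2⟩

theorem ιMulti_comp_perm {ι : Type*} [Fintype ι] [DecidableEq ι] {d : ℕ} (κ : Fin d ≃ ι)
    (w : ι → V) (σ : Equiv.Perm ι) :
    ιMulti K d ((w ∘ σ) ∘ κ) = Equiv.Perm.sign σ • ιMulti K d (w ∘ κ) :=
  ((ιMulti K d).domDomCongr κ).map_perm w σ

/-- Wedging with a part of a basis picks out one coordinate. -/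
theorem wedge_eq_smul {r s : ℕ} (b : Module.Basis (Fin r ⊕ Fin s) K V)
    (f : Fin r → Module.Dual K V) (hl : ∀ i j, f i (b (Sum.inl j)) = if j = i then 1 else 0)
    (hr : ∀ i j, f i (b (Sum.inr j)) = 0) (η : ⋀[K]^r V) :
    wedge η (ιMulti K s (b ∘ Sum.inr)) =
      pairingDual K V r (ιMulti K r f) η • ιMulti K (r + s) (b ∘ finSumFinEquiv.symm) := by
  let T₁ : ⋀[K]^r V →ₗ[K] ⋀[K]^(r + s) V :=
    { toFun := fun η => wedge η (ιMulti K s (b ∘ Sum.inr))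
      map_add' := fun η η' => Subtype.ext (add_mul _ _ _)
      map_smul' := fun c η => Subtype.ext (smul_mul_assoc _ _ _) }
  let T₂ : ⋀[K]^r V →ₗ[K] ⋀[K]^(r + s) V :=
    (pairingDual K V r (ιMulti K r f)).smulRight (ιMulti K (r + s) (b ∘ finSumFinEquiv.symm))
  suffices h : T₁ = T₂ from congr($h η)
  refine linearMap_ext (b.ext_alternating fun k hk => ?_)
  change wedge (ιMulti K r fun i => b (k i)) _ = pairingDual K V r _ (ιMulti K r fun i => b (k i)) • _
  rw [wedge_ιMulti_ιMulti, pairingDual_ιMulti_ιMulti]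
  -- If a vector of the second block occurs, the left side has a repeated factor and the determinant
  -- a zero row. Otherwise the first block is permuted, and both sides acquire the same sign.
  by_cases h : ∃ i j, k i = Sum.inr j
  · obtain ⟨i, j, hij⟩ := h
    rw [Matrix.det_eq_zero_of_row_eq_zero i, zero_smul]
    · refine (ιMulti K (r + s)).map_eq_zero_of_eq _ (i := Fin.castAdd s i) (j := Fin.natAdd r j)
        ?_ ?_
      · rw [Fin.append_left, Fin.append_right, hij]
        rfl
      · intro h
        have := congr(($h).1)
        simp only [Fin.val_castAdd, Fin.val_natAdd] at this
        omega
    · intro j'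
      rw [Matrix.of_apply, hij, hr]
  · have h' : ∀ i, ∃ j, k i = Sum.inl j := fun i => by
      rcases hki : k i with j | j
      · exact ⟨j, rfl⟩
      · exact absurd ⟨i, j, hki⟩ h
    choose σ hσ using h'
    have hσi : Function.Injective σ := fun i j hij => hk (by rw [hσ, hσ, hij])
    let τ : Equiv.Perm (Fin r) := Equiv.ofBijective σ (Finite.injective_iff_bijective.1 hσi)
    have h1 : (Matrix.of fun i j => f j (b (k i))) =
        (1 : Matrix (Fin r) (Fin r) K).submatrix τ id := by
      ext i j
      rw [Matrix.of_apply, hσ, hl, Matrix.submatrix_apply, Matrix.one_apply]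
      rfl
    rw [h1, Matrix.det_permute, Matrix.det_one, mul_one, ← append_comp_inl_inr,
      ← wedge_ιMulti_ιMulti, ← wedge_ιMulti_ιMulti]
    have h2 : (fun i => b (k i)) = (b ∘ Sum.inl) ∘ τ := by
      funext i
      simp [hσ, τ]
    rw [h2]
    have h3 := ιMulti_comp_perm (K := K) (Equiv.refl (Fin r)) (b ∘ Sum.inl) τ
    simp only [Equiv.coe_refl, Function.comp_id] at h3
    rw [h3]
    apply Subtype.ext
    rcases Int.units_eq_one_or (Equiv.Perm.sign τ) with h | h <;> simp [h, wedge]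

theorem exists_perm_extend {n p : ℕ} {k : Fin p → Fin n ⊕ Fin p} (hk : Function.Injective k) :
    ∃ σ : Equiv.Perm (Fin n ⊕ Fin p), ∀ i, σ (Sum.inr i) = k i := by
  let e : {x : Fin n ⊕ Fin p // x ∈ Set.range Sum.inr} ≃
      {x : Fin n ⊕ Fin p // x ∈ Set.range k} :=
    (Equiv.ofInjective _ Sum.inr_injective).symm.trans (Equiv.ofInjective k hk)
  refine ⟨e.extendSubtype, fun i => ?_⟩
  rw [Equiv.extendSubtype_apply_of_mem _ _ ⟨i, rfl⟩]
  have : (Equiv.ofInjective (Sum.inr : Fin p → Fin n ⊕ Fin p) Sum.inr_injective).symm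
      ⟨Sum.inr i, ⟨i, rfl⟩⟩ = i := by
    rw [Equiv.symm_apply_eq]
    rfl
  simp only [e, Equiv.trans_apply, this]
  rfl

end Pairing

end PluckerLimit

end

noncomputable section

namespace PluckerLimit

/-! ### Contraction by means of two Hodge duals. -/

section Contraction

universe u

variable {K : Type u} [Field K]
variable {V W : Type u} [AddCommGroup V] [Module K V] [AddCommGroup W] [Module K W]

open exteriorPower

/-- Reordering the blocks of an index set. -/
def blockEquiv (n p l : ℕ) : Fin (p + l) ⊕ Fin n ≃ (Fin n ⊕ Fin p) ⊕ Fin l where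
  toFun := Sum.elim (fun i => Sum.map Sum.inr id (finSumFinEquiv.symm i)) (Sum.inl ∘ Sum.inl)
  invFun := Sum.elim (Sum.elim Sum.inr (fun i => Sum.inl (finSumFinEquiv (Sum.inl i))))
    (fun i => Sum.inl (finSumFinEquiv (Sum.inr i)))
  left_inv i := by
    rcases i with i | i
    · obtain ⟨i | i, rfl⟩ := finSumFinEquiv.surjective i <;> simp
    · simp
  right_inv i := by
    rcases i with (i | i) | i <;> simp

/-- Plücker varieties are stable under contraction with the wedge product of a part of a basis. -/
theorem PluckerVariety.exists_contraction (X : PluckerVariety K) [FiniteDimensional K V]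
    [FiniteDimensional K W] {n p l : ℕ} (e : Module.Basis (Fin n ⊕ Fin p) K V)
    (E : Module.Basis ((Fin n ⊕ Fin p) ⊕ Fin l) K W) (i : V →ₗ[K] W)
    (hi : ∀ j, i (e j) = E (Sum.inl j)) {η : ⋀[K]^(p + l) (Module.Dual K W)}
    (hη : η ∈ X.inst (p + l) (Module.Dual K W)) :
    ∃ η' ∈ X.inst p (Module.Dual K V), ∀ m, pairingDual K V p η' m =
      pairingDual K W (p + l) η (wedge (map p i m) (ιMulti K l (E ∘ Sum.inr))) := by
  let π : W →ₗ[K] V := E.constr K (Sum.elim e 0)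
  have hπl : ∀ j, π (E (Sum.inl j)) = e j := fun j => by
    rw [E.constr_basis]
    rfl
  have hπr : ∀ j, π (E (Sum.inr j)) = 0 := fun j => by
    rw [E.constr_basis]
    rfl
  have hπ : ∀ j, π.dualMap (e.coord j) = E.coord (Sum.inl j) := by
    intro j
    refine E.ext fun k => ?_
    rw [LinearMap.dualMap_apply]
    rcases k with k | k
    · rw [hπl, e.coord_apply, E.coord_apply, e.repr_self, E.repr_self, Finsupp.single_apply,
        Finsupp.single_apply]
      simp
    · rw [hπr, map_zero, E.coord_apply, E.repr_self, Finsupp.single_apply, if_neg (by simp)]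
  let E' := E.dualBasis
  have hE' : ∀ j, E' j = E.coord j := fun j => congr($(E.coe_dualBasis) j)
  have hdimW : Module.finrank K (Module.Dual K W) = p + l + n := by
    rw [Subspace.dual_finrank_eq, Module.finrank_eq_card_basis E]
    simp
    ring
  have hdimV : Module.finrank K V = n + p := by
    rw [Module.finrank_eq_card_basis e]
    simp
  -- The volume forms are normalised on orderings matched by `blockEquiv`, so that no sign is left
  -- over in the end.
  obtain ⟨ψ₁, hψ₁⟩ := exists_volume
    (E'.reindex ((blockEquiv n p l).symm.trans finSumFinEquiv))
  obtain ⟨ψ₂, hψ₂⟩ := exists_volume (e.reindex finSumFinEquiv)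
  obtain ⟨star₁, hs₁, h₁⟩ := exists_hodgeDual hdimW ψ₁
  obtain ⟨star₂, hs₂, h₂⟩ := exists_hodgeDual hdimV ψ₂
  -- The contraction of `η` is obtained by a Hodge dual on `W*`, the projection to `V` killing the
  -- last `l` basis vectors, and a Hodge dual on `V`. Each of the three maps preserves `X`.
  let ρ : Module.Dual K (Module.Dual K W) →ₗ[K] V :=
    π ∘ₗ (Module.evalEquiv K W).symm.toLinearMap
  let ζ := map n ρ (star₁ η)
  have hζ : ∀ θ, pairingDual K V n θ ζ = ψ₁ (wedge η (map n π.dualMap θ)) := by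
    intro θ
    have hρ : Module.Dual.eval K V ∘ₗ ρ = π.dualMap.dualMap := by
      ext y θ
      obtain ⟨w, rfl⟩ := (Module.evalEquiv K W).surjective y
      simp [ρ]
    rw [← h₁, ← pairingDual_map_eval, ← pairingDual_map, ← hρ, exteriorPower.map_comp]
    rfl
  refine ⟨star₂ ζ, X.hodge_mem _ _ _ star₂ hs₂ (X.map_mem _ _ _ ρ
    (X.hodge_mem _ _ _ star₁ hs₁ hη)), fun m => ?_⟩
  let T : ⋀[K]^p V →ₗ[K] ⋀[K]^(p + l) W :=
    { toFun := fun m => wedge (map p i m) (ιMulti K l (E ∘ Sum.inr))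
      map_add' := fun m m' => Subtype.ext (by simp [wedge, add_mul])
      map_smul' := fun c m => Subtype.ext (by simp [wedge]) }
  suffices h : pairingDual K V p (star₂ ζ) = pairingDual K W (p + l) η ∘ₗ T from congr($h m)
  refine linearMap_ext (e.ext_alternating fun k hk => ?_)
  obtain ⟨σ, hσ⟩ := exists_perm_extend hk
  obtain rfl : (fun i => σ (Sum.inr i)) = k := funext hσ
  rw [LinearMap.compAlternatingMap_apply, LinearMap.compAlternatingMap_apply,
    LinearMap.comp_apply]
  have hv : (fun i => e (σ (Sum.inr i))) = e.reindex σ.symm ∘ Sum.inr := by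
    funext j
    simp
  conv_lhs => rw [hv]
  have hD : ∀ (a b : (Fin n ⊕ Fin p) ⊕ Fin l),
      Module.Dual.eval K W (E a) (E' b) = if b = a then 1 else 0 := fun a b => by
    rw [Module.Dual.eval_apply, hE', E.coord_apply, E.repr_self, Finsupp.single_apply]
    exact if_congr eq_comm rfl rfl
  rw [h₂, wedge_eq_smul (e.reindex σ.symm) (fun j => e.coord (σ (Sum.inl j)))
    (fun i j => by simp [Finsupp.single_apply]) (fun i j => by simp), hζ,
    map_apply_ιMulti]
  let τ : Equiv.Perm ((Fin n ⊕ Fin p) ⊕ Fin l) := Equiv.sumCongr σ (Equiv.refl _)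
  let b := E'.reindex ((blockEquiv n p l).trans τ).symm
  have hb : π.dualMap ∘ (fun j => e.coord (σ (Sum.inl j))) = b ∘ Sum.inr := by
    funext j
    simp [b, hπ, hE', τ, blockEquiv]
  rw [hb, wedge_eq_smul b (fun j => Module.Dual.eval K W (E (τ (blockEquiv n p l (Sum.inl j)))))
    (fun i j => by
      simp only [b, Module.Basis.reindex_apply, Equiv.symm_symm, Equiv.trans_apply, hD]
      simp)
    (fun i j => by
      simp only [b, Module.Basis.reindex_apply, Equiv.symm_symm, Equiv.trans_apply, hD]
      simp)]
  have hc : pairingDual K (Module.Dual K W) (p + l) (ιMulti K (p + l)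
      fun j => Module.Dual.eval K W (E (τ (blockEquiv n p l (Sum.inl j))))) η =
      pairingDual K W (p + l) η (T (ιMulti K p fun j => e (σ (Sum.inr j)))) := by
    change _ = pairingDual K W (p + l) η (wedge (map p i _) _)
    rw [map_apply_ιMulti, wedge_ιMulti_ιMulti]
    refine Eq.trans ?_ (pairingDual_map_eval (V := W) _ η)
    rw [map_apply_ιMulti]
    congr 3
    funext j
    refine Fin.addCases (fun j => ?_) (fun j => ?_) j <;> simp [τ, blockEquiv, hi]
  rw [hc]
  -- The reordering `σ` affects both volume elements; its two signs cancel.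
  have hv₂ : ιMulti K (n + p) ((e.reindex σ.symm) ∘ finSumFinEquiv.symm) =
      Equiv.Perm.sign σ • ιMulti K (n + p) (e.reindex finSumFinEquiv) := by
    convert ιMulti_comp_perm (finSumFinEquiv (m := n) (n := p)).symm e σ using 2
    · funext j
      simp
    · congr 1
      funext j
      simp
  have hv₁ : ιMulti K (p + l + n) (b ∘ finSumFinEquiv.symm) =
      Equiv.Perm.sign σ • ιMulti K (p + l + n)
        (E'.reindex ((blockEquiv n p l).symm.trans finSumFinEquiv)) := by
    have hs : Equiv.Perm.sign τ = Equiv.Perm.sign σ := by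
      rw [Equiv.Perm.sign_sumCongr, Equiv.Perm.sign_refl, mul_one]
    rw [← hs]
    convert ιMulti_comp_perm ((finSumFinEquiv (m := p + l) (n := n)).symm.trans
      (blockEquiv n p l)) E' τ using 2
    · funext j
      simp [b]
    · congr 1
      funext j
      simp
  rw [hv₁, hv₂]
  generalize ιMulti K (p + l + n)
    (E'.reindex ((blockEquiv n p l).symm.trans finSumFinEquiv)) = B₁ at hψ₁ ⊢
  generalize ιMulti K (n + p) (e.reindex finSumFinEquiv) = B₂ at hψ₂ ⊢
  change _ = pairingDual K W (p + l) η (T (ιMulti K p fun j => e (σ (Sum.inr j))))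
  rcases Int.units_eq_one_or (Equiv.Perm.sign σ) with h | h <;> simp [h, hψ₁, hψ₂]

end Contraction

end PluckerLimit

end

noncomputable section

namespace PluckerLimit

/-! ### Compatibility of levels, invariance and equations of the limit. -/

section Limit

universe u

variable {K : Type u} [Field K]

open exteriorPower

variable (K) in
theorem linearIndependent_x : LinearIndependent K (x K) :=
  Finsupp.linearIndependent_single_one K Idx

variable (K) in
theorem exists_basis_Vnp {n p : ℕ} {ι : Type*} (f : ι → Idx) (hf : Function.Injective f)
    (h : ∀ k : Idx, k ∈ Set.range f ↔ -(n : ℤ) ≤ k ∧ (k : ℤ) ≤ p) :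
    ∃ b : Module.Basis ι K (Vnp K n p), ∀ i, (b i : VInf K) = x K (f i) := by
  have hm : ∀ i, x K (f i) ∈ Vnp K n p := fun i =>
    x_mem_Vnp ((h _).1 ⟨i, rfl⟩).1 ((h _).1 ⟨i, rfl⟩).2
  have hli : LinearIndependent K fun i => (⟨x K (f i), hm i⟩ : Vnp K n p) :=
    LinearIndependent.of_comp (Vnp K n p).subtype ((linearIndependent_x K).comp f hf)
  refine ⟨Module.Basis.mk hli ?_, fun i => by rw [Module.Basis.mk_apply]⟩
  refine le_of_eq (Submodule.map_injective_of_injective (Vnp K n p).injective_subtype ?_)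
  rw [Submodule.map_span, Submodule.map_top, Submodule.range_subtype, ← Set.range_comp]
  conv_lhs => rw [Vnp]
  congr 1
  ext v
  constructor
  · rintro ⟨k, hk, rfl⟩
    obtain ⟨i, rfl⟩ := (h k).2 hk
    exact ⟨i, rfl⟩
  · rintro ⟨i, rfl⟩
    exact ⟨f i, (h _).1 ⟨i, rfl⟩, rfl⟩

/-- The index `-(k + 1)` for a natural number `k`. -/
def negIdx (k : ℕ) : Idx := ⟨-((k : ℤ) + 1), by omega⟩

/-- The enumeration of the indices in `[-n, p]`. -/
def idxSum (n p : ℕ) : Fin n ⊕ Fin p → Idx :=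
  Sum.elim (fun i => negIdx i) (fun j => posIdx j)

theorem idxSum_injective (n p : ℕ) : Function.Injective (idxSum n p) := by
  rintro (i | i) (j | j) h <;>
  · have h' := congr(($h).1)
    simp only [idxSum, Sum.elim_inl, Sum.elim_inr, negIdx, posIdx] at h'
    first
      | (exfalso; omega)
      | (congr 1; ext; omega)

theorem mem_range_idxSum {n p : ℕ} (k : Idx) :
    k ∈ Set.range (idxSum n p) ↔ -(n : ℤ) ≤ k ∧ (k : ℤ) ≤ p := by
  constructor
  · rintro ⟨i | i, rfl⟩ <;> simp only [idxSum, Sum.elim_inl, Sum.elim_inr, negIdx, posIdx] <;>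
      omega
  · rintro ⟨h1, h2⟩
    rcases lt_or_gt_of_ne k.2 with h | h
    · refine ⟨Sum.inl ⟨(-k.1).toNat - 1, by omega⟩, Subtype.ext ?_⟩
      simp only [idxSum, Sum.elim_inl, negIdx]
      omega
    · refine ⟨Sum.inr ⟨k.1.toNat - 1, by omega⟩, Subtype.ext ?_⟩
      simp only [idxSum, Sum.elim_inr, posIdx]
      omega

theorem tail_eq_ιMulti (p l : ℕ) :
    tail K p l = ExteriorAlgebra.ιMulti K l fun k => x K (posIdx (p + k)) := by
  rw [ExteriorAlgebra.ιMulti_apply, tail]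
  congr 1
  apply List.ext_getElem
  · simp
  · intro i h1 h2
    simp

/-- The transition map is an inclusion followed by wedging with `x_{p+1}, …, x_{p'}`. Its transpose
is therefore a contraction with part of a basis, followed by the map induced by the dual of an
inclusion; both preserve `X`. -/
theorem PluckerVariety.exists_restrict (X : PluckerVariety K) {a b : ℕ × ℕ} (hab : a ≤ b)
    {η : ⋀[K]^b.2 (Module.Dual K (Vnp K b.1 b.2))}
    (hη : η ∈ X.inst b.2 (Module.Dual K (Vnp K b.1 b.2))) :
    ∃ η' ∈ X.inst a.2 (Module.Dual K (Vnp K a.1 a.2)), ∀ m,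
      pairingDual K (Vnp K a.1 a.2) a.2 η' m =
        pairingDual K (Vnp K b.1 b.2) b.2 η (trans K a b hab m) := by
  obtain ⟨n, p⟩ := a
  obtain ⟨n', p'⟩ := b
  obtain ⟨hn, hp⟩ : n ≤ n' ∧ p ≤ p' := hab
  obtain ⟨l, rfl⟩ := Nat.exists_eq_add_of_le hp
  dsimp only at *
  obtain ⟨e, he⟩ := exists_basis_Vnp K (idxSum n' p) (idxSum_injective _ _) mem_range_idxSum
  let f : (Fin n' ⊕ Fin p) ⊕ Fin l → Idx := fun j =>
    idxSum n' (p + l) ((Equiv.sumAssoc _ _ _).trans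
      (Equiv.sumCongr (Equiv.refl _) finSumFinEquiv) j)
  obtain ⟨E, hE⟩ := exists_basis_Vnp (n := n') (p := p + l) K f
    ((idxSum_injective _ _).comp (Equiv.injective _)) (fun k => by
      rw [← mem_range_idxSum]
      exact iff_of_eq (congrArg (k ∈ ·) (EquivLike.range_comp _ _)))
  let i := Submodule.inclusion (Vnp_mono K (le_refl n') (Nat.le_add_right p l))
  have hi : ∀ j, i (e j) = E (Sum.inl j) := by
    intro j
    apply Subtype.ext
    rw [hE]
    change (e j).1 = _
    rw [he]
    rcases j with j | j <;> rfl
  obtain ⟨η', hη', h⟩ := X.exists_contraction e E i hi hη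
  refine ⟨map p (Submodule.inclusion (Vnp_mono K hn (le_refl p))).dualMap η',
    X.map_mem _ _ _ _ hη', fun m => ?_⟩
  rw [pairingDual_map, h]
  congr 1
  apply Subtype.ext
  apply map_subtype_injective (K := K) (n', p + l)
  rw [map_subtype_trans, wedge, map_mul, coe_map, coe_map]
  congr 1
  · rw [← AlgHom.comp_apply, ← AlgHom.comp_apply, ExteriorAlgebra.map_comp_map,
      ExteriorAlgebra.map_comp_map]
    rfl
  · dsimp only
    rw [Nat.add_sub_cancel_left, ιMulti_apply_coe, ExteriorAlgebra.map_apply_ιMulti,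
      tail_eq_ιMulti]
    congr 1
    funext k
    exact hE _

theorem PluckerVariety.mem_limit {X : PluckerVariety K} {ω : Module.Dual K (InfWedge K)} :
    ω ∈ X.limit ↔ ∀ a : ℕ × ℕ, ∃ η ∈ X.inst a.2 (Module.Dual K (Vnp K a.1 a.2)),
      ∀ m, pairingDual K (Vnp K a.1 a.2) a.2 η m = ω (toInfWedge K a m) := by
  constructor
  · intro h a
    obtain ⟨η, hη, h⟩ := h a.1 a.2
    exact ⟨η, hη, fun m => congr($h m)⟩
  · intro h n p
    obtain ⟨η, hη, h⟩ := h (n, p)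
    exact ⟨η, hη, LinearMap.ext h⟩

theorem infWedgeRep_toInfWedge (g : GInf K) {a : ℕ × ℕ} (hg : g.1 ∈ Gnp K a)
    (m : ⋀[K]^a.2 (Vnp K a.1 a.2)) :
    infWedgeRep K g (toInfWedge K a m) = toInfWedge K a (extAct a g.1 hg m) :=
  act_toInfWedge g a hg m

/-- At a level above `a` where `g` is defined, `g` acts through a linear map, whose dual preserves
`X`. The result is then restricted to the level `a`. -/
theorem PluckerVariety.comp_mem_limit (X : PluckerVariety K) {ω : Module.Dual K (InfWedge K)}
    (hω : ω ∈ X.limit) (g : GInf K) : ω ∘ₗ infWedgeRep K g ∈ X.limit := by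
  rw [mem_limit] at hω ⊢
  intro a
  obtain ⟨b, hab, hg⟩ : ∃ b, a ≤ b ∧ g.1 ∈ Gnp K b := by
    obtain ⟨c, hc⟩ := g.2
    exact ⟨a ⊔ c, le_sup_left, Gnp_mono le_sup_right hc⟩
  obtain ⟨η, hη, h⟩ := hω b
  obtain ⟨η', hη', h'⟩ := X.exists_restrict hab (X.map_mem _ _ _ (restr b g.1 hg).dualMap hη)
  refine ⟨η', hη', fun m => ?_⟩
  rw [h', pairingDual_map, h, LinearMap.comp_apply, ← toInfWedge_trans a b hab,
    infWedgeRep_toInfWedge g hg]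
  rfl

theorem exists_polyFun_of_span {ι W : Type*} [AddCommGroup W] [Module K W]
    (y : ι → Module.Dual K W) {S : Set ι} (hy : Submodule.span K (y '' S) = ⊤)
    (F : SymmetricAlgebra K (Module.Dual K W)) :
    ∃ f ∈ polyFun K S, ∀ w, SymmetricAlgebra.lift (Module.Dual.eval K W w) F =
      f fun i => y i w := by
  induction F using SymmetricAlgebra.induction with
  | algebraMap r => exact ⟨_, (polyFun K S).algebraMap_mem r, fun ω => by simp⟩
  | ι z =>
    have hz : z ∈ (⊤ : Submodule K (Module.Dual K W)) := trivial
    simp only [SymmetricAlgebra.lift_ι_apply, Module.Dual.eval_apply]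
    rw [← hy] at hz
    induction hz using Submodule.span_induction with
    | mem z h =>
      obtain ⟨D, hD, rfl⟩ := h
      exact ⟨_, coord_mem_polyFun hD, fun ω => rfl⟩
    | zero => exact ⟨0, zero_mem _, fun ω => rfl⟩
    | add _ _ _ _ h1 h2 =>
      obtain ⟨f1, hf1, h1⟩ := h1
      obtain ⟨f2, hf2, h2⟩ := h2
      exact ⟨f1 + f2, add_mem hf1 hf2, fun ω => by rw [LinearMap.add_apply, h1, h2]; rfl⟩
    | smul c _ _ h =>
      obtain ⟨f1, hf1, h1⟩ := h
      exact ⟨c • f1, (polyFun K S).smul_mem hf1 c, fun ω => by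
        rw [LinearMap.smul_apply, h1]; rfl⟩
  | mul _ _ h1 h2 =>
    obtain ⟨f1, hf1, h1⟩ := h1
    obtain ⟨f2, hf2, h2⟩ := h2
    exact ⟨f1 * f2, mul_mem hf1 hf2, fun ω => by rw [map_mul, h1, h2]; rfl⟩
  | add _ _ h1 h2 =>
    obtain ⟨f1, hf1, h1⟩ := h1
    obtain ⟨f2, hf2, h2⟩ := h2
    exact ⟨f1 + f2, add_mem hf1 hf2, fun ω => by rw [map_add, h1, h2]; rfl⟩

theorem pairingDual_flip_surjective {V : Type u} [AddCommGroup V] [Module K V]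
    [FiniteDimensional K V] (n : ℕ) : Function.Surjective (pairingDual K V n).flip := by
  intro ℓ
  let P := LinearEquiv.ofBijective _ (pairingDual_bijective (K := K) (V := V) n)
  obtain ⟨z, hz⟩ := (Module.evalEquiv K (⋀[K]^n V)).surjective (ℓ ∘ₗ P.symm.toLinearMap)
  refine ⟨z, LinearMap.ext fun η => ?_⟩
  have h : P η z = ℓ (P.symm (P η)) := congr($hz (P η))
  rw [P.symm_apply_apply] at h
  exact h

theorem exists_polynomial_of_span {V : Type u} [AddCommGroup V] [Module K V]
    [FiniteDimensional K V] {n : ℕ} {ι : Type*} (y : ι → ⋀[K]^n V) {S : Set ι}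
    (hy : Submodule.span K (y '' S) = ⊤)
    (F : SymmetricAlgebra K (Module.Dual K (⋀[K]^n (Module.Dual K V)))) :
    ∃ f ∈ MvPolynomial.supported K S, ∀ η,
      SymmetricAlgebra.lift (Module.Dual.eval K _ η) F =
        MvPolynomial.eval (fun i => pairingDual K V n η (y i)) f := by
  have hy' : Submodule.span K ((fun i => (pairingDual K V n).flip (y i)) '' S) = ⊤ := by
    apply_fun Submodule.map (pairingDual K V n).flip at hy
    rwa [Submodule.map_span, Submodule.map_top, ← Set.image_comp,
      LinearMap.range_eq_top.2 (pairingDual_flip_surjective _)] at hy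
  obtain ⟨f, hf, h⟩ := exists_polyFun_of_span _ hy' F
  obtain ⟨f', hf', h'⟩ := mem_polyFun.1 hf
  exact ⟨f', hf', fun η => (h η).trans (h' _)⟩

/-- A closed subset of `⋀^n V*` is cut out by polynomials in the coordinates given by a spanning
family of `⋀^n V`. -/
theorem IsZariskiClosed.exists_polynomials {V : Type u} [AddCommGroup V] [Module K V]
    [FiniteDimensional K V] {n : ℕ} {Z : Set (⋀[K]^n (Module.Dual K V))}
    (hZ : IsZariskiClosed K Z) {ι : Type*} (y : ι → ⋀[K]^n V) {S : Set ι}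
    (hy : Submodule.span K (y '' S) = ⊤) :
    ∃ T : Set (MvPolynomial ι K), (∀ f ∈ T, f ∈ MvPolynomial.supported K S) ∧
      ∀ η, η ∈ Z ↔ ∀ f ∈ T, MvPolynomial.eval (fun i => pairingDual K V n η (y i)) f = 0 := by
  obtain ⟨R, rfl⟩ := hZ
  refine ⟨{f | f ∈ MvPolynomial.supported K S ∧ ∀ η, (∀ F ∈ R,
    SymmetricAlgebra.lift (Module.Dual.eval K _ η) F = 0) →
      MvPolynomial.eval (fun i => pairingDual K V n η (y i)) f = 0}, fun f hf => hf.1,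
    fun η => ⟨fun h f hf => hf.2 η h, fun h F hF => ?_⟩⟩
  obtain ⟨f, hf, h1⟩ := exists_polynomial_of_span y hy F
  rw [h1]
  exact h f ⟨hf, fun η' h' => by rw [← h1]; exact h' F hF⟩

theorem PluckerVariety.exists_polynomials (X : PluckerVariety K) (a : ℕ × ℕ) :
    ∃ T : Set (MvPolynomial (Finset Idx) K), (∀ f ∈ T, f ∈ MvPolynomial.supported K (levelSet a)) ∧
      ∀ η, η ∈ X.inst a.2 (Module.Dual K (Vnp K a.1 a.2)) ↔ ∀ f ∈ T,
        MvPolynomial.eval (fun D => pairingDual K _ _ η (levelMonomial K a D)) f = 0 :=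
  (X.isZariskiClosed _ _).exists_polynomials (levelMonomial K a) (span_levelMonomial K a)

/-- Evaluation of a polynomial on `⋀^p V_{n,p}^*` at the restriction of a point of the dual
infinite wedge. -/
theorem eval_coords_eq {a : ℕ × ℕ} {ω : Module.Dual K (InfWedge K)}
    {η : ⋀[K]^a.2 (Module.Dual K (Vnp K a.1 a.2))}
    (h : ∀ m, pairingDual K _ _ η m = ω (toInfWedge K a m)) {f : MvPolynomial (Finset Idx) K}
    (hf : f ∈ MvPolynomial.supported K (levelSet a)) :
    MvPolynomial.eval (fun D => pairingDual K _ _ η (levelMonomial K a D)) f =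
      MvPolynomial.eval (coords ω) f :=
  eval_eq_of_supported hf fun D hD => by
    rw [h, toInfWedge_levelMonomial hD]
    rfl

theorem exists_coordRing (f : MvPolynomial (Finset Idx) K) :
    ∃ F : CoordRing K, ∀ ω, evalAt ω F = MvPolynomial.eval (coords ω) f := by
  refine ⟨MvPolynomial.aeval (fun D => SymmetricAlgebra.ι K _ (monomial K D)) f, fun ω => ?_⟩
  have h : (evalAt ω).comp (MvPolynomial.aeval fun D => SymmetricAlgebra.ι K _ (monomial K D)) =
      MvPolynomial.aeval (coords ω) := by
    ext D
    simp only [AlgHom.comp_apply, MvPolynomial.aeval_X, evalAt_ι]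
    rfl
  rw [eval_eq_aeval]
  exact congr($h f)

/-- The limit is cut out by the coordinate functions vanishing on it. -/
theorem PluckerVariety.mem_limit_of_vanish (X : PluckerVariety K)
    {ω : Module.Dual K (InfWedge K)}
    (h : ∀ F : CoordRing K, (∀ ω' ∈ X.limit, evalAt ω' F = 0) → evalAt ω F = 0) :
    ω ∈ X.limit := by
  rw [mem_limit]
  intro a
  obtain ⟨η, hη⟩ := (pairingDual_bijective (K := K) (V := Vnp K a.1 a.2) a.2).2
    (ω ∘ₗ toInfWedge K a)
  have hη' : ∀ m, pairingDual K _ _ η m = ω (toInfWedge K a m) := fun m => congr($hη m)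
  refine ⟨η, ?_, hη'⟩
  obtain ⟨T, hT, hT'⟩ := X.exists_polynomials a
  rw [hT']
  intro f hf
  obtain ⟨F, h1⟩ := exists_coordRing f
  rw [eval_coords_eq hη' (hT f hf), ← h1]
  refine h F fun ω' hω' => ?_
  obtain ⟨η', hX, h2⟩ := mem_limit.1 hω' a
  rw [h1, ← eval_coords_eq h2 (hT f hf)]
  exact (hT' η').1 hX f hf

theorem exists_surjective_of_finrank_le {V W : Type u} [AddCommGroup V] [Module K V]
    [AddCommGroup W] [Module K W] [FiniteDimensional K V] [FiniteDimensional K W]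
    (h : Module.finrank K W ≤ Module.finrank K V) :
    ∃ f : V →ₗ[K] W, Function.Surjective f := by
  let b := Module.finBasis K V
  let c := Module.finBasis K W
  let f := b.constr K fun i => if hi : i.1 < Module.finrank K W then c ⟨i, hi⟩ else 0
  refine ⟨f, LinearMap.range_eq_top.1 (eq_top_iff.2 ?_)⟩
  rw [← c.span_eq, Submodule.span_le]
  rintro _ ⟨i, rfl⟩
  refine ⟨b ⟨i, i.2.trans_le h⟩, ?_⟩
  rw [b.constr_basis, dif_pos i.2]

/-- A surjection onto `V` lifts a point outside `X.inst a.2 V` to a point outside the instance at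
level `a`. Some equation at that level is nonzero at the lifted point, hence a nonzero polynomial.
-/
theorem PluckerVariety.exists_polynomial_level (X : PluckerVariety K) {a : ℕ × ℕ} {V : Type u}
    [AddCommGroup V] [Module K V] [FiniteDimensional K V] (hV : X.inst a.2 V ≠ Set.univ)
    (hdim : Module.finrank K V ≤ Module.finrank K (Module.Dual K (Vnp K a.1 a.2))) :
    ∃ f ∈ MvPolynomial.supported K (levelSet a), f ≠ 0 ∧
      ∀ ω ∈ X.limit, MvPolynomial.eval (coords ω) f = 0 := by
  obtain ⟨g, hg⟩ := exists_surjective_of_finrank_le hdim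
  obtain ⟨T, hT, hT'⟩ := X.exists_polynomials a
  obtain ⟨v, hv⟩ := (Set.ne_univ_iff_exists_notMem _).1 hV
  obtain ⟨η, rfl⟩ := exteriorPower.map_surjective (n := a.2) hg v
  have hη : ¬ ∀ f ∈ T,
      MvPolynomial.eval (fun D => pairingDual K _ _ η (levelMonomial K a D)) f = 0 := fun h =>
    hv (X.map_mem _ _ _ g ((hT' η).2 h))
  push Not at hη
  obtain ⟨f, hf, hf0⟩ := hη
  refine ⟨f, hT f hf, ?_, fun ω hω => ?_⟩
  · rintro rfl
    exact hf0 (map_zero _)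
  · obtain ⟨η', hX, h2⟩ := mem_limit.1 hω a
    rw [← eval_coords_eq h2 (hT f hf)]
    exact (hT' η').1 hX f hf

theorem finrank_Vnp (n p : ℕ) : Module.finrank K (Vnp K n p) = n + p := by
  obtain ⟨e, -⟩ := exists_basis_Vnp K (idxSum n p) (idxSum_injective _ _) mem_range_idxSum
  rw [Module.finrank_eq_card_basis e]
  simp

theorem PluckerVariety.IsBounded.exists_polynomial {X : PluckerVariety K} (hX : X.IsBounded) :
    ∃ n, 2 ≤ n ∧ ∃ f ∈ MvPolynomial.supported K (planeSet n), f ≠ 0 ∧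
      ∀ ω ∈ X.limit, MvPolynomial.eval (coords ω) f = 0 := by
  obtain ⟨V, _, _, _, hV⟩ := hX
  -- The level `(dim V + 2, 2)` is large enough for a surjection onto `V`, and the summand `2`
  -- ensures `2 ≤ n`. Its coordinates are precisely those in `planeSet n`.
  exact ⟨Module.finrank K V + 2, by omega, X.exists_polynomial_level
    (a := (Module.finrank K V + 2, 2)) hV (by
      rw [Subspace.dual_finrank_eq, finrank_Vnp]
      omega)⟩

end Limit

end PluckerLimit

end

/-! ### Finitely many equations up to `G_∞`. -/

theorem corollary6p5 {K : Type*} [Field K] [Infinite K]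
    (X : PluckerLimit.PluckerVariety K) (hX : X.IsBounded) :
    ∃ S : Finset (PluckerLimit.CoordRing K),
      X.limit =
        PluckerLimit.zeroSet (⋃ f ∈ S, MulAction.orbit (PluckerLimit.GInf K) f) := by
  classical
  obtain ⟨n, hn, f, hf, hf0, hfX⟩ := hX.exists_polynomial
  obtain ⟨F₀, hF₀⟩ := PluckerLimit.exists_coordRing f
  -- Among all polynomial functions vanishing on the limit, finitely many suffice within the
  -- Noetherian set of points satisfying all conjugates of `f`.
  let 𝓢 : Set (Module.Dual K (PluckerLimit.InfWedge K) → K) :=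
    {F | F ∈ PluckerLimit.dualFun K ∧ ∀ ω ∈ X.limit, F ω = 0}
  obtain ⟨T, hT, hT'⟩ := (PluckerLimit.noeth_dual hn hf hf0).exists_finset
    (fun g hg z hz => PluckerLimit.van_stable hg hz) (S := 𝓢) (fun F hF => hF.1)
  have hlift : ∀ F : T, ∃ f : PluckerLimit.CoordRing K,
      (fun ω => PluckerLimit.evalAt ω f) = F.1 := fun F => (hT F.2).1
  choose L hL using hlift
  -- The equation `F₀` must be included: it is what confines `ω` to the Noetherian set.
  refine ⟨insert F₀ (Finset.univ.image L), ?_⟩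
  have hmem : ∀ f ∈ insert F₀ (Finset.univ.image L), ∀ ω ∈ X.limit,
      PluckerLimit.evalAt ω f = 0 := by
    intro f hf ω hω
    rcases Finset.mem_insert.1 hf with rfl | hf
    · rw [hF₀]
      exact hfX ω hω
    · obtain ⟨F, -, rfl⟩ := Finset.mem_image.1 hf
      exact (congrFun (hL F) ω).trans ((hT F.2).2 ω hω)
  ext ω
  refine Iff.trans ?_ PluckerLimit.mem_zeroSet_orbit.symm
  constructor
  · intro hω f hf e he
    obtain ⟨g, hg⟩ := PluckerLimit.mem_dualGroup.1 he
    refine hmem f hf _ ?_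
    rw [hg]
    exact X.comp_mem_limit hω g
  · intro h
    refine X.mem_limit_of_vanish fun F hF => ?_
    have hZ : ω ∈ PluckerLimit.van (PluckerLimit.dualGroup K)
        (fun ω => MvPolynomial.eval (PluckerLimit.coords ω) f) := by
      have := h F₀ (Finset.mem_insert_self _ _)
      simpa only [hF₀] using this
    refine hT' ω hZ (fun F hF => ?_) _ ⟨⟨F, rfl⟩, hF⟩ 1 (one_mem _)
    have h1 := hL ⟨F, hF⟩
    dsimp only at h1
    rw [← h1]
    exact h _ (Finset.mem_insert_of_mem (Finset.mem_image_of_mem _ (Finset.mem_univ _)))
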